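/- Let $q \in (0,1]$ and $N \in \mathbb{N}_0$. Let $\mathcal{O}(SU_q(2))$ be the universal unital complex $*$-algebra with generators $a,b$ and relations $ba = qab$, $b^*a = qab^*$, $bb^* = b^*b$, $a^*a + q^2bb^* = 1 = aa^* + bb^*$, let $\Delta$ be its coproduct, determined by $\Delta(u_{ij}) = \sum_l u_{il}\otimes u_{lj}$ for $u = \begin{pmatrix} a^* & -qb \\ b^* & a\end{pmatrix}$, and let $h$ be its Haar state, i.e. the unique linear functional with $h(1)=1$, $h(x^*x)\ge 0$ and $(h\otimes 1)\Delta(x) = h(x)1 = (1\otimes h)\Delta(x)$ for all $x$. Let $L^2(SU_q(2))$ be the Hilbert space completion of $\mathcal{O}(SU_q(2))$ for $\langle x,y\rangle = h(x^*y)$, and let $\rho$ be the representation of $\mathcal{O}(SU_q(2))$ on it by left multiplication. For $n \in \mathbb{Z}$ let $\mathcal{A}_n$ be the $n$-th spectral subspace of the circle action on $\mathcal{O}(SU_q(2))$ given by $a \mapsto za$, $b \mapsto zb$ ($z \in S^1$), let $H_n$ be the closure of $\mathcal{A}_n$ in $L^2(SU_q(2))$, and put $\mathcal{O}(S_q^2)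 := \mathcal{A}_0$ (the coordinate algebra of the standard Podleś sphere), which acts on $H_1 \oplus H_{-1}$ by $\pi(x) = \rho(x)|_{H_1} \oplus \rho(x)|_{H_{-1}}$. Let $\langle k,\cdot\rangle$ and $\langle k^{-1},\cdot\rangle$ be the characters of $\mathcal{O}(SU_q(2))$ with $\langle k^{\pm1},a\rangle = q^{\pm 1/2}$, $\langle k^{\pm1},a^*\rangle = q^{\mp 1/2}$ and value $0$ on $b, b^*$, and for $\eta \in \{e,f\}$ let $\langle \eta,\cdot\rangle$ be the linear functional satisfying $\langle \eta, xy\rangle = \langle \eta,x\rangle\langle k,y\rangle + \langle k^{-1},x\rangle\langle \eta,y\rangle$ with $\langle e,b\rangle = -q^{-1}$, $\langle f,b^*\rangle = 1$ and value $0$ on the other elements of $\{a,a^*,b,b^*\}$. Put $\partial_\eta(x) := (1\otimes\langle\eta,\cdot\rangle)\Delta(x)$. Let $E$ and $F$ be the closures of the unbounded operators $\partial_e \colon \mathcal{A}_1 \to H_{-1}$ and $\partial_f \colon \mathcal{A}_{-1} \to H_{1}$, and let $D_q = \begin{pmatrix} 0 & F \\ E & 0 \end{pmatrix}$, with domain $\mathrm{Dom}(E)\oplus\mathrm{Dom}(F)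 \subseteq H_1\oplus H_{-1}$, be the Dąbrowski–Sitarz Dirac operator. For $x \in \mathcal{O}(S_q^2)$ let $\partial(x) \in \mathbb{B}(H_1\oplus H_{-1})$ be the bounded extension of the commutator $[D_q,\pi(x)]$. Finally let $h_N(x) := \big(\sum_{m=0}^{N} q^{2m}\big)\, h\big((a^*)^N x a^N\big)$, and let $\beta_N(x) := (1\otimes h_N)\Delta(x)$ be the quantum Berezin transform. Then for every $x \in \mathcal{O}(S_q^2)$: the operator $\pi(x)$ preserves $\mathrm{Dom}(D_q)$ and $[D_q,\pi(x)]$ extends to the bounded operator $\partial(x)$; the element $\beta_N(x)$ belongs to $\mathcal{O}(S_q^2)$ (so that the same holds for it); and $$\| \partial(\beta_N(x)) \| \leq \| \partial(x) \| .$$ -/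

import Mathlib

open scoped TensorProduct ComplexOrder

noncomputable section

namespace QuantumSU2

/-! ### The coordinate algebra of quantum `SU(2)` -/

/-- Names of the generators `a`, `a^*`, `b`, `b^*`. -/
inductive Gen : Type
  | a | as | b | bs

/-- The defining relations of quantum `SU(2)`, together with the adjoints of the first two (the
others are self-adjoint), for elements `a`, `as`, `b`, `bs` that play the roles of
`a`, `a^*`, `b`, `b^*`. -/
structure Relations (q : ℝ) {A : Type*} [Ring A] [Algebra ℂ A] (a as b bs : A) : Prop where
  ba : b * a = (q : ℂ) • (a * b)
  bsa : bs * a = (q : ℂ) • (a * bs)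
  asbs : as * bs = (q : ℂ) • (bs * as)
  asb : as * b = (q : ℂ) • (b * as)
  bbs : b * bs = bs * b
  asa : as * a + (q : ℂ) ^ 2 • (b * bs) = 1
  aas : a * as + b * bs = 1

/-- The same relations, between elements of the free algebra on the four generators. -/
inductive Rel (q : ℝ) : FreeAlgebra ℂ Gen → FreeAlgebra ℂ Gen → Prop
  | ba : Rel q (FreeAlgebra.ι ℂ Gen.b * FreeAlgebra.ι ℂ Gen.a)
      ((q : ℂ) • (FreeAlgebra.ι ℂ Gen.a * FreeAlgebra.ι ℂ Gen.b))
  | bsa : Rel q (FreeAlgebra.ι ℂ Gen.bs * FreeAlgebra.ι ℂ Gen.a)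
      ((q : ℂ) • (FreeAlgebra.ι ℂ Gen.a * FreeAlgebra.ι ℂ Gen.bs))
  | asbs : Rel q (FreeAlgebra.ι ℂ Gen.as * FreeAlgebra.ι ℂ Gen.bs)
      ((q : ℂ) • (FreeAlgebra.ι ℂ Gen.bs * FreeAlgebra.ι ℂ Gen.as))
  | asb : Rel q (FreeAlgebra.ι ℂ Gen.as * FreeAlgebra.ι ℂ Gen.b)
      ((q : ℂ) • (FreeAlgebra.ι ℂ Gen.b * FreeAlgebra.ι ℂ Gen.as))
  | bbs : Rel q (FreeAlgebra.ι ℂ Gen.b * FreeAlgebra.ι ℂ Gen.bs)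
      (FreeAlgebra.ι ℂ Gen.bs * FreeAlgebra.ι ℂ Gen.b)
  | asa : Rel q (FreeAlgebra.ι ℂ Gen.as * FreeAlgebra.ι ℂ Gen.a
      + (q : ℂ) ^ 2 • (FreeAlgebra.ι ℂ Gen.b * FreeAlgebra.ι ℂ Gen.bs)) 1
  | aas : Rel q (FreeAlgebra.ι ℂ Gen.a * FreeAlgebra.ι ℂ Gen.as
      + FreeAlgebra.ι ℂ Gen.b * FreeAlgebra.ι ℂ Gen.bs) 1

/-- The coordinate algebra `𝒪(SU_q(2))`: the universal unital complex `*`-algebra generated by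
`a` and `b` subject to `ba = qab`, `b^*a = qab^*`, `bb^* = b^*b`,
`a^*a + q^2bb^* = 1 = aa^* + bb^*`. -/
def Coord (q : ℝ) : Type := RingQuot (Rel q)

instance (q : ℝ) : Ring (Coord q) := inferInstanceAs (Ring (RingQuot (Rel q)))

instance (q : ℝ) : Algebra ℂ (Coord q) := inferInstanceAs (Algebra ℂ (RingQuot (Rel q)))

namespace Coord

variable (q : ℝ)

/-- The quotient map from the free algebra. -/
def mk : FreeAlgebra ℂ Gen →ₐ[ℂ] Coord q := RingQuot.mkAlgHom ℂ (Rel q)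

theorem mk_rel {x y : FreeAlgebra ℂ Gen} (h : Rel q x y) : mk q x = mk q y :=
  RingQuot.mkAlgHom_rel ℂ h

/-- The image of a generator in the coordinate algebra. -/
def gen (g : Gen) : Coord q := mk q (FreeAlgebra.ι ℂ g)

/-- The generator `a`. -/
def a : Coord q := gen q Gen.a

/-- The generator `b`. -/
def b : Coord q := gen q Gen.b

theorem relations_gen :
    Relations q (gen q Gen.a) (gen q Gen.as) (gen q Gen.b) (gen q Gen.bs) where
  ba := by simpa only [gen, map_mul, map_smul] using mk_rel q Rel.ba
  bsa := by simpa only [gen, map_mul, map_smul] using mk_rel q Rel.bsa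
  asbs := by simpa only [gen, map_mul, map_smul] using mk_rel q Rel.asbs
  asb := by simpa only [gen, map_mul, map_smul] using mk_rel q Rel.asb
  bbs := by simpa only [gen, map_mul, map_smul] using mk_rel q Rel.bbs
  asa := by simpa only [gen, map_mul, map_smul, map_add, map_one] using mk_rel q Rel.asa
  aas := by simpa only [gen, map_mul, map_smul, map_add, map_one] using mk_rel q Rel.aas

variable {q}

/-- The universal property: a quadruple satisfying the relations determines a homomorphism. -/
def lift {A : Type*} [Ring A] [Algebra ℂ A] {a as b bs : A} (h : Relations q a as b bs) :
    Coord q →ₐ[ℂ] A :=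
  RingQuot.liftAlgHom ℂ ⟨FreeAlgebra.lift ℂ (fun g => match g with
    | Gen.a => a | Gen.as => as | Gen.b => b | Gen.bs => bs), by
      intro x y hxy
      cases hxy <;> simp only [map_mul, map_smul, map_add, map_one, FreeAlgebra.lift_ι_apply]
      exacts [h.ba, h.bsa, h.asbs, h.asb, h.bbs, h.asa, h.aas]⟩

section lift

variable {A : Type*} [Ring A] [Algebra ℂ A] {a' as' b' bs' : A}
  (h : Relations q a' as' b' bs')

theorem lift_gen (g : Gen) : lift h (gen q g) = (match g with
    | Gen.a => a' | Gen.as => as' | Gen.b => b' | Gen.bs => bs') := by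
  refine (RingQuot.liftAlgHom_mkAlgHom_apply ℂ _ _ _).trans ?_
  rw [FreeAlgebra.lift_ι_apply]

end lift

theorem algHom_ext {A : Type*} [Ring A] [Algebra ℂ A] {f g : Coord q →ₐ[ℂ] A}
    (h : ∀ i, f (gen q i) = g (gen q i)) : f = g := by
  apply RingQuot.ringQuot_ext' ℂ
  ext i
  exact h i

@[elab_as_elim]
theorem induction {P : Coord q → Prop} (h0 : ∀ c : ℂ, P (algebraMap ℂ _ c))
    (hg : ∀ g, P (gen q g)) (hm : ∀ x y, P x → P y → P (x * y))
    (ha : ∀ x y, P x → P y → P (x + y)) (x : Coord q) : P x := by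
  obtain ⟨y, rfl⟩ := RingQuot.mkAlgHom_surjective ℂ (Rel q) x
  induction y using FreeAlgebra.induction with
  | grade0 c => exact ((mk q).commutes c).symm ▸ h0 c
  | grade1 g => exact hg g
  | mul x y hx hy => exact (map_mul (mk q) x y).symm ▸ hm _ _ hx hy
  | add x y hx hy => exact (map_add (mk q) x y).symm ▸ ha _ _ hx hy

end Coord

/-! ### The involution -/

/-- The opposite of an algebra with the complex-conjugate scalar action; a homomorphism
`A → ConjOp A` is a conjugate-linear antimultiplicative map `A → A`. -/
def ConjOp (A : Type*) : Type _ := Aᵐᵒᵖ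

instance (A : Type*) [Ring A] : Ring (ConjOp A) := inferInstanceAs (Ring Aᵐᵒᵖ)

instance (A : Type*) [Ring A] [Algebra ℂ A] : Algebra ℂ (ConjOp A) :=
  ((algebraMap ℂ Aᵐᵒᵖ).comp (starRingEnd ℂ)).toAlgebra'
    (fun c x => Algebra.commutes (A := Aᵐᵒᵖ) (starRingEnd ℂ c) x)

namespace ConjOp

variable {A : Type*} [Ring A]

/-- The identity map `A → ConjOp A`. -/
def mk (x : A) : ConjOp A := MulOpposite.op x

/-- The identity map `ConjOp A → A`. -/
def out (x : ConjOp A) : A := MulOpposite.unop x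

theorem mk_mul (x y : A) : mk x * mk y = mk (y * x) := rfl

theorem mk_add (x y : A) : mk x + mk y = mk (x + y) := rfl

theorem smul_mk [Algebra ℂ A] (c : ℂ) (x : A) : c • mk x = mk (starRingEnd ℂ c • x) := by
  rw [Algebra.smul_def, Algebra.smul_def, Algebra.commutes]
  rfl

end ConjOp

namespace Coord

variable {q : ℝ}

theorem relations_conjOp : Relations q (A := ConjOp (Coord q))
    (ConjOp.mk (gen q Gen.as)) (ConjOp.mk (gen q Gen.a))
    (ConjOp.mk (gen q Gen.bs)) (ConjOp.mk (gen q Gen.b)) := by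
  have h := relations_gen q
  constructor <;> simp only [ConjOp.mk_mul, ConjOp.mk_add, ConjOp.smul_mk, map_pow,
    Complex.conj_ofReal]
  · rw [h.asbs]
  · rw [h.asb]
  · rw [h.ba]
  · rw [h.bsa]
  · rw [h.bbs]
  · rw [h.asa]; rfl
  · rw [h.aas]; rfl

/-- The involution as a homomorphism into the conjugate opposite algebra. -/
def starHom : Coord q →ₐ[ℂ] ConjOp (Coord q) := lift relations_conjOp

/-- The involution of the coordinate algebra: conjugate linear, antimultiplicative, and
interchanging `a`, `a^*` and `b`, `b^*`. -/
instance : Star (Coord q) := ⟨fun x => ConjOp.out (starHom x)⟩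

theorem star_gen (g : Gen) : star (gen q g) = gen q (match g with
    | Gen.a => Gen.as | Gen.as => Gen.a | Gen.b => Gen.bs | Gen.bs => Gen.b) := by
  change ConjOp.out (lift relations_conjOp (gen q g)) = _
  rw [lift_gen]
  cases g <;> rfl

theorem star_mul' (x y : Coord q) : star (x * y) = star y * star x := by
  change ConjOp.out (starHom (x * y)) = _
  rw [map_mul]; rfl

theorem star_add' (x y : Coord q) : star (x + y) = star x + star y := by
  change ConjOp.out (starHom (x + y)) = _
  rw [map_add]; rfl

theorem star_algebraMap' (c : ℂ) :
    star (algebraMap ℂ (Coord q) c) = algebraMap ℂ (Coord q) (starRingEnd ℂ c) := by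
  change ConjOp.out (starHom (algebraMap ℂ (Coord q) c)) = _
  rw [AlgHom.commutes]; rfl

instance : StarRing (Coord q) where
  star_involutive x := by
    induction x using Coord.induction with
    | h0 c => rw [star_algebraMap', star_algebraMap', Complex.conj_conj]
    | hg g => rw [star_gen, star_gen]; cases g <;> rfl
    | hm x y hx hy => rw [star_mul', star_mul', hx, hy]
    | ha x y hx hy => rw [star_add', star_add', hx, hy]
  star_mul := star_mul'
  star_add := star_add'

instance : StarModule ℂ (Coord q) where
  star_smul c x := by
    rw [Algebra.smul_def, star_mul, star_algebraMap', Algebra.smul_def, Algebra.commutes]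
    rfl

theorem star_a : star (a q) = gen q Gen.as := star_gen _

theorem star_b : star (b q) = gen q Gen.bs := star_gen _

theorem relations : Relations q (a q) (star (a q)) (b q) (star (b q)) := by
  rw [star_a, star_b]; exact relations_gen q

/-! ### The coproduct -/

theorem relations_tensor : Relations q (A := Coord q ⊗[ℂ] Coord q)
    (a q ⊗ₜ a q - (q : ℂ) • (star (b q) ⊗ₜ b q))
    (star (a q) ⊗ₜ star (a q) - (q : ℂ) • (b q ⊗ₜ star (b q)))
    (star (a q) ⊗ₜ b q + b q ⊗ₜ a q)
    (star (b q) ⊗ₜ star (a q) + a q ⊗ₜ star (b q)) := by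
  have h := relations (q := q)
  have h1 : star (a q) * a q = 1 - (q : ℂ) ^ 2 • (b q * star (b q)) := eq_sub_of_add_eq h.asa
  have h2 : a q * star (a q) = 1 - b q * star (b q) := eq_sub_of_add_eq h.aas
  constructor <;>
  simp only [mul_add, add_mul, mul_sub, sub_mul, smul_mul_assoc, mul_smul_comm,
    Algebra.TensorProduct.tmul_mul_tmul, h.ba, h.bsa, h.asb, h.asbs, ← h.bbs, h1, h2,
    TensorProduct.sub_tmul, TensorProduct.tmul_sub, ← TensorProduct.smul_tmul', TensorProduct.tmul_smul,
    Algebra.TensorProduct.one_def] <;>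
  module

/-- The coproduct, determined by `Δ(u) = u ⊗ u` for the fundamental unitary
`u = !![a^*, -q b; b^*, a]`, that is `Δ(u_{ij}) = ∑_l u_{il} ⊗ u_{lj}`. -/
def comul : Coord q →ₐ[ℂ] Coord q ⊗[ℂ] Coord q := lift relations_tensor

/-- The slice map `1 ⊗ φ`, sending `x ⊗ y` to `φ(y) x`. -/
def sliceRight (φ : Coord q →ₗ[ℂ] ℂ) : Coord q ⊗[ℂ] Coord q →ₗ[ℂ] Coord q :=
  (TensorProduct.rid ℂ (Coord q)).toLinearMap ∘ₗ φ.lTensor (Coord q)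

/-- The slice map `φ ⊗ 1`, sending `x ⊗ y` to `φ(x) y`. -/
def sliceLeft (φ : Coord q →ₗ[ℂ] ℂ) : Coord q ⊗[ℂ] Coord q →ₗ[ℂ] Coord q :=
  (TensorProduct.lid ℂ (Coord q)).toLinearMap ∘ₗ φ.rTensor (Coord q)

theorem relations_counit : Relations q (A := ℂ) 1 1 0 0 := by
  constructor <;> simp

/-- The counit, determined by `ε(u) = 1`. -/
def counit : Coord q →ₐ[ℂ] ℂ := lift relations_counit

theorem counit_star (x : Coord q) : counit (star x) = star (counit x) := by
  induction x using Coord.induction with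
  | h0 c => rw [star_algebraMap', AlgHom.commutes, AlgHom.commutes]; rfl
  | hg g => rw [star_gen]; unfold counit; rw [lift_gen, lift_gen]; cases g <;> simp
  | hm x y hx hy => rw [star_mul, map_mul, map_mul, hx, hy, star_mul]
  | ha x y hx hy => rw [star_add, map_add, map_add, hx, hy, star_add]

/-! ### The Haar state -/

/-- A Haar state: a positive normalised functional that is left and right invariant. -/
structure IsHaarState (φ : Coord q →ₗ[ℂ] ℂ) : Prop where
  nonneg : ∀ x, 0 ≤ φ (star x * x)
  map_one : φ 1 = 1
  left_invariant : ∀ x, sliceLeft φ (comul x) = φ x • (1 : Coord q)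
  right_invariant : ∀ x, sliceRight φ (comul x) = φ x • (1 : Coord q)

variable (q) in
open Classical in
/-- The Haar state of quantum `SU(2)`: the (unique) invariant state. The value if there were no
invariant state, which does not happen for `0 < q ≤ 1`, is the counit. -/
def haar : Coord q →ₗ[ℂ] ℂ :=
  if h : ∃ φ : Coord q →ₗ[ℂ] ℂ, IsHaarState φ then h.choose else counit.toLinearMap

theorem haar_nonneg (x : Coord q) : 0 ≤ haar q (star x * x) := by
  unfold haar
  split_ifs with h
  · exact h.choose_spec.nonneg x
  · change 0 ≤ counit (star x * x)
    rw [map_mul, counit_star]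
    exact star_mul_self_nonneg _

theorem haar_star (x : Coord q) : haar q (star x) = star (haar q x) := by
  have h0 := (Complex.nonneg_iff.1 (haar_nonneg (1 : Coord q))).2
  have hx := (Complex.nonneg_iff.1 (haar_nonneg x)).2
  have h1 := (Complex.nonneg_iff.1 (haar_nonneg (1 + x))).2
  have h2 := (Complex.nonneg_iff.1 (haar_nonneg (1 + Complex.I • x))).2
  have e1 : star (1 + x) * (1 + x) = star (1 : Coord q) * 1 + star x * x + (x + star x) := by
    simp only [star_add, star_one]; noncomm_ring
  have e2 : star (1 + Complex.I • x) * (1 + Complex.I • x)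
      = star (1 : Coord q) * 1 + star x * x + (Complex.I • x - Complex.I • star x) := by
    simp only [star_add, star_one, star_smul, RCLike.star_def, Complex.conj_I, add_mul, mul_add,
      smul_mul_assoc, mul_smul_comm, one_mul, mul_one]
    match_scalars <;> simp
  rw [e1] at h1
  rw [e2] at h2
  simp only [map_add, map_sub, map_smul, Complex.add_im, Complex.sub_im, smul_eq_mul,
    Complex.mul_im, Complex.I_re, Complex.I_im] at h1 h2
  apply Complex.ext
  · rw [RCLike.star_def, Complex.conj_re]; linarith
  · rw [RCLike.star_def, Complex.conj_im]; linarith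

/-! ### The Hilbert space `L²(SU_q(2))` and the representation by left multiplication -/

end Coord

/-- The coordinate algebra with the pre-inner product `⟨x, y⟩ = h(x^* y)`. -/
def PreL2 (q : ℝ) : Type := Coord q

instance (q : ℝ) : AddCommGroup (PreL2 q) := inferInstanceAs (AddCommGroup (Coord q))

instance (q : ℝ) : Module ℂ (PreL2 q) := inferInstanceAs (Module ℂ (Coord q))

/-- The identity map from the coordinate algebra. -/
def toPreL2 (q : ℝ) : Coord q ≃ₗ[ℂ] PreL2 q := LinearEquiv.refl ℂ (Coord q)

/-- The pre-inner product `⟨x, y⟩ = h(x^* y)`. -/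
@[reducible]
def preL2Core (q : ℝ) : PreInnerProductSpace.Core ℂ (PreL2 q) where
  inner x y := Coord.haar q (star ((toPreL2 q).symm x) * (toPreL2 q).symm y)
  conj_inner_symm x y := by
    rw [← RCLike.star_def, ← Coord.haar_star, star_mul, star_star]
  re_inner_nonneg x := (Complex.nonneg_iff.1 (Coord.haar_nonneg _)).1
  add_left x y z := by rw [map_add, star_add, add_mul, map_add]
  smul_left x y r := by
    rw [map_smul, star_smul, smul_mul_assoc, map_smul, RCLike.star_def, smul_eq_mul]

instance (q : ℝ) : SeminormedAddCommGroup (PreL2 q) :=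
  letI := preL2Core q
  InnerProductSpace.Core.toSeminormedAddCommGroup (𝕜 := ℂ)

instance (q : ℝ) : InnerProductSpace ℂ (PreL2 q) := InnerProductSpace.ofCore (preL2Core q)

theorem preL2_norm_sq (q : ℝ) (x : Coord q) :
    ‖toPreL2 q x‖ ^ 2 = (Coord.haar q (star x * x)).re :=
  InnerProductSpace.norm_sq_eq_re_inner (𝕜 := ℂ) (toPreL2 q x)

theorem exists_mul_bound (q : ℝ) (x : Coord q) :
    ∃ C : ℝ, ∀ y : Coord q, ‖toPreL2 q (x * y)‖ ≤ C * ‖toPreL2 q y‖ := by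
  have key : ∀ (x z : Coord q) (r : ℝ), star x * x + (r : ℂ) ^ 2 • (star z * z) = 1 →
      ∀ y : Coord q, ‖toPreL2 q (x * y)‖ ≤ 1 * ‖toPreL2 q y‖ := by
    intro x z r h y
    have e : Coord.haar q (star y * y) = Coord.haar q (star (x * y) * (x * y))
        + (r : ℂ) ^ 2 * Coord.haar q (star (z * y) * (z * y)) := by
      rw [← smul_eq_mul (a := (r : ℂ) ^ 2), ← map_smul, ← map_add]
      congr 1
      calc star y * y = star y * (star x * x + (r : ℂ) ^ 2 • (star z * z)) * y := by
            rw [h, mul_one]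
        _ = _ := by
          simp only [star_mul, mul_add, add_mul, mul_smul_comm, smul_mul_assoc, mul_assoc]
    have e' := congrArg Complex.re e
    rw [Complex.add_re, ← Complex.ofReal_pow, Complex.re_ofReal_mul, ← preL2_norm_sq,
      ← preL2_norm_sq, ← preL2_norm_sq] at e'
    rw [one_mul]
    refine abs_le_of_sq_le_sq' ?_ (norm_nonneg _) |>.2
    nlinarith [mul_nonneg (sq_nonneg r) (sq_nonneg ‖toPreL2 q (z * y)‖)]
  have R := Coord.relations_gen q
  induction x using Coord.induction with
  | h0 c =>
    refine ⟨‖c‖, fun y => ?_⟩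
    rw [← Algebra.smul_def, map_smul, norm_smul]
  | hg g =>
    refine ⟨1, ?_⟩
    cases g
    · refine key _ (Coord.gen q Gen.bs) q ?_
      rw [Coord.star_gen, Coord.star_gen]; exact R.asa
    · refine key _ (Coord.gen q Gen.bs) 1 ?_
      rw [Coord.star_gen, Coord.star_gen]; simpa using R.aas
    · refine key _ (Coord.gen q Gen.as) 1 ?_
      rw [Coord.star_gen, Coord.star_gen]; simpa [← R.bbs, add_comm] using R.aas
    · refine key _ (Coord.gen q Gen.as) 1 ?_
      rw [Coord.star_gen, Coord.star_gen]; simpa [add_comm] using R.aas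
  | hm x y hx hy =>
    obtain ⟨C, hC⟩ := hx
    obtain ⟨D, hD⟩ := hy
    refine ⟨|C| * D, fun z => ?_⟩
    rw [mul_assoc]
    calc _ ≤ C * ‖toPreL2 q (y * z)‖ := hC _
      _ ≤ |C| * ‖toPreL2 q (y * z)‖ := by gcongr; exact le_abs_self C
      _ ≤ |C| * (D * ‖toPreL2 q z‖) := by gcongr; exact hD z
      _ = _ := by ring
  | ha x y hx hy =>
    obtain ⟨C, hC⟩ := hx
    obtain ⟨D, hD⟩ := hy
    refine ⟨C + D, fun z => ?_⟩
    rw [add_mul, map_add, add_mul]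
    exact (norm_add_le _ _).trans (add_le_add (hC z) (hD z))

/-- The Hilbert space `L²(SU_q(2))`. -/
abbrev L2 (q : ℝ) : Type := UniformSpace.Completion (PreL2 q)

/-- The canonical map `𝒪(SU_q(2)) → L²(SU_q(2))`. -/
def toL2 (q : ℝ) : Coord q →ₗ[ℂ] L2 q :=
  (UniformSpace.Completion.toComplL (𝕜 := ℂ) (E := PreL2 q)).toLinearMap ∘ₗ
    (toPreL2 q).toLinearMap

/-- Left multiplication by `x` as a bounded operator on the pre-Hilbert space. -/
def mulPreL2 {q : ℝ} (x : Coord q) : PreL2 q →L[ℂ] PreL2 q :=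
  LinearMap.mkContinuousOfExistsBound
    ((toPreL2 q).toLinearMap ∘ₗ LinearMap.mulLeft ℂ x ∘ₗ (toPreL2 q).symm.toLinearMap)
    (by
      obtain ⟨C, hC⟩ := exists_mul_bound q x
      exact ⟨C, fun y => hC ((toPreL2 q).symm y)⟩)

/-- The representation `ρ` of `𝒪(SU_q(2))` on `L²(SU_q(2))`, `ρ(x) y = x y`. -/
def rho {q : ℝ} (x : Coord q) : L2 q →L[ℂ] L2 q := (mulPreL2 x).completion

theorem rho_toL2 {q : ℝ} (x y : Coord q) : rho x (toL2 q y) = toL2 q (x * y) :=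
  ContinuousLinearMap.completion_apply_coe (mulPreL2 x) (toPreL2 q y)

/-! ### The circle action, the Podleś sphere and the spaces `H_n` -/

namespace Coord

variable {q : ℝ}

theorem relations_circle (z : Circle) : Relations q ((z : ℂ) • a q) ((z : ℂ)⁻¹ • star (a q))
    ((z : ℂ) • b q) ((z : ℂ)⁻¹ • star (b q)) := by
  have h := relations (q := q)
  have hz : (z : ℂ) ≠ 0 := Circle.coe_ne_zero z
  constructor <;> simp only [smul_mul_smul_comm, inv_mul_cancel₀ hz, mul_inv_cancel₀ hz, one_smul]
  · rw [h.ba, smul_comm]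
  · rw [h.bsa]
  · rw [h.asbs, smul_comm]
  · rw [h.asb]
  · rw [h.bbs]
  · exact h.asa
  · exact h.aas

/-- The circle action `σ_L`, determined by `a ↦ z a` and `b ↦ z b` (and therefore
`a^* ↦ z⁻¹ a^*`, `b^* ↦ z⁻¹ b^*`). -/
def circleAct (z : Circle) : Coord q →ₐ[ℂ] Coord q := lift (relations_circle z)

theorem circleAct_star (z : Circle) (x : Coord q) :
    circleAct z (star x) = star (circleAct z x) := by
  induction x using Coord.induction with
  | h0 c => rw [star_algebraMap', AlgHom.commutes, AlgHom.commutes, star_algebraMap']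
  | hg g =>
    rw [star_gen]
    unfold circleAct
    rw [lift_gen, lift_gen]
    cases g <;> simp [← Circle.coe_inv_eq_conj]
  | hm x y hx hy => rw [star_mul, map_mul, map_mul, hx, hy, star_mul]
  | ha x y hx hy => rw [star_add, map_add, map_add, hx, hy, star_add]

variable (q) in
/-- The spectral subspace `𝒜_n` of the circle action. -/
def spectralSubspace (n : ℤ) : Submodule ℂ (Coord q) where
  carrier := {x | ∀ z : Circle, circleAct z x = (z : ℂ) ^ n • x}
  add_mem' hx hy z := by rw [map_add, hx z, hy z, smul_add]
  zero_mem' z := by rw [map_zero, smul_zero]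
  smul_mem' c x hx z := by rw [map_smul, hx z, smul_comm]

end Coord

/-- The coordinate algebra `𝒪(S_q^2)` of the standard Podleś sphere: the fixed points of the
circle action. -/
def podles (q : ℝ) : StarSubalgebra ℂ (Coord q) where
  carrier := {x | ∀ z : Circle, Coord.circleAct z x = x}
  mul_mem' hx hy z := by rw [map_mul, hx z, hy z]
  add_mem' hx hy z := by rw [map_add, hx z, hy z]
  algebraMap_mem' c z := by rw [AlgHom.commutes]
  star_mem' hx z := by rw [Coord.circleAct_star, hx z]

theorem podles_mul_mem {q : ℝ} {n : ℤ} {x y : Coord q} (hx : x ∈ podles q)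
    (hy : y ∈ Coord.spectralSubspace q n) : x * y ∈ Coord.spectralSubspace q n := by
  intro z
  rw [map_mul, hx z, hy z, mul_smul_comm]

/-- The Hilbert space `H_n`: the closure of `𝒜_n` in `L²(SU_q(2))`. -/
def H (q : ℝ) (n : ℤ) : Submodule ℂ (L2 q) :=
  ((Coord.spectralSubspace q n).map (toL2 q)).topologicalClosure

theorem toL2_mem_H {q : ℝ} {n : ℤ} {y : Coord q} (hy : y ∈ Coord.spectralSubspace q n) :
    toL2 q y ∈ H q n :=
  Submodule.le_topologicalClosure _ (Submodule.mem_map_of_mem hy)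

theorem rho_mem_H {q : ℝ} {n : ℤ} (x : podles q) {ξ : L2 q} (hξ : ξ ∈ H q n) :
    rho (x : Coord q) ξ ∈ H q n := by
  refine map_mem_closure (rho (x : Coord q)).continuous hξ ?_
  rintro _ ⟨y, hy, rfl⟩
  rw [rho_toL2]
  exact Submodule.mem_map_of_mem (podles_mul_mem x.2 hy)

/-- The restriction of `ρ(x)` to `H_n`, for `x` in `𝒪(S_q^2)`. -/
def rhoH {q : ℝ} (n : ℤ) (x : podles q) : H q n →L[ℂ] H q n :=
  (rho (x : Coord q)).restrict (fun _ hξ => rho_mem_H x hξ)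

/-- The Hilbert space direct sum `H_+ ⊕ H_- = H_1 ⊕ H_{-1}`. -/
abbrev Spinors (q : ℝ) : Type := WithLp 2 (H q 1 × H q (-1))

/-- The representation `π` of `𝒪(S_q^2)` on `H_+ ⊕ H_-`, diagonal with entries the
restrictions of `ρ`. -/
def piRep {q : ℝ} (x : podles q) : Spinors q →L[ℂ] Spinors q :=
  (WithLp.prodContinuousLinearEquiv 2 ℂ (H q 1) (H q (-1))).symm.toContinuousLinearMap ∘L
    ((rhoH 1 x).prodMap (rhoH (-1) x)) ∘L
    (WithLp.prodContinuousLinearEquiv 2 ℂ (H q 1) (H q (-1))).toContinuousLinearMap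

/-! ### The pairing with the generators of the quantum enveloping algebra -/

section Dirac

variable (q : Set.Ioc (0 : ℝ) 1)

/-- The complex number `q^{1/2}`. -/
def sqrtq : ℂ := ((Real.sqrt (q : ℝ) : ℝ) : ℂ)

theorem sqrtq_ne_zero : sqrtq q ≠ 0 :=
  Complex.ofReal_ne_zero.2 (Real.sqrt_pos.2 q.2.1).ne'

theorem sqrtq_mul_self : sqrtq q * sqrtq q = ((q : ℝ) : ℂ) := by
  unfold sqrtq
  rw [← Complex.ofReal_mul, Real.mul_self_sqrt q.2.1.le]

theorem relations_triangular (s t : ℂ) : Relations (q : ℝ)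
    !![(sqrtq q)⁻¹, 0; 0, sqrtq q] !![sqrtq q, 0; 0, (sqrtq q)⁻¹] !![0, s; 0, 0] !![0, t; 0, 0] := by
  have h0 := sqrtq_ne_zero q
  constructor <;> try rw [← sqrtq_mul_self]
  all_goals ext i j <;> fin_cases i <;> fin_cases j <;>
    (simp; try field_simp)

/-- The homomorphism `x ↦ !![⟨k⁻¹, x⟩, ⟨e, x⟩; 0, ⟨k, x⟩]`. That it is multiplicative expresses
`Δ(k) = k ⊗ k` and `Δ(e) = e ⊗ k + k⁻¹ ⊗ e`; its values on the generators are
`⟨k, a⟩ = q^{1/2}`, `⟨k, a^*⟩ = q^{-1/2}`, `⟨e, b⟩ = -q⁻¹`, and zero in the remaining cases. -/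
def pairHomE : Coord (q : ℝ) →ₐ[ℂ] Matrix (Fin 2) (Fin 2) ℂ :=
  Coord.lift (relations_triangular q (-((q : ℝ) : ℂ)⁻¹) 0)

/-- The homomorphism `x ↦ !![⟨k⁻¹, x⟩, ⟨f, x⟩; 0, ⟨k, x⟩]`, where `⟨f, b^*⟩ = 1` and `⟨f, ·⟩`
vanishes on `a`, `a^*`, `b`. -/
def pairHomF : Coord (q : ℝ) →ₐ[ℂ] Matrix (Fin 2) (Fin 2) ℂ :=
  Coord.lift (relations_triangular q 0 1)

/-- The functional `⟨e, ·⟩`. -/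
def pairE : Coord (q : ℝ) →ₗ[ℂ] ℂ := Matrix.entryLinearMap ℂ ℂ 0 1 ∘ₗ (pairHomE q).toLinearMap

/-- The functional `⟨f, ·⟩`. -/
def pairF : Coord (q : ℝ) →ₗ[ℂ] ℂ := Matrix.entryLinearMap ℂ ℂ 0 1 ∘ₗ (pairHomF q).toLinearMap

/-- The endomorphism `∂_e(x) = (1 ⊗ ⟨e, ·⟩)Δ(x)`. -/
def partialE : Coord (q : ℝ) →ₗ[ℂ] Coord (q : ℝ) :=
  Coord.sliceRight (pairE q) ∘ₗ Coord.comul.toLinearMap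

/-- The endomorphism `∂_f(x) = (1 ⊗ ⟨f, ·⟩)Δ(x)`. -/
def partialF : Coord (q : ℝ) →ₗ[ℂ] Coord (q : ℝ) :=
  Coord.sliceRight (pairF q) ∘ₗ Coord.comul.toLinearMap

/-! ### The Dirac operator -/

/-- The operator `ℰ : 𝒜_1 → H_-`, `ℰ(x) = ∂_e(x)`, as an unbounded operator from `H_+` to `H_-`,
given by its graph `{(x, ∂_e(x)) | x ∈ 𝒜_1}` (recall that `∂_e` maps `𝒜_1` into `𝒜_{-1}`). -/
def E₀ : H (q : ℝ) 1 →ₗ.[ℂ] H (q : ℝ) (-1) :=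
  (((Coord.spectralSubspace (q : ℝ) 1).map
    ((toL2 (q : ℝ)).prod (toL2 (q : ℝ) ∘ₗ partialE q))).comap
      ((H (q : ℝ) 1).subtype.prodMap (H (q : ℝ) (-1)).subtype)).toLinearPMap

/-- The operator `ℱ : 𝒜_{-1} → H_+`, `ℱ(x) = ∂_f(x)`, as an unbounded operator from `H_-` to
`H_+`, given by its graph `{(x, ∂_f(x)) | x ∈ 𝒜_{-1}}`. -/
def F₀ : H (q : ℝ) (-1) →ₗ.[ℂ] H (q : ℝ) 1 :=
  (((Coord.spectralSubspace (q : ℝ) (-1)).map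
    ((toL2 (q : ℝ)).prod (toL2 (q : ℝ) ∘ₗ partialF q))).comap
      ((H (q : ℝ) (-1)).subtype.prodMap (H (q : ℝ) 1).subtype)).toLinearPMap

/-- The operator `E : Dom(E) → H_-`, the closure of `ℰ`. -/
def E : H (q : ℝ) 1 →ₗ.[ℂ] H (q : ℝ) (-1) := (E₀ q).closure

/-- The operator `F : Dom(F) → H_+`, the closure of `ℱ`. -/
def F : H (q : ℝ) (-1) →ₗ.[ℂ] H (q : ℝ) 1 := (F₀ q).closure

/-- The domain `Dom(E) ⊕ Dom(F)` of the Dirac operator. -/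
def diracDomain : Submodule ℂ (Spinors (q : ℝ)) where
  carrier := {ξ | ξ.fst ∈ (E q).domain ∧ ξ.snd ∈ (F q).domain}
  add_mem' hξ hη := ⟨(E q).domain.add_mem hξ.1 hη.1, (F q).domain.add_mem hξ.2 hη.2⟩
  zero_mem' := ⟨(E q).domain.zero_mem, (F q).domain.zero_mem⟩
  smul_mem' c _ hξ := ⟨(E q).domain.smul_mem c hξ.1, (F q).domain.smul_mem c hξ.2⟩

/-- The Dirac operator `D_q = !![0, F; E, 0]` on `H_+ ⊕ H_-`. -/
def dirac : Spinors (q : ℝ) →ₗ.[ℂ] Spinors (q : ℝ) where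
  domain := diracDomain q
  toFun :=
    { toFun := fun ξ => WithLp.toLp 2 (F q ⟨ξ.1.snd, ξ.2.2⟩, E q ⟨ξ.1.fst, ξ.2.1⟩)
      map_add' := fun ξ η =>
        congrArg (WithLp.toLp 2) (Prod.ext
          ((F q).map_add ⟨ξ.1.snd, ξ.2.2⟩ ⟨η.1.snd, η.2.2⟩)
          ((E q).map_add ⟨ξ.1.fst, ξ.2.1⟩ ⟨η.1.fst, η.2.1⟩))
      map_smul' := fun c ξ =>
        congrArg (WithLp.toLp 2) (Prod.ext
          ((F q).map_smul c ⟨ξ.1.snd, ξ.2.2⟩)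
          ((E q).map_smul c ⟨ξ.1.fst, ξ.2.1⟩)) }

/-- The bounded operator `T` is the closure of the commutator `[D_q, π(x)]`: the operator `π(x)`
preserves the (dense) domain of `D_q` and `T ξ = D_q π(x) ξ - π(x) D_q ξ` on it. -/
def IsDiracCommutator (x : podles (q : ℝ)) (T : Spinors (q : ℝ) →L[ℂ] Spinors (q : ℝ)) : Prop :=
  ∀ ξ : (dirac q).domain, ∃ hξ : piRep x (ξ : Spinors (q : ℝ)) ∈ (dirac q).domain,
    T (ξ : Spinors (q : ℝ)) = dirac q ⟨piRep x (ξ : Spinors (q : ℝ)), hξ⟩ - piRep x (dirac q ξ)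

open Classical in
/-- The derivation `∂ : 𝒪(S_q^2) → 𝔹(H_+ ⊕ H_-)`, `∂(x)` being the closure of `[D_q, π(x)]`
(and zero should this commutator not be bounded). -/
def derivation (x : podles (q : ℝ)) : Spinors (q : ℝ) →L[ℂ] Spinors (q : ℝ) :=
  if h : ∃ T, IsDiracCommutator q x T then h.choose else 0

end Dirac

/-! ### The quantum Berezin transform -/

/-- The functional `h_N(x) = ⟨N + 1⟩ h((a^*)^N x a^N)`, where
`⟨N + 1⟩ = 1 + q^2 + ⋯ + q^{2N}`. -/
def hN (q : ℝ) (N : ℕ) : Coord q →ₗ[ℂ] ℂ :=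
  (∑ m ∈ Finset.range (N + 1), (q : ℂ) ^ (2 * m)) •
    (Coord.haar q ∘ₗ LinearMap.mulLeft ℂ (star (Coord.a q) ^ N) ∘ₗ
      LinearMap.mulRight ℂ (Coord.a q ^ N))

/-- The quantum Berezin transform `β_N(x) = (1 ⊗ h_N)Δ(x)`, a priori with values in
`𝒪(SU_q(2))`. -/
def berezin (q : ℝ) (N : ℕ) (x : podles q) : Coord q :=
  Coord.sliceRight (hN q N) (Coord.comul (x : Coord q))

end QuantumSU2

end

open scoped TensorProduct ComplexOrder Polynomial InnerProductSpace

noncomputable section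

namespace QuantumSU2

namespace Coord

/-! ### Monomials -/

section Monomials

variable {q : ℝ}

/-! For `x` in `𝒜_0` the twisted Leibniz rule identifies `[D_q, π(x)]` with left multiplication by
the off-diagonal matrix `X(x)` whose entries are `q^{-1/2} ∂_f(x)` and `q^{1/2} ∂_e(x)`
(`isDiracCommutator_commutator`, `derivation_eq_commutator`). Convolution by `h_N` does not commute
with forming `X`, but it does after a rotation by the fundamental unitary: `X(β_N(x)) = u^* β_N(u
X(x) u^*) u`, with `β_N` applied entrywise (`commEntry_convRight_hN`). This comes from `(u^* ⊗
1)Δ(u) = 1 ⊗ u` together with `hN_frameEntry`: `h_N` cannot distinguish the entries of `u X(x) u^*`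
from the left convolutions of `x` by the matching multiples of `e` and `f`. Since `h_N` is invariant
under the two-torus, that is a computation on the few monomials which land in degree zero.

The inequality then says that `β_N` does not increase the norm of a `2 × 2` matrix. Three facts
enter. Left multiplication by `u` is isometric and `u^*` maps `𝒜_0²` into `𝒜_1 ⊕ 𝒜_{-1}`, so `u X(x)
u^*` is bounded by `‖∂(x)‖` on `𝒜_0²` (`vecNormSq_frameEntry_le_of_podles`). Right multiplication by
`q^{-1} a^*` and `q b^*` embeds `𝒜_{n+1}` isometrically in `𝒜_n ⊕ 𝒜_n` and commutes with left
multiplication, so the bound passes to every `𝒜_N²` (`vecNormSq_matVec_le`). Finally `β_N` is a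
unital completely positive map built from compressions to `𝒜_N` (`exists_convRight_hN_eq_sum`), so
it contracts matrices measured there (`vecNormSq_convRight_hN_le`).

All this needs the Haar state explicitly, whereas `haar` is defined by choice. A candidate is built
from the moments `h(t^n) = 1/(1 + q^2 + ⋯ + q^{2n})` of `t = b b^*`. It is positive because the
moments are those of a Jackson integral (Lebesgue measure for `q = 1`), right invariant because it
kills the image of `∂_e`, and left invariant by transposing `u`. Pairing left with right invariance
gives uniqueness (`haar_eq_haarCand`). -/

variable (q) in
/-- The positive element `t = b b^*`. -/
def t : Coord q := b q * star (b q)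

variable (q) in
/-- Polynomials in `t = b b^*`. -/
def pt : ℂ[X] →ₐ[ℂ] Coord q := Polynomial.aeval (t q)

/-- The substitution `g(t) ↦ g(c t)`. -/
def dilate (c : ℂ) : ℂ[X] →ₐ[ℂ] ℂ[X] := Polynomial.aeval (Polynomial.C c * Polynomial.X)

theorem dilate_X (c : ℂ) : dilate c Polynomial.X = Polynomial.C c * Polynomial.X := by
  simp [dilate]

theorem eval_dilate (c z : ℂ) (g : ℂ[X]) : (dilate c g).eval z = g.eval (c * z) := by
  simp only [dilate, ← Polynomial.comp_eq_aeval, Polynomial.eval_comp]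
  simp

theorem dilate_dilate (c d : ℂ) (g : ℂ[X]) : dilate c (dilate d g) = dilate (d * c) g := by
  have : (dilate c).comp (dilate d) = dilate (d * c) := by
    ext
    simp [dilate, Polynomial.C_mul, mul_assoc]
  exact DFunLike.congr_fun this g

theorem dilate_one (g : ℂ[X]) : dilate 1 g = g := by
  have : dilate 1 = AlgHom.id ℂ ℂ[X] := by
    ext
    simp [dilate]
  exact DFunLike.congr_fun this g

theorem pt_X : pt q Polynomial.X = t q := by simp [pt]

theorem b_mul_a : b q * a q = (q : ℂ) • (a q * b q) := relations.ba

theorem star_b_mul_a : star (b q) * a q = (q : ℂ) • (a q * star (b q)) := relations.bsa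

theorem star_a_mul_star_b : star (a q) * star (b q) = (q : ℂ) • (star (b q) * star (a q)) :=
  relations.asbs

theorem star_a_mul_b : star (a q) * b q = (q : ℂ) • (b q * star (a q)) := relations.asb

theorem star_b_mul_b : star (b q) * b q = t q := relations.bbs.symm

theorem b_mul_star_b : b q * star (b q) = t q := rfl

theorem star_a_mul_a : star (a q) * a q = 1 - (q : ℂ) ^ 2 • t q :=
  eq_sub_of_add_eq relations.asa

theorem a_mul_star_a : a q * star (a q) = 1 - t q := eq_sub_of_add_eq relations.aas

theorem star_t : star (t q) = t q := by simp [t]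

theorem t_mul_a : t q * a q = (q : ℂ) ^ 2 • (a q * t q) := by
  rw [t, mul_assoc, star_b_mul_a, mul_smul_comm, ← mul_assoc, b_mul_a, smul_mul_assoc, smul_smul,
    mul_assoc, sq]

theorem star_a_mul_t : star (a q) * t q = (q : ℂ) ^ 2 • (t q * star (a q)) := by
  have := congrArg star (t_mul_a (q := q))
  simpa [star_t] using this

theorem commute_b_t : Commute (b q) (t q) := by
  rw [commute_iff_eq, t, mul_assoc, star_b_mul_b, ← b_mul_star_b]

theorem commute_star_b_t : Commute (star (b q)) (t q) := by
  rw [commute_iff_eq, ← star_b_mul_b, mul_assoc, b_mul_star_b, ← star_b_mul_b]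

theorem commute_pt {x : Coord q} (h : Commute x (t q)) (g : ℂ[X]) : Commute x (pt q g) := by
  induction g using Polynomial.induction_on' with
  | add f g hf hg => rw [map_add]; exact hf.add_right hg
  | monomial n c =>
    rw [pt, Polynomial.aeval_monomial]
    exact (Algebra.commute_algebraMap_right c x).mul_right (h.pow_right n)

theorem pt_mul_a (g : ℂ[X]) : pt q g * a q = a q * pt q (dilate ((q : ℂ) ^ 2) g) := by
  induction g using Polynomial.induction_on with
  | C c =>
    rw [← Polynomial.algebraMap_eq, AlgHom.commutes, AlgHom.commutes, AlgHom.commutes]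
    exact Algebra.commutes c _
  | add f g hf hg => simp only [map_add, add_mul, mul_add, hf, hg]
  | monomial n c h =>
    rw [pow_succ, ← mul_assoc]
    generalize Polynomial.C c * Polynomial.X ^ n = f at h
    rw [map_mul, map_mul, map_mul, pt_X, mul_assoc, t_mul_a, mul_smul_comm,
      ← mul_assoc, h, dilate_X, map_mul, pt_X, ← Polynomial.algebraMap_eq, AlgHom.commutes,
      Algebra.algebraMap_eq_smul_one, smul_mul_assoc, one_mul, mul_smul_comm, mul_smul_comm,
      mul_assoc]

theorem star_a_mul_pt (g : ℂ[X]) :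
    star (a q) * pt q g = pt q (dilate ((q : ℂ) ^ 2) g) * star (a q) := by
  induction g using Polynomial.induction_on with
  | C c =>
    rw [← Polynomial.algebraMap_eq, AlgHom.commutes, AlgHom.commutes, AlgHom.commutes]
    exact (Algebra.commutes c _).symm
  | add f g hf hg => simp only [map_add, add_mul, mul_add, hf, hg]
  | monomial n c h =>
    rw [pow_succ, ← mul_assoc]
    generalize Polynomial.C c * Polynomial.X ^ n = f at h
    rw [map_mul, map_mul, map_mul, pt_X, ← mul_assoc, h, mul_assoc,
      star_a_mul_t, dilate_X, map_mul, pt_X, ← Polynomial.algebraMap_eq, AlgHom.commutes,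
      Algebra.algebraMap_eq_smul_one, smul_mul_assoc, one_mul, mul_smul_comm, mul_smul_comm,
      smul_mul_assoc, mul_assoc]

theorem a_mul_pt (hq : q ≠ 0) (g : ℂ[X]) :
    a q * pt q g = pt q (dilate ((q : ℂ) ^ 2)⁻¹ g) * a q := by
  rw [pt_mul_a, dilate_dilate, inv_mul_cancel₀ (by simpa using hq), dilate_one]

variable (q) in
/-- The element `a^i`, where `a^{-1}` is read as `a^*`. -/
def aPow (i : ℤ) : Coord q := a q ^ i.toNat * star (a q) ^ (-i).toNat

variable (q) in
/-- The element `b^j`, where `b^{-1}` is read as `b^*`. -/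
def bPow (j : ℤ) : Coord q := b q ^ j.toNat * star (b q) ^ (-j).toNat

theorem aPow_natCast (n : ℕ) : aPow q n = a q ^ n := by simp [aPow]

theorem aPow_neg_natCast (n : ℕ) : aPow q (-n) = star (a q) ^ n := by simp [aPow]

theorem bPow_natCast (n : ℕ) : bPow q n = b q ^ n := by simp [bPow]

theorem bPow_neg_natCast (n : ℕ) : bPow q (-n) = star (b q) ^ n := by simp [bPow]

/-- Powers `aPow` do not multiply exactly: for a negative exponent a factor `a a^* = 1 - t` appears,
and the polynomial absorbs it. The three lemmas after it have the same shape, with `a^* a = 1 - q^2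
t` or `b b^* = t`. -/
theorem a_mul_aPow (i : ℤ) : ∃ g, a q * aPow q i = pt q g * aPow q (i + 1) := by
  obtain ⟨n, rfl | rfl⟩ := i.eq_nat_or_neg
  · refine ⟨1, ?_⟩
    rw [map_one, one_mul, aPow_natCast]
    exact_mod_cast (pow_succ' (a q) n).symm.trans (aPow_natCast (n + 1)).symm
  · cases n with
    | zero => exact ⟨1, by simp [aPow]⟩
    | succ n =>
      refine ⟨1 - Polynomial.X, ?_⟩
      rw [show -((n + 1 : ℕ) : ℤ) + 1 = -(n : ℤ) by push_cast; ring, aPow_neg_natCast,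
        aPow_neg_natCast, pow_succ', ← mul_assoc, a_mul_star_a, map_sub, map_one, pt_X]

theorem star_a_mul_aPow (i : ℤ) :
    ∃ g, star (a q) * aPow q i = pt q g * aPow q (i - 1) := by
  obtain ⟨n, rfl | rfl⟩ := i.eq_nat_or_neg
  · cases n with
    | zero => exact ⟨1, by simp [aPow]⟩
    | succ n =>
      refine ⟨1 - ((q : ℂ) ^ 2) • Polynomial.X, ?_⟩
      rw [show ((n + 1 : ℕ) : ℤ) - 1 = (n : ℤ) by push_cast; ring, aPow_natCast,
        aPow_natCast, pow_succ', ← mul_assoc, star_a_mul_a, map_sub, map_one, map_smul, pt_X]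
  · refine ⟨1, ?_⟩
    rw [map_one, one_mul, aPow_neg_natCast, show -(n : ℤ) - 1 = -((n + 1 : ℕ) : ℤ) by
      push_cast; ring, aPow_neg_natCast, pow_succ']

theorem b_mul_bPow (j : ℤ) : ∃ g, b q * bPow q j = bPow q (j + 1) * pt q g := by
  obtain ⟨n, rfl | rfl⟩ := j.eq_nat_or_neg
  · refine ⟨1, ?_⟩
    rw [map_one, mul_one, bPow_natCast]
    exact_mod_cast (pow_succ' (b q) n).symm.trans (bPow_natCast (n + 1)).symm
  · cases n with
    | zero => exact ⟨1, by simp [bPow]⟩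
    | succ n =>
      refine ⟨Polynomial.X, ?_⟩
      rw [show -((n + 1 : ℕ) : ℤ) + 1 = -(n : ℤ) by push_cast; ring, bPow_neg_natCast,
        bPow_neg_natCast, pow_succ', ← mul_assoc, b_mul_star_b, pt_X,
        (commute_star_b_t.pow_left n).eq]

theorem star_b_mul_bPow (j : ℤ) :
    ∃ g, star (b q) * bPow q j = bPow q (j - 1) * pt q g := by
  obtain ⟨n, rfl | rfl⟩ := j.eq_nat_or_neg
  · cases n with
    | zero => exact ⟨1, by simp [bPow]⟩
    | succ n =>
      refine ⟨Polynomial.X, ?_⟩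
      rw [show ((n + 1 : ℕ) : ℤ) - 1 = (n : ℤ) by push_cast; ring, bPow_natCast,
        bPow_natCast, pow_succ', ← mul_assoc, star_b_mul_b, pt_X, (commute_b_t.pow_left n).eq]
  · refine ⟨1, ?_⟩
    rw [map_one, mul_one, bPow_neg_natCast, show -(n : ℤ) - 1 = -((n + 1 : ℕ) : ℤ) by
      push_cast; ring, bPow_neg_natCast, pow_succ']

theorem mul_pow_eq_smul_pow_mul {x y : Coord q} {c : ℂ} (h : x * y = c • (y * x)) (n : ℕ) :
    x * y ^ n = c ^ n • (y ^ n * x) := by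
  induction n with
  | zero => simp
  | succ n ih =>
    rw [pow_succ', ← mul_assoc, h, smul_mul_assoc, mul_assoc, ih, mul_smul_comm, smul_smul,
      mul_assoc, pow_succ']

theorem a_mul_b (hq : q ≠ 0) : a q * b q = (q : ℂ)⁻¹ • (b q * a q) := by
  rw [b_mul_a, smul_smul, inv_mul_cancel₀ (by simpa using hq), one_smul]

theorem a_mul_star_b (hq : q ≠ 0) : a q * star (b q) = (q : ℂ)⁻¹ • (star (b q) * a q) := by
  rw [star_b_mul_a, smul_smul, inv_mul_cancel₀ (by simpa using hq), one_smul]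

theorem a_mul_bPow (hq : q ≠ 0) (j : ℤ) : ∃ c : ℂ, a q * bPow q j = c • (bPow q j * a q) := by
  refine ⟨(q : ℂ)⁻¹ ^ j.toNat * (q : ℂ)⁻¹ ^ (-j).toNat, ?_⟩
  rw [bPow, ← mul_assoc, mul_pow_eq_smul_pow_mul (a_mul_b hq), smul_mul_assoc, mul_assoc,
    mul_pow_eq_smul_pow_mul (a_mul_star_b hq), mul_smul_comm, smul_smul, mul_assoc]

theorem star_a_mul_bPow (j : ℤ) :
    ∃ c : ℂ, star (a q) * bPow q j = c • (bPow q j * star (a q)) := by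
  refine ⟨(q : ℂ) ^ j.toNat * (q : ℂ) ^ (-j).toNat, ?_⟩
  rw [bPow, ← mul_assoc, mul_pow_eq_smul_pow_mul star_a_mul_b, smul_mul_assoc, mul_assoc,
    mul_pow_eq_smul_pow_mul star_a_mul_star_b, mul_smul_comm, smul_smul, mul_assoc]

variable (q) in
/-- The monomials `b^j g(t) a^i`, of degree `i` in `a` and degree `j` in `b`. -/
def mono (p : ℤ × ℤ) : ℂ[X] →ₗ[ℂ] Coord q :=
  LinearMap.mulRight ℂ (aPow q p.1) ∘ₗ LinearMap.mulLeft ℂ (bPow q p.2) ∘ₗ (pt q).toLinearMap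

theorem mono_apply (p : ℤ × ℤ) (g : ℂ[X]) : mono q p g = bPow q p.2 * pt q g * aPow q p.1 := rfl

theorem mono_zero (g : ℂ[X]) : mono q 0 g = pt q g := by
  simp [mono_apply, aPow, bPow]

/-- Normal ordering. Moving a generator into place costs a scalar, a dilation of the polynomial and
the correction factors above, and never produces a second monomial. Hence the span of the monomials
is a left ideal. -/
theorem gen_mul_mono (hq : q ≠ 0) (g : Gen) (p : ℤ × ℤ) (f : ℂ[X]) :
    ∃ p' f', gen q g * mono q p f = mono q p' f' := by
  obtain ⟨i, j⟩ := p
  cases g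
  · obtain ⟨c, hc⟩ := a_mul_bPow hq j
    obtain ⟨g, hg⟩ := a_mul_aPow (q := q) i
    refine ⟨(i + 1, j), c • (dilate ((q : ℂ) ^ 2)⁻¹ f * g), ?_⟩
    change a q * _ = _
    rw [mono_apply, ← mul_assoc, ← mul_assoc, hc, map_smul, mono_apply, smul_mul_assoc,
      mul_assoc (bPow q j), a_mul_pt hq, smul_mul_assoc, mul_assoc, mul_assoc, hg, map_mul]
    simp only [mul_assoc]
  · obtain ⟨c, hc⟩ := star_a_mul_bPow (q := q) j
    obtain ⟨g, hg⟩ := star_a_mul_aPow (q := q) i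
    refine ⟨(i - 1, j), c • (dilate ((q : ℂ) ^ 2) f * g), ?_⟩
    rw [← star_a, mono_apply, ← mul_assoc, ← mul_assoc, hc, map_smul, mono_apply, smul_mul_assoc,
      mul_assoc (bPow q j), star_a_mul_pt, smul_mul_assoc, mul_assoc, mul_assoc, hg, map_mul]
    simp only [mul_assoc]
  · obtain ⟨g, hg⟩ := b_mul_bPow (q := q) j
    refine ⟨(i, j + 1), g * f, ?_⟩
    change b q * _ = _
    rw [mono_apply, mono_apply, ← mul_assoc, ← mul_assoc, hg, map_mul]
    simp only [mul_assoc]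
  · obtain ⟨g, hg⟩ := star_b_mul_bPow (q := q) j
    refine ⟨(i, j - 1), g * f, ?_⟩
    rw [← star_b, mono_apply, mono_apply, ← mul_assoc, ← mul_assoc, hg, map_mul]
    simp only [mul_assoc]

/-- The monomials span the coordinate algebra. -/
theorem iSup_range_mono (hq : q ≠ 0) : ⨆ p, LinearMap.range (mono q p) = ⊤ := by
  set S := ⨆ p, LinearMap.range (mono q p) with hS
  have mem : ∀ p f, mono q p f ∈ S := fun p f =>
    Submodule.mem_iSup_of_mem p (LinearMap.mem_range_self _ _)
  have key : ∀ x y : Coord q, y ∈ S → x * y ∈ S := by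
    intro x
    induction x using Coord.induction with
    | h0 c => intro y hy; rw [← Algebra.smul_def]; exact S.smul_mem c hy
    | hg g =>
      intro y hy
      suffices S ≤ S.comap (LinearMap.mulLeft ℂ (gen q g)) from this hy
      conv_lhs => rw [hS]
      refine iSup_le fun p => ?_
      rintro _ ⟨f, rfl⟩
      obtain ⟨p', f', h⟩ := gen_mul_mono hq g p f
      rw [Submodule.mem_comap, LinearMap.mulLeft_apply, h]
      exact mem _ _
    | hm x y hx hy => intro z hz; rw [mul_assoc]; exact hx _ (hy _ hz)
    | ha x y hx hy => intro z hz; rw [add_mul]; exact S.add_mem (hx _ hz) (hy _ hz)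
  refine eq_top_iff.2 fun x _ => ?_
  have h1 : (1 : Coord q) ∈ S := by simpa [mono_zero] using mem 0 1
  simpa using key x 1 h1

/-- Two linear maps on the coordinate algebra that agree on the monomials `b^j t^n a^i` agree. -/
theorem linearMap_ext {V : Type*} [AddCommGroup V] [Module ℂ V] (hq : q ≠ 0)
    {φ ψ : Coord q →ₗ[ℂ] V}
    (h : ∀ (p : ℤ × ℤ) (n : ℕ), φ (mono q p (Polynomial.X ^ n)) = ψ (mono q p (Polynomial.X ^ n))) :
    φ = ψ := by
  have h1 : ∀ p, φ ∘ₗ mono q p = ψ ∘ₗ mono q p := fun p => by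
    refine Polynomial.lhom_ext' fun n => LinearMap.ext_ring ?_
    simpa [← Polynomial.X_pow_eq_monomial] using h p n
  have h2 : ⊤ ≤ LinearMap.eqLocus φ ψ := by
    rw [← iSup_range_mono hq]
    refine iSup_le fun p => ?_
    rintro _ ⟨f, rfl⟩
    exact LinearMap.congr_fun (h1 p) f
  exact LinearMap.ext fun x => h2 (Submodule.mem_top (x := x))

/-! ### The torus action -/

/-- The relations are homogeneous in `a` and in `b` separately. Invertible parameters, not only
unimodular ones, are allowed because the automorphisms `K` and `Kinv` are torus actions at `q^{1/2}`
and `q^{-1/2}`. -/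
theorem relations_torus (z w : ℂˣ) : Relations q ((z : ℂ) • a q) ((z : ℂ)⁻¹ • star (a q))
    ((w : ℂ) • b q) ((w : ℂ)⁻¹ • star (b q)) := by
  have h := relations (q := q)
  have hz : (z : ℂ) ≠ 0 := z.ne_zero
  have hw : (w : ℂ) ≠ 0 := w.ne_zero
  constructor <;> simp only [smul_mul_smul_comm, inv_mul_cancel₀ hz, mul_inv_cancel₀ hz,
    inv_mul_cancel₀ hw, mul_inv_cancel₀ hw, one_smul]
  · rw [h.ba, smul_comm, mul_comm]
  · rw [h.bsa, smul_comm, mul_comm]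
  · rw [h.asbs, smul_comm, mul_comm]
  · rw [h.asb, smul_comm, mul_comm]
  · rw [h.bbs]
  · exact h.asa
  · exact h.aas

/-- The action of the complexified two-torus determined by `a ↦ z a` and `b ↦ w b`. -/
def torus (z w : ℂˣ) : Coord q →ₐ[ℂ] Coord q := lift (relations_torus z w)

theorem torus_a (z w : ℂˣ) : torus z w (a q) = (z : ℂ) • a q := lift_gen _ _

theorem torus_b (z w : ℂˣ) : torus z w (b q) = (w : ℂ) • b q := lift_gen _ _

theorem torus_star_a (z w : ℂˣ) : torus z w (star (a q)) = (z : ℂ)⁻¹ • star (a q) := by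
  conv_lhs => rw [star_a]
  exact lift_gen _ _

theorem torus_star_b (z w : ℂˣ) : torus z w (star (b q)) = (w : ℂ)⁻¹ • star (b q) := by
  conv_lhs => rw [star_b]
  exact lift_gen _ _

theorem circleAct_eq_torus (z : Circle) :
    circleAct (q := q) z = torus (Circle.toUnits z) (Circle.toUnits z) := rfl

theorem torus_t (z w : ℂˣ) : torus z w (t q) = t q := by
  rw [t, map_mul, torus_b, torus_star_b, smul_mul_smul_comm,
    mul_inv_cancel₀ (w.ne_zero), one_smul]

theorem torus_pt (z w : ℂˣ) (g : ℂ[X]) : torus z w (pt q g) = pt q g := by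
  rw [pt, ← Polynomial.aeval_algHom_apply, torus_t]

theorem smul_pow_mul_inv_smul_pow (z : ℂ) (x y : Coord q) (i : ℤ) :
    (z • x) ^ i.toNat * (z⁻¹ • y) ^ (-i).toNat = z ^ i • (x ^ i.toNat * y ^ (-i).toNat) := by
  rw [smul_pow, smul_pow, smul_mul_smul_comm]
  congr 1
  obtain ⟨n, rfl | rfl⟩ := i.eq_nat_or_neg <;> simp

theorem torus_mono (z w : ℂˣ) (p : ℤ × ℤ) (g : ℂ[X]) :
    torus z w (mono q p g) = ((z : ℂ) ^ p.1 * (w : ℂ) ^ p.2) • mono q p g := by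
  rw [mono_apply, map_mul, map_mul, torus_pt]
  simp only [aPow, bPow, map_mul, map_pow, torus_a, torus_b, torus_star_a, torus_star_b]
  rw [smul_pow_mul_inv_smul_pow,
    smul_pow_mul_inv_smul_pow, smul_mul_assoc, mul_smul_comm,
    smul_mul_assoc, smul_smul]

end Monomials

end Coord

end QuantumSU2

end

noncomputable section

namespace QuantumSU2

/-! ### The Jackson integral of polynomials -/

/-- The `q`-integer `1 + q^2 + ⋯ + q^{2(n-1)}`. -/
def qInt (q : ℝ) (n : ℕ) : ℝ := ∑ m ∈ Finset.range n, q ^ (2 * m)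

theorem qInt_zero (q : ℝ) : qInt q 0 = 0 := by simp [qInt]

theorem qInt_succ (q : ℝ) (n : ℕ) : qInt q (n + 1) = qInt q n + q ^ (2 * n) :=
  Finset.sum_range_succ _ _

theorem qInt_add (q : ℝ) (m n : ℕ) : qInt q (m + n) = qInt q m + q ^ (2 * m) * qInt q n := by
  simp only [qInt, Finset.sum_range_add, Finset.mul_sum, mul_add, pow_add]

theorem qInt_nonneg {q : ℝ} (hq : 0 ≤ q) (n : ℕ) : 0 ≤ qInt q n :=
  Finset.sum_nonneg fun _ _ => pow_nonneg hq _

theorem qInt_succ_pos {q : ℝ} (hq : 0 ≤ q) (n : ℕ) : 0 < qInt q (n + 1) := by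
  rw [add_comm, qInt_add]
  have := mul_nonneg (pow_nonneg hq (2 * 1)) (qInt_nonneg hq n)
  have h1 : qInt q 1 = 1 := by simp [qInt]
  linarith

theorem one_sub_sq_mul_qInt (q : ℝ) (n : ℕ) : (1 - q ^ 2) * qInt q n = 1 - q ^ (2 * n) := by
  induction n with
  | zero => simp [qInt]
  | succ n ih => rw [qInt_succ, mul_add, ih]; ring

/-- The functional with moments `t^n ↦ 1 / (1 + q^2 + ⋯ + q^{2n})`. -/
def jackson (q : ℝ) : ℂ[X] →ₗ[ℂ] ℂ :=
  Polynomial.lsum fun n => LinearMap.mulLeft ℂ ((qInt q (n + 1) : ℂ)⁻¹)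

theorem jackson_monomial (q : ℝ) (n : ℕ) (c : ℂ) :
    jackson q (Polynomial.monomial n c) = (qInt q (n + 1) : ℂ)⁻¹ * c := by
  simp [jackson, Polynomial.lsum_apply]

theorem jackson_X_pow (q : ℝ) (n : ℕ) :
    jackson q (Polynomial.X ^ n) = (qInt q (n + 1) : ℂ)⁻¹ := by
  rw [Polynomial.X_pow_eq_monomial, jackson_monomial, mul_one]

theorem dilate_monomial (c d : ℂ) (n : ℕ) :
    Coord.dilate c (Polynomial.monomial n d) = Polynomial.monomial n (c ^ n * d) := by
  rw [Coord.dilate, Polynomial.aeval_monomial, mul_pow, ← Polynomial.C_pow,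
    Polynomial.algebraMap_eq, ← mul_assoc, ← Polynomial.C_mul, Polynomial.C_mul_X_pow_eq_monomial,
    mul_comm]

/-- For `q < 1`, dilation by `q^2` shifts the nodes `1, q^2, q^4, …` of the Jackson sum by one, so
only the contribution of the node `1` is lost. That boundary term vanishes for polynomials divisible
by `1 - t`, which is what the modular property uses. -/
theorem jackson_dilate {q : ℝ} (hq : 0 < q) (G : ℂ[X]) :
    (q : ℂ) ^ 2 * jackson q (Coord.dilate ((q : ℂ) ^ 2) G)
      = jackson q G - (1 - (q : ℂ) ^ 2) * G.eval 1 := by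
  induction G using Polynomial.induction_on' with
  | add f g hf hg => simp only [map_add, Polynomial.eval_add, mul_add, hf, hg]; ring
  | monomial n c =>
    have h0 : (qInt q (n + 1) : ℂ) ≠ 0 := by exact_mod_cast (qInt_succ_pos hq.le n).ne'
    have h1 : (1 - (q : ℂ) ^ 2) * (qInt q (n + 1) : ℂ) = 1 - (q : ℂ) ^ (2 * (n + 1)) := by
      exact_mod_cast one_sub_sq_mul_qInt q (n + 1)
    rw [dilate_monomial, jackson_monomial, jackson_monomial, Polynomial.eval_monomial]
    field_simp
    linear_combination c * h1

/-- Each moment is a geometric series with ratio `q^{2(n+1)}`. Exhibiting the functional as a sum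
with positive weights is the source of positivity for `q < 1`; at `q = 1` the sum degenerates and
Lebesgue measure replaces it. -/
theorem hasSum_jackson {q : ℝ} (hq : 0 < q) (hq1 : q < 1) (F : ℂ[X]) :
    HasSum (fun j : ℕ => (1 - (q : ℂ) ^ 2) * ((q : ℂ) ^ 2) ^ j * F.eval (((q : ℂ) ^ 2) ^ j))
      (jackson q F) := by
  induction F using Polynomial.induction_on' with
  | add f g hf hg => simpa only [map_add, Polynomial.eval_add, mul_add] using hf.add hg
  | monomial n c =>
    have hr : ‖(q : ℂ) ^ (2 * (n + 1))‖ < 1 := by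
      rw [norm_pow, Complex.norm_real, Real.norm_of_nonneg hq.le]
      exact pow_lt_one₀ hq.le hq1 (by positivity)
    have h0 : (qInt q (n + 1) : ℂ) ≠ 0 := by exact_mod_cast (qInt_succ_pos hq.le n).ne'
    have h1 : (1 - (q : ℂ) ^ 2) * (qInt q (n + 1) : ℂ) = 1 - (q : ℂ) ^ (2 * (n + 1)) := by
      exact_mod_cast one_sub_sq_mul_qInt q (n + 1)
    have h2 : 1 - (q : ℂ) ^ (2 * (n + 1)) ≠ 0 := fun h => by
      rw [sub_eq_zero] at h
      rw [← h] at hr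
      simp at hr
    have := (hasSum_geometric_of_norm_lt_one hr).mul_left ((1 - (q : ℂ) ^ 2) * c)
    rw [jackson_monomial]
    have e : (qInt q (n + 1) : ℂ)⁻¹ * c
        = (1 - (q : ℂ) ^ 2) * c * (1 - (q : ℂ) ^ (2 * (n + 1)))⁻¹ := by
      field_simp
      linear_combination (-c) * h1
    rw [e]
    refine this.congr_fun fun j => ?_
    rw [Polynomial.eval_monomial]
    ring

theorem jackson_one_eq_integral (F : ℂ[X]) :
    jackson 1 F = ∫ x in (0 : ℝ)..1, F.eval (x : ℂ) := by
  induction F using Polynomial.induction_on' with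
  | add f g hf hg =>
    simp only [map_add, Polynomial.eval_add]
    rw [intervalIntegral.integral_add, hf, hg]
    · exact (f.continuous.comp Complex.continuous_ofReal).intervalIntegrable _ _
    · exact (g.continuous.comp Complex.continuous_ofReal).intervalIntegrable _ _
  | monomial n c =>
    rw [jackson_monomial]
    simp only [Polynomial.eval_monomial, ← Complex.ofReal_pow]
    rw [intervalIntegral.integral_const_mul, intervalIntegral.integral_ofReal, integral_pow]
    simp [qInt]
    ring

/-- The Jackson integral is positive. -/
theorem jackson_nonneg {q : ℝ} (hq : 0 < q) (hq1 : q ≤ 1) {F : ℂ[X]}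
    (hF : ∀ x : ℝ, 0 ≤ x → x ≤ 1 → 0 ≤ F.eval (x : ℂ)) : 0 ≤ jackson q F := by
  rcases hq1.lt_or_eq with h | rfl
  · refine (hasSum_jackson hq h F).nonneg fun j => mul_nonneg (mul_nonneg ?_ ?_) ?_
    · exact_mod_cast (sub_pos.2 (pow_lt_one₀ hq.le h two_ne_zero)).le
    · exact_mod_cast (by positivity : 0 ≤ (q ^ 2) ^ j)
    · exact_mod_cast hF ((q ^ 2) ^ j) (by positivity)
        (pow_le_one₀ (by positivity) (pow_le_one₀ hq.le h.le))
  · rw [jackson_one_eq_integral]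
    have hre : ∀ x ∈ Set.Icc (0 : ℝ) 1, F.eval (x : ℂ) = ((F.eval (x : ℂ)).re : ℂ) := fun x hx =>
      Complex.eq_re_of_ofReal_le (r := 0) (by simpa using hF x hx.1 hx.2)
    rw [intervalIntegral.integral_congr (g := fun x : ℝ => ((F.eval (x : ℂ)).re : ℂ))
      (by rw [Set.uIcc_of_le zero_le_one]; exact hre), intervalIntegral.integral_ofReal]
    exact_mod_cast intervalIntegral.integral_nonneg zero_le_one fun x hx =>
      (Complex.nonneg_iff.1 (hF x hx.1 hx.2)).1

/-- The polynomial `(1 - q^2 t)(1 - q^4 t)⋯(1 - q^{2k} t)`. -/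
def qPoch (q : ℝ) (k : ℕ) : ℂ[X] :=
  ∏ i ∈ Finset.range k, (1 - Polynomial.C ((q : ℂ) ^ (2 * (i + 1))) * Polynomial.X)

theorem qPoch_succ (q : ℝ) (k : ℕ) : qPoch q (k + 1)
    = qPoch q k * (1 - Polynomial.C ((q : ℂ) ^ (2 * (k + 1))) * Polynomial.X) :=
  Finset.prod_range_succ _ _

theorem eval_qPoch_nonneg {q : ℝ} (hq : 0 ≤ q) (hq1 : q ≤ 1) (k : ℕ) (x : ℝ) (hx : 0 ≤ x)
    (hx1 : x ≤ 1) : 0 ≤ (qPoch q k).eval (x : ℂ) := by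
  induction k with
  | zero => simp [qPoch]
  | succ k ih =>
    rw [qPoch_succ, Polynomial.eval_mul]
    refine mul_nonneg ih ?_
    simp only [Polynomial.eval_sub, Polynomial.eval_one, Polynomial.eval_mul, Polynomial.eval_C,
      Polynomial.eval_X]
    have : q ^ (2 * (k + 1)) * x ≤ 1 := mul_le_one₀ (pow_le_one₀ hq hq1) hx hx1
    exact_mod_cast sub_nonneg.2 this

/-- The `q`-beta integral. -/
theorem jackson_X_pow_mul_qPoch {q : ℝ} (hq : 0 < q) (n k : ℕ) :
    jackson q (Polynomial.X ^ n * qPoch q k)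
      = (∏ i ∈ Finset.range k, (qInt q (i + 1) : ℂ)) /
        ∏ i ∈ Finset.range (k + 1), (qInt q (n + i + 1) : ℂ) := by
  have h0 : ∀ m, (qInt q (m + 1) : ℂ) ≠ 0 := fun m => by
    exact_mod_cast (qInt_succ_pos hq.le m).ne'
  induction k generalizing n with
  | zero => simp [qPoch, jackson_X_pow]
  | succ k ih =>
    have e : Polynomial.X ^ n * qPoch q (k + 1) = Polynomial.X ^ n * qPoch q k
        - (q : ℂ) ^ (2 * (k + 1)) • (Polynomial.X ^ (n + 1) * qPoch q k) := by
      rw [qPoch_succ, Polynomial.smul_eq_C_mul]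
      ring
    -- With `⟨m⟩` for `qInt q m`, putting the two terms of the splitting over a common denominator
    -- leaves the numerator `⟨n+k+2⟩ - q^{2(k+1)} ⟨n+1⟩`. This identity says that it equals `⟨k+1⟩`.
    have h1 : (qInt q (n + (k + 1) + 1) : ℂ)
        = qInt q (k + 1) + (q : ℂ) ^ (2 * (k + 1)) * qInt q (n + 1) := by
      rw [show n + (k + 1) + 1 = (k + 1) + (n + 1) by ring, qInt_add]
      push_cast
      ring
    rw [e, map_sub, map_smul, ih, ih, smul_eq_mul,
      Finset.prod_range_succ (fun i => (qInt q (i + 1) : ℂ)) k,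
      Finset.prod_range_succ (fun i => (qInt q (n + i + 1) : ℂ)) (k + 1)]
    have h2 : ∏ i ∈ Finset.range (k + 1), (qInt q (n + 1 + i + 1) : ℂ)
        = (∏ i ∈ Finset.range (k + 1), (qInt q (n + i + 1) : ℂ)) * qInt q (n + (k + 1) + 1)
          / qInt q (n + 1) := by
      rw [eq_div_iff (h0 n), ← Finset.prod_range_succ (fun i => (qInt q (n + i + 1) : ℂ)),
        Finset.prod_range_succ' (fun i => (qInt q (n + i + 1) : ℂ))]
      simp only [add_zero]
      congr 1
      refine Finset.prod_congr rfl fun i _ => ?_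
      rw [show n + 1 + i = n + (i + 1) by ring]
    rw [h2]
    have h3 : ∏ i ∈ Finset.range (k + 1), (qInt q (n + i + 1) : ℂ) ≠ 0 :=
      Finset.prod_ne_zero_iff.2 fun i _ => h0 _
    have h4 := h0 (n + (k + 1))
    have h5 := h0 n
    field_simp
    rw [h1]
    ring

/-- The case `n = 0` of the beta integral. It is the value of the Haar state on `(a^*)^k a^k`, and
so shows that the prefactor of `h_N` makes `h_N` unital. -/
theorem jackson_qPoch {q : ℝ} (hq : 0 < q) (k : ℕ) :
    jackson q (qPoch q k) = (qInt q (k + 1) : ℂ)⁻¹ := by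
  have h0 : ∀ m, (qInt q (m + 1) : ℂ) ≠ 0 := fun m => by
    exact_mod_cast (qInt_succ_pos hq.le m).ne'
  have := jackson_X_pow_mul_qPoch hq 0 k
  simp only [pow_zero, one_mul, zero_add] at this
  rw [this, Finset.prod_range_succ]
  have h3 : ∏ i ∈ Finset.range k, (qInt q (i + 1) : ℂ) ≠ 0 :=
    Finset.prod_ne_zero_iff.2 fun i _ => h0 _
  field_simp

end QuantumSU2

end

noncomputable section

namespace QuantumSU2

namespace Coord

variable {q : ℝ}

/-! ### A representation by weighted shifts -/

/-- The space of the weighted-shift representation: families of polynomials indexed by degree. -/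
abbrev ShiftSpace : Type := ℤ × ℤ → ℂ[X]

variable (q) in
/-- The action of `a`: it raises the first degree. -/
def shiftA : Module.End ℂ ShiftSpace where
  toFun φ p := (q : ℂ) ^ (-p.2) • dilate ((q : ℂ) ^ 2)⁻¹ (φ (p.1 - 1, p.2))
  map_add' φ ψ := by ext1 p; simp only [Pi.add_apply, map_add, smul_add]
  map_smul' c φ := by
    ext1 p; simp only [Pi.smul_apply, map_smul, RingHom.id_apply]; rw [smul_comm]

variable (q) in
/-- The action of `a^*`: it lowers the first degree. -/
def shiftStarA : Module.End ℂ ShiftSpace where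
  toFun φ p := (q : ℂ) ^ p.2 • ((1 - Polynomial.C ((q : ℂ) ^ 2) * Polynomial.X) *
    dilate ((q : ℂ) ^ 2) (φ (p.1 + 1, p.2)))
  map_add' φ ψ := by ext1 p; simp only [Pi.add_apply, map_add, mul_add, smul_add]
  map_smul' c φ := by
    ext1 p
    simp only [Pi.smul_apply, map_smul, RingHom.id_apply, mul_smul_comm]
    rw [smul_comm]

/-- The action of `b`: it raises the second degree. -/
def shiftB : Module.End ℂ ShiftSpace where
  toFun φ p := φ (p.1, p.2 - 1)
  map_add' _ _ := rfl
  map_smul' _ _ := rfl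

/-- The action of `b^*`: it lowers the second degree. -/
def shiftStarB : Module.End ℂ ShiftSpace where
  toFun φ p := Polynomial.X * φ (p.1, p.2 + 1)
  map_add' φ ψ := by ext1 p; simp only [Pi.add_apply, mul_add]
  map_smul' c φ := by ext1 p; simp only [Pi.smul_apply, mul_smul_comm, RingHom.id_apply]

/-- The formulas are those of left multiplication on formal sums of `b^j g(t) a^i` when `a` and `b`
are inverted, so that `b^* = t b^{-1}` and `a^* = (1 - q^2 t) a^{-1}`. The representation lets
coefficients of monomials be read off without first proving that the monomials are independent. -/
theorem relations_shift (hq : q ≠ 0) :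
    Relations q (shiftA q) (shiftStarA q) shiftB shiftStarB := by
  have hc : (q : ℂ) ≠ 0 := by simpa using hq
  have hc2 : (q : ℂ) ^ 2 ≠ 0 := pow_ne_zero 2 hc
  constructor <;> refine LinearMap.ext fun φ => funext fun p => ?_ <;>
    simp only [Module.End.mul_apply, LinearMap.smul_apply, LinearMap.add_apply, Pi.smul_apply,
      Pi.add_apply, Module.End.one_apply, shiftA, shiftStarA, shiftB, shiftStarB,
      LinearMap.coe_mk, AddHom.coe_mk, sub_add_cancel, add_sub_cancel_right, map_mul, map_smul,
      map_sub, map_one, dilate_X, dilate_dilate, inv_mul_cancel₀ hc2, mul_inv_cancel₀ hc2,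
      dilate_one, smul_smul]
  · congr 1
    rw [neg_sub, sub_eq_add_neg, zpow_add₀ hc, zpow_one]
  · rw [mul_assoc (Polynomial.C _), ← Polynomial.smul_eq_C_mul, smul_smul]
    have e : (q : ℂ) ^ (-(p.2 + 1)) = q * (q : ℂ) ^ (-p.2) * ((q : ℂ) ^ 2)⁻¹ := by
      rw [neg_add, zpow_add₀ hc, zpow_neg_one]
      field_simp
    rw [e, mul_smul_comm]
  · rw [mul_smul_comm, smul_smul, mul_assoc (Polynomial.C _), mul_left_comm _ (Polynomial.C _),
      ← Polynomial.smul_eq_C_mul, smul_smul, mul_left_comm _ Polynomial.X]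
    congr 1
    rw [zpow_add₀ hc, zpow_one]
    ring
  · congr 1
    rw [zpow_sub₀ hc, zpow_one]
    field_simp
  · rw [mul_smul_comm, smul_smul, ← zpow_add₀ hc, add_neg_cancel, zpow_zero, one_smul,
      Polynomial.smul_eq_C_mul]
    ring
  · rw [← zpow_add₀ hc, neg_add_cancel, zpow_zero, one_smul, ← Polynomial.algebraMap_eq,
      AlgHom.commutes, ← mul_assoc, ← map_mul, mul_inv_cancel₀ hc2, map_one]
    ring

/-- The weighted-shift representation. -/
def shiftRep (hq : q ≠ 0) : Coord q →ₐ[ℂ] Module.End ℂ ShiftSpace := lift (relations_shift hq)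

variable (q) in
theorem shiftRep_a (hq : q ≠ 0) : shiftRep hq (a q) = shiftA q := lift_gen _ _

variable (q) in
theorem shiftRep_b (hq : q ≠ 0) : shiftRep hq (b q) = shiftB := lift_gen _ _

theorem shiftRep_star_a (hq : q ≠ 0) : shiftRep hq (star (a q)) = shiftStarA q := by
  rw [star_a]
  exact lift_gen _ _

theorem shiftRep_star_b (hq : q ≠ 0) : shiftRep hq (star (b q)) = shiftStarB := by
  rw [star_b]
  exact lift_gen _ _

theorem shiftRep_t (hq : q ≠ 0) (φ : ShiftSpace) (p : ℤ × ℤ) :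
    shiftRep hq (t q) φ p = Polynomial.X * φ p := by
  rw [t, map_mul, shiftRep_b, shiftRep_star_b]
  simp [shiftB, shiftStarB]

theorem shiftRep_pt (hq : q ≠ 0) (g : ℂ[X]) (φ : ShiftSpace) (p : ℤ × ℤ) :
    shiftRep hq (pt q g) φ p = g * φ p := by
  induction g using Polynomial.induction_on generalizing φ with
  | C c =>
    rw [← Polynomial.algebraMap_eq, AlgHom.commutes, AlgHom.commutes, Module.algebraMap_end_apply,
      Pi.smul_apply, Algebra.smul_def]
  | add f g hf hg => rw [map_add, map_add, LinearMap.add_apply, Pi.add_apply, hf, hg, add_mul]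
  | monomial n c h =>
    rw [pow_succ, ← mul_assoc, map_mul, map_mul, pt_X, Module.End.mul_apply, h, shiftRep_t,
      ← mul_assoc]

/-- The family `φ` is concentrated in degree `p`. -/
def SupportedAt (p : ℤ × ℤ) (φ : ShiftSpace) : Prop := ∀ p', p' ≠ p → φ p' = 0

theorem supportedAt_pow {T : Module.End ℂ ShiftSpace} {d : ℤ × ℤ}
    (hT : ∀ p φ, SupportedAt p φ → SupportedAt (p + d) (T φ)) (n : ℕ) {p : ℤ × ℤ}
    {φ : ShiftSpace} (h : SupportedAt p φ) : SupportedAt (p + n • d) ((T ^ n) φ) := by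
  induction n with
  | zero => simpa using h
  | succ n ih =>
    rw [pow_succ', Module.End.mul_apply, succ_nsmul, ← add_assoc]
    exact hT _ _ ih

theorem supportedAt_shiftA (p : ℤ × ℤ) (φ : ShiftSpace) (h : SupportedAt p φ) :
    SupportedAt (p + (1, 0)) (shiftA q φ) := fun p' hp' => by
  simp only [shiftA, LinearMap.coe_mk, AddHom.coe_mk]
  rw [h, map_zero, smul_zero]
  rintro rfl
  exact hp' (by simp)

theorem supportedAt_shiftStarA (p : ℤ × ℤ) (φ : ShiftSpace) (h : SupportedAt p φ) :
    SupportedAt (p + (-1, 0)) (shiftStarA q φ) := fun p' hp' => by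
  simp only [shiftStarA, LinearMap.coe_mk, AddHom.coe_mk]
  rw [h, map_zero, mul_zero, smul_zero]
  rintro rfl
  exact hp' (by simp)

theorem supportedAt_shiftB (p : ℤ × ℤ) (φ : ShiftSpace) (h : SupportedAt p φ) :
    SupportedAt (p + (0, 1)) (shiftB φ) := fun p' hp' => by
  simp only [shiftB, LinearMap.coe_mk, AddHom.coe_mk]
  rw [h]
  rintro rfl
  exact hp' (by simp)

theorem supportedAt_shiftStarB (p : ℤ × ℤ) (φ : ShiftSpace) (h : SupportedAt p φ) :
    SupportedAt (p + (0, -1)) (shiftStarB φ) := fun p' hp' => by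
  simp only [shiftStarB, LinearMap.coe_mk, AddHom.coe_mk]
  rw [h, mul_zero]
  rintro rfl
  exact hp' (by simp)

/-- Each generator shifts the degree by a fixed amount, so a monomial moves the vacuum to its own
degree. The degree-zero component therefore only sees monomials of degree zero. -/
theorem supportedAt_shiftRep_mono (hq : q ≠ 0) (p : ℤ × ℤ) (g : ℂ[X]) {φ : ShiftSpace}
    (h : SupportedAt 0 φ) : SupportedAt p (shiftRep hq (mono q p g) φ) := by
  have h1 : SupportedAt (p.1, 0) (shiftRep hq (aPow q p.1) φ) := by
    simp only [aPow, map_mul, map_pow, shiftRep_a, shiftRep_star_a, Module.End.mul_apply]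
    have := supportedAt_pow (supportedAt_shiftA (q := q)) p.1.toNat
      (supportedAt_pow (supportedAt_shiftStarA (q := q)) (-p.1).toNat h)
    convert this using 1
    ext <;> simp
    omega
  have h2 : SupportedAt (p.1, 0) (shiftRep hq (pt q g * aPow q p.1) φ) := fun p' hp' => by
    rw [map_mul, Module.End.mul_apply, shiftRep_pt, h1 p' hp', mul_zero]
  rw [mono_apply, mul_assoc, map_mul, Module.End.mul_apply]
  simp only [bPow, map_mul (shiftRep hq) (b q ^ _), map_pow, shiftRep_b, shiftRep_star_b,
    Module.End.mul_apply]
  have := supportedAt_pow supportedAt_shiftB p.2.toNat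
      (supportedAt_pow supportedAt_shiftStarB (-p.2).toNat h2)
  convert this using 1
  ext <;> simp
  omega

/-- The functional that sends `b^j g(t) a^i` to the Jackson integral of `g` if `i = j = 0` and to
zero otherwise. -/
def haarFun (hq : q ≠ 0) : Coord q →ₗ[ℂ] ℂ :=
  jackson q ∘ₗ LinearMap.proj (0 : ℤ × ℤ) ∘ₗ
    LinearMap.applyₗ (Pi.single 0 1 : ShiftSpace) ∘ₗ (shiftRep hq).toLinearMap

theorem haarFun_pt (hq : q ≠ 0) (g : ℂ[X]) : haarFun hq (pt q g) = jackson q g := by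
  change jackson q (shiftRep hq (pt q g) (Pi.single 0 1) 0) = _
  rw [shiftRep_pt, Pi.single_eq_same, mul_one]

theorem haarFun_mono (hq : q ≠ 0) {p : ℤ × ℤ} (hp : p ≠ 0) (g : ℂ[X]) :
    haarFun hq (mono q p g) = 0 := by
  change jackson q (shiftRep hq (mono q p g) (Pi.single 0 1) 0) = _
  rw [supportedAt_shiftRep_mono hq p g (fun p' hp' => Pi.single_eq_of_ne hp' 1) 0 hp.symm, map_zero]

theorem haarFun_torus (hq : q ≠ 0) (z w : ℂˣ) (x : Coord q) :
    haarFun hq (torus z w x) = haarFun hq x := by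
  suffices haarFun hq ∘ₗ (torus z w).toLinearMap = haarFun hq from LinearMap.congr_fun this x
  refine linearMap_ext hq fun p n => ?_
  change haarFun hq (torus z w _) = _
  rw [torus_mono, map_smul]
  by_cases hp : p = 0
  · simp [hp]
  · rw [haarFun_mono hq hp, smul_zero]

end Coord

end QuantumSU2

end

noncomputable section

namespace QuantumSU2

namespace Coord

variable {q : ℝ}

/-! ### Homogeneous elements -/

variable (q) in
/-- The elements of degree `p.1` in `a` and degree `p.2` in `b`. -/
def homog (p : ℤ × ℤ) : Submodule ℂ (Coord q) where
  carrier := {x | ∀ z w : ℂˣ, torus z w x = ((z : ℂ) ^ p.1 * (w : ℂ) ^ p.2) • x}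
  add_mem' hx hy z w := by rw [map_add, hx z w, hy z w, smul_add]
  zero_mem' z w := by rw [map_zero, smul_zero]
  smul_mem' c x hx z w := by rw [map_smul, hx z w, smul_comm]

theorem mono_mem_homog (p : ℤ × ℤ) (g : ℂ[X]) : mono q p g ∈ homog q p :=
  fun z w => torus_mono z w p g

theorem homog_mul {p p' : ℤ × ℤ} {x y : Coord q} (hx : x ∈ homog q p) (hy : y ∈ homog q p') :
    x * y ∈ homog q (p + p') := fun z w => by
  rw [map_mul, hx z w, hy z w, smul_mul_smul_comm, Prod.fst_add, Prod.snd_add,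
    zpow_add₀ (z.ne_zero), zpow_add₀ (w.ne_zero)]
  congr 1
  ring

theorem a_mem_homog : a q ∈ homog q (1, 0) := fun z w => by simp [torus_a]

theorem star_a_mem_homog : star (a q) ∈ homog q (-1, 0) := fun z w => by simp [torus_star_a]

theorem b_mem_homog : b q ∈ homog q (0, 1) := fun z w => by simp [torus_b]

theorem star_b_mem_homog : star (b q) ∈ homog q (0, -1) := fun z w => by simp [torus_star_b]

theorem torus_star (z w : ℂˣ) (x : Coord q) :
    torus z w (star x) = star (torus (star z)⁻¹ (star w)⁻¹ x) := by
  induction x using Coord.induction with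
  | h0 c => rw [star_algebraMap', AlgHom.commutes, AlgHom.commutes, star_algebraMap']
  | hg g =>
    rw [star_gen]
    unfold torus
    rw [lift_gen, lift_gen]
    cases g <;> simp
  | hm x y hx hy => rw [star_mul, map_mul, map_mul, hx, hy, star_mul]
  | ha x y hx hy => rw [star_add, map_add, map_add, hx, hy, star_add]

theorem homog_star {p : ℤ × ℤ} {x : Coord q} (hx : x ∈ homog q p) : star x ∈ homog q (-p) :=
  fun z w => by
  rw [torus_star, hx, star_smul]
  congr 1
  simp

theorem exists_units_zpow_ne_one {n : ℤ} (hn : n ≠ 0) : ∃ z : ℂˣ, (z : ℂ) ^ n ≠ 1 := by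
  refine ⟨Units.mk0 2 two_ne_zero, fun h => hn ?_⟩
  have hreal : (2 : ℝ) ^ n = 1 := by
    have : ((2 : ℝ) : ℂ) ^ n = 1 := by simpa using h
    exact_mod_cast this
  exact (zpow_eq_one_iff_right₀ zero_le_two (by norm_num)).1 hreal

/-- A functional that is invariant under the torus action vanishes in nonzero degrees. -/
theorem eq_zero_of_mem_homog {φ : Coord q →ₗ[ℂ] ℂ} (hφ : ∀ z w x, φ (torus z w x) = φ x)
    {p : ℤ × ℤ} (hp : p ≠ 0) {x : Coord q} (hx : x ∈ homog q p) : φ x = 0 := by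
  have h : ∀ z w : ℂˣ, ((z : ℂ) ^ p.1 * (w : ℂ) ^ p.2 - 1) * φ x = 0 := fun z w => by
    rw [sub_mul, one_mul, ← smul_eq_mul, ← map_smul, ← hx z w, hφ, sub_self]
  by_cases h1 : p.1 = 0
  · have h2 : p.2 ≠ 0 := fun h2 => hp (Prod.ext h1 h2)
    obtain ⟨w, hw⟩ := exists_units_zpow_ne_one h2
    refine (mul_eq_zero.1 (h 1 w)).resolve_left ?_
    simpa [sub_eq_zero] using hw
  · obtain ⟨z, hz⟩ := exists_units_zpow_ne_one h1
    refine (mul_eq_zero.1 (h z 1)).resolve_left ?_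
    simpa [sub_eq_zero] using hz

theorem haarFun_eq_zero (hq : q ≠ 0) {p : ℤ × ℤ} (hp : p ≠ 0) {x : Coord q}
    (hx : x ∈ homog q p) : haarFun hq x = 0 :=
  eq_zero_of_mem_homog (haarFun_torus hq) hp hx

/-! ### The modular property -/

/-- Only degree `(-1, 0)` contributes, that is `x = g(t) a^*`. Then `a x = G(t)` with `G(t) =
g(q^{-2} t)(1 - t)`, while `x a = G(q^2 t)`. Since `G(1) = 0`, the boundary term of `jackson_dilate`
drops out and leaves the factor `q^2`. -/
theorem haarFun_a_mul (hq : 0 < q) (x : Coord q) :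
    haarFun hq.ne' (a q * x) = (q : ℂ) ^ 2 * haarFun hq.ne' (x * a q) := by
  have hq2 : (q : ℂ) ^ 2 ≠ 0 := pow_ne_zero 2 (by simpa using hq.ne')
  suffices haarFun hq.ne' ∘ₗ LinearMap.mulLeft ℂ (a q)
      = (q : ℂ) ^ 2 • (haarFun hq.ne' ∘ₗ LinearMap.mulRight ℂ (a q)) from
    LinearMap.congr_fun this x
  refine linearMap_ext hq.ne' fun p n => ?_
  simp only [LinearMap.comp_apply, LinearMap.mulLeft_apply, LinearMap.smul_apply,
    LinearMap.mulRight_apply, smul_eq_mul]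
  by_cases hp : p = (-1, 0)
  · have e : mono q p (Polynomial.X ^ n) = pt q (Polynomial.X ^ n) * star (a q) := by
      simp [hp, mono_apply, aPow, bPow]
    set g : ℂ[X] := Polynomial.X ^ n
    rw [e, ← mul_assoc, a_mul_pt hq.ne', mul_assoc, a_mul_star_a, mul_assoc, star_a_mul_a]
    have e1 : pt q (dilate ((q : ℂ) ^ 2)⁻¹ g) * (1 - t q)
        = pt q (dilate ((q : ℂ) ^ 2)⁻¹ g * (1 - Polynomial.X)) := by
      rw [map_mul, map_sub, map_one, pt_X]
    have e2 : pt q g * (1 - (q : ℂ) ^ 2 • t q)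
        = pt q (dilate ((q : ℂ) ^ 2) (dilate ((q : ℂ) ^ 2)⁻¹ g * (1 - Polynomial.X))) := by
      rw [map_mul (dilate _), dilate_dilate, inv_mul_cancel₀ hq2, dilate_one, map_mul, map_sub,
        map_sub, map_one, map_one, dilate_X, map_mul, pt_X, ← Polynomial.algebraMap_eq,
        AlgHom.commutes, Algebra.smul_def]
    rw [e1, e2, haarFun_pt, haarFun_pt, jackson_dilate hq]
    simp
  · have h1 : p + (1, 0) ≠ 0 := fun h => hp (by rw [eq_neg_of_add_eq_zero_left h]; rfl)
    rw [haarFun_eq_zero _ h1 (add_comm (1, 0) p ▸ homog_mul a_mem_homog (mono_mem_homog p _)),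
      haarFun_eq_zero _ h1 (homog_mul (mono_mem_homog p _) a_mem_homog), mul_zero]

theorem haarFun_b_mul (hq : q ≠ 0) (x : Coord q) :
    haarFun hq (b q * x) = haarFun hq (x * b q) := by
  suffices haarFun hq ∘ₗ LinearMap.mulLeft ℂ (b q) = haarFun hq ∘ₗ LinearMap.mulRight ℂ (b q) from
    LinearMap.congr_fun this x
  refine linearMap_ext hq fun p n => ?_
  simp only [LinearMap.comp_apply, LinearMap.mulLeft_apply, LinearMap.mulRight_apply]
  by_cases hp : p = (0, -1)
  · have e : mono q p (Polynomial.X ^ n) = star (b q) * pt q (Polynomial.X ^ n) := by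
      simp [hp, mono_apply, aPow, bPow]
    rw [e, ← mul_assoc, b_mul_star_b, mul_assoc, ← (commute_pt commute_b_t _).eq, ← mul_assoc,
      star_b_mul_b]
  · have h1 : p + (0, 1) ≠ 0 := fun h => hp (by rw [eq_neg_of_add_eq_zero_left h]; rfl)
    rw [haarFun_eq_zero _ h1 (add_comm (0, 1) p ▸ homog_mul b_mem_homog (mono_mem_homog p _)),
      haarFun_eq_zero _ h1 (homog_mul (mono_mem_homog p _) b_mem_homog)]

theorem haarFun_a_pow_mul (hq : 0 < q) (k : ℕ) (x : Coord q) :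
    haarFun hq.ne' (a q ^ k * x) = ((q : ℂ) ^ 2) ^ k * haarFun hq.ne' (x * a q ^ k) := by
  induction k generalizing x with
  | zero => simp
  | succ k ih =>
    rw [pow_succ' (a q), mul_assoc, haarFun_a_mul hq, mul_assoc, ih, mul_assoc, ← mul_assoc (_ ^ 2),
      ← pow_succ']

/-! ### Positivity -/

theorem pt_mul_a_pow (g : ℂ[X]) (k : ℕ) :
    pt q g * a q ^ k = a q ^ k * pt q (dilate (((q : ℂ) ^ 2) ^ k) g) := by
  induction k with
  | zero => simp [dilate_one]
  | succ k ih =>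
    rw [pow_succ (a q), ← mul_assoc, ih, mul_assoc, pt_mul_a, dilate_dilate, mul_assoc,
      pow_succ (_ ^ 2)]

theorem star_a_pow_mul_a_pow (k : ℕ) : star (a q) ^ k * a q ^ k = pt q (qPoch q k) := by
  induction k with
  | zero => simp [qPoch]
  | succ k ih =>
    have e : star (a q) * a q = pt q (1 - Polynomial.C ((q : ℂ) ^ 2) * Polynomial.X) := by
      rw [star_a_mul_a, map_sub, map_one, map_mul, pt_X, ← Polynomial.algebraMap_eq,
        AlgHom.commutes, Algebra.smul_def]
    rw [pow_succ (star (a q)), pow_succ' (a q), mul_assoc, ← mul_assoc (star (a q)), e,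
      pt_mul_a_pow, ← mul_assoc, ih, qPoch_succ, map_mul]
    congr 2
    rw [map_sub, map_one, map_mul, dilate_X, ← Polynomial.algebraMap_eq, AlgHom.commutes,
      ← mul_assoc, ← map_mul]
    congr 3
    ring

theorem star_pt (g : ℂ[X]) : star (pt q g) = pt q (g.map (starRingEnd ℂ)) := by
  induction g using Polynomial.induction_on' with
  | add f g hf hg => rw [map_add, star_add, hf, hg, Polynomial.map_add, map_add]
  | monomial n c =>
    rw [Polynomial.map_monomial, pt, Polynomial.aeval_monomial, Polynomial.aeval_monomial,
      star_mul, star_algebraMap', star_pow, star_t, Algebra.commutes]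

theorem star_bPow_mul_bPow (j : ℤ) :
    star (bPow q j) * bPow q j = pt q (Polynomial.X ^ j.natAbs) := by
  rw [map_pow, pt_X]
  obtain ⟨n, rfl | rfl⟩ := j.eq_nat_or_neg
  · rw [bPow_natCast, star_pow, Int.natAbs_natCast, ← star_b_mul_b,
      Commute.mul_pow (by rw [commute_iff_eq, star_b_mul_b, b_mul_star_b])]
  · rw [bPow_neg_natCast, star_pow, star_star, Int.natAbs_neg, Int.natAbs_natCast, t,
      Commute.mul_pow (by rw [commute_iff_eq, star_b_mul_b, b_mul_star_b])]

/-- The product reduces to a polynomial `G = ḡ t^{|j|} g`, nonnegative on `[0, ∞)`, sandwiched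
between powers of `a` or `a^*`. For positive exponents `(a^*)^k a^k` supplies the nonnegative factor
`qPoch`; for negative ones the modular property first carries `a^k` to the right, at the cost of a
positive scalar. What remains is a Jackson integral of a polynomial that is nonnegative on `[0, 1]`.
-/
theorem haarFun_star_mono_mul_mono_nonneg (hq : 0 < q) (hq1 : q ≤ 1) (p : ℤ × ℤ) (g : ℂ[X]) :
    0 ≤ haarFun hq.ne' (star (mono q p g) * mono q p g) := by
  set G : ℂ[X] := g.map (starRingEnd ℂ) * Polynomial.X ^ p.2.natAbs * g with hG
  have e : star (mono q p g) * mono q p g = star (aPow q p.1) * pt q G * aPow q p.1 := by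
    rw [mono_apply, hG, map_mul, map_mul, ← star_bPow_mul_bPow, ← star_pt]
    simp only [star_mul, mul_assoc]
  have hpos : ∀ x : ℝ, 0 ≤ x → 0 ≤ G.eval (x : ℂ) := fun x hx => by
    have e1 : (g.map (starRingEnd ℂ)).eval (x : ℂ) = star (g.eval (x : ℂ)) := by
      have := Polynomial.eval_map_apply (p := g) (f := starRingEnd ℂ) (x : ℂ)
      rw [Complex.conj_ofReal] at this
      exact this
    rw [hG, Polynomial.eval_mul, Polynomial.eval_mul, e1, Polynomial.eval_pow, Polynomial.eval_X,
      mul_right_comm]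
    refine mul_nonneg (star_mul_self_nonneg _) (by exact_mod_cast pow_nonneg hx _)
  rw [e]
  obtain ⟨k, hk | hk⟩ := p.1.eq_nat_or_neg
  · rw [hk, aPow_natCast, mul_assoc, pt_mul_a_pow, ← mul_assoc, star_pow, star_a_pow_mul_a_pow,
      ← map_mul, haarFun_pt]
    refine jackson_nonneg hq hq1 fun x hx hx1 => ?_
    rw [Polynomial.eval_mul, eval_dilate]
    refine mul_nonneg (eval_qPoch_nonneg hq.le hq1 k x hx hx1) ?_
    have h := hpos ((q ^ 2) ^ k * x) (by positivity)
    push_cast at h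
    exact h
  · rw [hk, aPow_neg_natCast, star_pow, star_star, mul_assoc, haarFun_a_pow_mul hq, mul_assoc,
      star_a_pow_mul_a_pow, ← map_mul, haarFun_pt]
    refine mul_nonneg (by exact_mod_cast (by positivity : 0 ≤ (q ^ 2) ^ k))
      (jackson_nonneg hq hq1 fun x hx hx1 => ?_)
    rw [Polynomial.eval_mul]
    exact mul_nonneg (hpos x hx) (eval_qPoch_nonneg hq.le hq1 k x hx hx1)

/-- Monomials of different degrees are orthogonal by torus invariance, so the form is a sum of the
diagonal terms already treated. -/
theorem haarFun_nonneg (hq : 0 < q) (hq1 : q ≤ 1) (x : Coord q) :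
    0 ≤ haarFun hq.ne' (star x * x) := by
  have hx : x ∈ ⨆ p, LinearMap.range (mono q p) := by
    rw [iSup_range_mono hq.ne']; exact Submodule.mem_top
  obtain ⟨f, hf, rfl⟩ := (Submodule.mem_iSup_iff_exists_finsupp _ _).1 hx
  rw [Finsupp.sum, star_sum, Finset.sum_mul_sum, map_sum]
  refine Finset.sum_nonneg fun p hp => ?_
  rw [map_sum, Finset.sum_eq_single p]
  · obtain ⟨g, hg⟩ := hf p
    rw [← hg]
    exact haarFun_star_mono_mul_mono_nonneg hq hq1 p g
  · intro p' _ hp'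
    obtain ⟨g, hg⟩ := hf p
    obtain ⟨g', hg'⟩ := hf p'
    rw [← hg, ← hg']
    refine haarFun_eq_zero _ ?_ (homog_mul (homog_star (mono_mem_homog p g)) (mono_mem_homog p' g'))
    rwa [neg_add_eq_sub, sub_ne_zero]
  · exact fun h => absurd hp h

end Coord

end QuantumSU2

end

noncomputable section

namespace QuantumSU2

namespace Coord

variable {q : ℝ}

/-! ### The coproduct and slice maps -/

variable (q) in
theorem comul_a : comul (a q) = a q ⊗ₜ a q - (q : ℂ) • (star (b q) ⊗ₜ[ℂ] b q) := lift_gen _ _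

variable (q) in
theorem comul_b : comul (b q) = star (a q) ⊗ₜ[ℂ] b q + b q ⊗ₜ a q := lift_gen _ _

variable (q) in
theorem comul_star_a :
    comul (star (a q)) = star (a q) ⊗ₜ star (a q) - (q : ℂ) • (b q ⊗ₜ[ℂ] star (b q)) := by
  conv_lhs => rw [star_a]
  exact lift_gen _ _

variable (q) in
theorem comul_star_b :
    comul (star (b q)) = star (b q) ⊗ₜ[ℂ] star (a q) + a q ⊗ₜ star (b q) := by
  conv_lhs => rw [star_b]
  exact lift_gen _ _

theorem algHom_ext' {A : Type*} [Ring A] [Algebra ℂ A] {f g : Coord q →ₐ[ℂ] A}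
    (ha : f (a q) = g (a q)) (hsa : f (star (a q)) = g (star (a q)))
    (hb : f (b q) = g (b q)) (hsb : f (star (b q)) = g (star (b q))) : f = g := by
  refine algHom_ext fun i => ?_
  cases i
  · exact ha
  · rwa [← star_a]
  · exact hb
  · rwa [← star_b]

/-- Coassociativity. -/
theorem comul_coassoc (x : Coord q) :
    Algebra.TensorProduct.assoc ℂ ℂ ℂ (Coord q) (Coord q) (Coord q)
        (Algebra.TensorProduct.map comul (AlgHom.id ℂ (Coord q)) (comul x))
      = Algebra.TensorProduct.map (AlgHom.id ℂ (Coord q)) comul (comul x) := by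
  suffices ((Algebra.TensorProduct.assoc ℂ ℂ ℂ (Coord q) (Coord q) (Coord q)).toAlgHom.comp
      (Algebra.TensorProduct.map comul (AlgHom.id ℂ (Coord q)))).comp comul
      = (Algebra.TensorProduct.map (AlgHom.id ℂ (Coord q)) comul).comp comul from
    DFunLike.congr_fun this x
  apply algHom_ext' <;>
  simp only [AlgHom.comp_apply, comul_a, comul_b, comul_star_a, comul_star_b, map_add, map_sub,
    map_smul, Algebra.TensorProduct.map_tmul, AlgHom.id_apply, TensorProduct.add_tmul,
    TensorProduct.sub_tmul, TensorProduct.tmul_add, TensorProduct.tmul_sub,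
    ← TensorProduct.smul_tmul', TensorProduct.tmul_smul, AlgEquiv.coe_toAlgHom,
    Algebra.TensorProduct.assoc_tmul] <;>
  module

theorem sliceRight_tmul (φ : Coord q →ₗ[ℂ] ℂ) (x y : Coord q) :
    sliceRight φ (x ⊗ₜ y) = φ y • x := by
  simp [sliceRight]

theorem sliceLeft_tmul (φ : Coord q →ₗ[ℂ] ℂ) (x y : Coord q) :
    sliceLeft φ (x ⊗ₜ y) = φ x • y := by
  simp [sliceLeft]

theorem apply_sliceRight (φ ψ : Coord q →ₗ[ℂ] ℂ) (w : Coord q ⊗[ℂ] Coord q) :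
    φ (sliceRight ψ w) = ψ (sliceLeft φ w) := by
  induction w using TensorProduct.induction_on with
  | zero => simp
  | tmul x y => rw [sliceRight_tmul, sliceLeft_tmul, map_smul, map_smul, smul_eq_mul, smul_eq_mul,
      mul_comm]
  | add v w hv hw => simp only [map_add, hv, hw]

/-- The convolution operator `x ↦ (1 ⊗ φ)Δ(x)`. -/
def convRight (φ : Coord q →ₗ[ℂ] ℂ) : Coord q →ₗ[ℂ] Coord q := sliceRight φ ∘ₗ comul.toLinearMap

/-- The convolution operator `x ↦ (φ ⊗ 1)Δ(x)`. -/
def convLeft (φ : Coord q →ₗ[ℂ] ℂ) : Coord q →ₗ[ℂ] Coord q := sliceLeft φ ∘ₗ comul.toLinearMap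

theorem convRight_apply (φ : Coord q →ₗ[ℂ] ℂ) (x : Coord q) :
    convRight φ x = sliceRight φ (comul x) := rfl

theorem convLeft_apply (φ : Coord q →ₗ[ℂ] ℂ) (x : Coord q) :
    convLeft φ x = sliceLeft φ (comul x) := rfl

theorem apply_convRight (φ ψ : Coord q →ₗ[ℂ] ℂ) (x : Coord q) :
    φ (convRight ψ x) = ψ (convLeft φ x) := apply_sliceRight φ ψ _

/-- This is coassociativity in operator form. Both sides are slices of the same element of the
triple tensor product by the functional `G`, bracketed in the two possible ways. -/
theorem convRight_convRight (φ ψ : Coord q →ₗ[ℂ] ℂ) (x : Coord q) :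
    convRight φ (convRight ψ x) = convRight (φ ∘ₗ convRight ψ) x := by
  let G : Coord q ⊗[ℂ] (Coord q ⊗[ℂ] Coord q) →ₗ[ℂ] Coord q :=
    (TensorProduct.rid ℂ (Coord q)).toLinearMap ∘ₗ
      (φ ∘ₗ sliceRight ψ).lTensor (Coord q)
  have h1 : ∀ w : Coord q ⊗[ℂ] Coord q, sliceRight φ (comul (sliceRight ψ w))
      = G (Algebra.TensorProduct.assoc ℂ ℂ ℂ (Coord q) (Coord q) (Coord q)
        (Algebra.TensorProduct.map comul (AlgHom.id ℂ (Coord q)) w)) := by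
    intro w
    induction w using TensorProduct.induction_on with
    | zero => simp
    | add v w hv hw => simp only [map_add, hv, hw]
    | tmul y z =>
      rw [sliceRight_tmul, map_smul, map_smul, Algebra.TensorProduct.map_tmul, AlgHom.id_apply]
      generalize comul y = v
      induction v using TensorProduct.induction_on with
      | zero => simp
      | add v w hv hw => simp only [map_add, hv, hw, TensorProduct.add_tmul, smul_add]
      | tmul x y =>
        rw [sliceRight_tmul, Algebra.TensorProduct.assoc_tmul]
        simp [G, sliceRight_tmul, smul_smul]
  have h2 : ∀ w : Coord q ⊗[ℂ] Coord q, sliceRight (φ ∘ₗ convRight ψ) w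
      = G (Algebra.TensorProduct.map (AlgHom.id ℂ (Coord q)) comul w) := by
    intro w
    induction w using TensorProduct.induction_on with
    | zero => simp
    | add v w hv hw => simp only [map_add, hv, hw]
    | tmul y z =>
      rw [sliceRight_tmul, Algebra.TensorProduct.map_tmul]
      simp [G, convRight_apply]
  rw [convRight_apply, convRight_apply, h1, comul_coassoc, ← h2, ← convRight_apply]

theorem sliceRight_one_tmul_mul (φ : Coord q →ₗ[ℂ] ℂ) (x y : Coord q)
    (w : Coord q ⊗[ℂ] Coord q) : sliceRight φ ((1 ⊗ₜ x) * w * (1 ⊗ₜ y))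
      = sliceRight (φ ∘ₗ LinearMap.mulRight ℂ y ∘ₗ LinearMap.mulLeft ℂ x) w := by
  induction w using TensorProduct.induction_on with
  | zero => simp
  | add v w hv hw => simp only [map_add, mul_add, add_mul, hv, hw]
  | tmul v w =>
    rw [Algebra.TensorProduct.tmul_mul_tmul, Algebra.TensorProduct.tmul_mul_tmul, sliceRight_tmul,
      sliceRight_tmul, one_mul, mul_one]
    rfl

theorem sliceRight_tmul_one_mul (φ : Coord q →ₗ[ℂ] ℂ) (x y : Coord q)
    (w : Coord q ⊗[ℂ] Coord q) :
    sliceRight φ ((x ⊗ₜ 1) * w * (y ⊗ₜ 1)) = x * sliceRight φ w * y := by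
  induction w using TensorProduct.induction_on with
  | zero => simp
  | add v w hv hw => simp only [map_add, mul_add, add_mul, hv, hw]
  | tmul v w =>
    rw [Algebra.TensorProduct.tmul_mul_tmul, Algebra.TensorProduct.tmul_mul_tmul, sliceRight_tmul,
      sliceRight_tmul, one_mul, mul_one, mul_smul_comm, smul_mul_assoc]

theorem comul_torus (z : ℂˣ) (x : Coord q) : comul (torus z z x)
    = Algebra.TensorProduct.map (AlgHom.id ℂ (Coord q)) (torus z z) (comul x) := by
  suffices comul.comp (torus z z) = (Algebra.TensorProduct.map (AlgHom.id ℂ (Coord q))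
      (torus z z)).comp comul from DFunLike.congr_fun this x
  apply algHom_ext' <;>
  simp only [AlgHom.comp_apply, torus_a, torus_b, torus_star_a, torus_star_b, comul_a, comul_b,
    comul_star_a, comul_star_b, map_add, map_sub, map_smul, Algebra.TensorProduct.map_tmul,
    AlgHom.id_apply, TensorProduct.tmul_smul] <;>
  module

/-- The parameters `(z, z)` scale the columns of `u` and `(z, z⁻¹)` scale its rows. In `u ⊗ u` a
column scaling of the first leg equals a row scaling of the second. This is why convolution with a
torus-invariant functional lands in the circle-fixed elements. -/
theorem map_torus_comul (z : ℂˣ) (x : Coord q) :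
    Algebra.TensorProduct.map (torus z z) (AlgHom.id ℂ (Coord q)) (comul x)
      = Algebra.TensorProduct.map (AlgHom.id ℂ (Coord q)) (torus z z⁻¹) (comul x) := by
  suffices (Algebra.TensorProduct.map (torus (q := q) z z) (AlgHom.id ℂ (Coord q))).comp comul
      = (Algebra.TensorProduct.map (AlgHom.id ℂ (Coord q)) (torus z z⁻¹)).comp comul from
    DFunLike.congr_fun this x
  apply algHom_ext' <;>
  simp only [AlgHom.comp_apply, torus_a, torus_b, torus_star_a, torus_star_b, comul_a, comul_b,
    comul_star_a, comul_star_b, map_add, map_sub, map_smul, Algebra.TensorProduct.map_tmul,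
    AlgHom.id_apply, TensorProduct.tmul_smul, ← TensorProduct.smul_tmul', Units.val_inv_eq_inv_val,
    inv_inv]

theorem sliceRight_map (φ : Coord q →ₗ[ℂ] ℂ) (f g : Coord q →ₐ[ℂ] Coord q)
    (w : Coord q ⊗[ℂ] Coord q) : sliceRight φ (Algebra.TensorProduct.map f g w)
      = f (sliceRight (φ ∘ₗ g.toLinearMap) w) := by
  induction w using TensorProduct.induction_on with
  | zero => simp
  | add v w hv hw => simp only [map_add, hv, hw]
  | tmul v w =>
    rw [Algebra.TensorProduct.map_tmul, sliceRight_tmul, sliceRight_tmul, map_smul]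
    rfl

theorem convRight_torus (φ : Coord q →ₗ[ℂ] ℂ) (z : ℂˣ) (x : Coord q) :
    convRight φ (torus z z x) = convRight (φ ∘ₗ (torus z z).toLinearMap) x := by
  rw [convRight_apply, comul_torus, sliceRight_map]
  rfl

theorem torus_convRight (φ : Coord q →ₗ[ℂ] ℂ) (z : ℂˣ) (x : Coord q) :
    torus z z (convRight φ x) = convRight (φ ∘ₗ (torus z z⁻¹).toLinearMap) x := by
  have := congrArg (sliceRight φ) (map_torus_comul z x)
  rw [sliceRight_map, sliceRight_map] at this
  exact this

/-! ### Twisted derivations -/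

section Twisted

variable {φ k l : Coord q →ₗ[ℂ] ℂ}

theorem sliceRight_mul (h : ∀ x y, φ (x * y) = φ x * φ y) (v w : Coord q ⊗[ℂ] Coord q) :
    sliceRight φ (v * w) = sliceRight φ v * sliceRight φ w := by
  induction v using TensorProduct.induction_on with
  | zero => simp
  | add v v' hv hv' => simp only [add_mul, map_add, hv, hv']
  | tmul x y =>
    induction w using TensorProduct.induction_on with
    | zero => simp
    | add w w' hw hw' => simp only [mul_add, map_add, hw, hw']
    | tmul x' y' =>
      simp only [Algebra.TensorProduct.tmul_mul_tmul, sliceRight_tmul, h, smul_mul_smul_comm]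

theorem sliceRight_mul_of_leibniz (h : ∀ x y, φ (x * y) = φ x * k y + l x * φ y)
    (v w : Coord q ⊗[ℂ] Coord q) : sliceRight φ (v * w)
      = sliceRight φ v * sliceRight k w + sliceRight l v * sliceRight φ w := by
  induction v using TensorProduct.induction_on with
  | zero => simp
  | add v v' hv hv' => simp only [add_mul, map_add, hv, hv']; abel
  | tmul x y =>
    induction w using TensorProduct.induction_on with
    | zero => simp
    | add w w' hw hw' => simp only [mul_add, map_add, hw, hw']; abel
    | tmul x' y' =>
      simp only [Algebra.TensorProduct.tmul_mul_tmul, sliceRight_tmul, h, smul_mul_smul_comm,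
        add_smul]

theorem convRight_mul_of_leibniz (h : ∀ x y, φ (x * y) = φ x * k y + l x * φ y) (x y : Coord q) :
    convRight φ (x * y) = convRight φ x * convRight k y + convRight l x * convRight φ y := by
  simp only [convRight_apply, map_mul, sliceRight_mul_of_leibniz h]

end Twisted

/-- The character `a ↦ z`, `a^* ↦ z⁻¹`, `b, b^* ↦ 0`. -/
def character (z : ℂˣ) : Coord q →ₐ[ℂ] ℂ := counit.comp (torus z 1)

theorem counit_a : counit (a q) = 1 := lift_gen _ _

theorem counit_b : counit (b q) = 0 := lift_gen _ _

theorem counit_star_a : counit (star (a q)) = 1 := by rw [counit_star, counit_a, star_one]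

theorem counit_star_b : counit (star (b q)) = 0 := by rw [counit_star, counit_b, star_zero]

theorem character_a (z : ℂˣ) : character z (a q) = z := by
  simp [character, torus_a, counit_a]

theorem character_b (z : ℂˣ) : character z (b q) = 0 := by
  simp [character, torus_b, counit_b]

theorem character_star_a (z : ℂˣ) : character z (star (a q)) = (z : ℂ)⁻¹ := by
  simp [character, torus_star_a, counit_star_a]

theorem character_star_b (z : ℂˣ) : character z (star (b q)) = 0 := by
  simp [character, torus_star_b, counit_star_b]

/-- Slicing with a multiplicative functional is an algebra homomorphism, so generators decide. It
turns the twists by `k` and `k⁻¹` in the Leibniz rule into the torus automorphisms `K` and `Kinv`.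
-/
theorem convRight_character (z : ℂˣ) (x : Coord q) :
    convRight (character z).toLinearMap x = torus z z x := by
  let f : Coord q →ₐ[ℂ] Coord q := AlgHom.ofLinearMap (convRight (character z).toLinearMap)
    (by rw [convRight_apply, map_one, Algebra.TensorProduct.one_def, sliceRight_tmul]; simp)
    (fun x y => by
      rw [convRight_apply, map_mul, sliceRight_mul fun x y => map_mul (character z) x y]; rfl)
  suffices f = torus z z from DFunLike.congr_fun this x
  apply algHom_ext' <;>
  simp only [f, AlgHom.ofLinearMap_apply, convRight_apply, comul_a, comul_b, comul_star_a,
    comul_star_b, map_add, map_sub, map_smul, sliceRight_tmul, AlgHom.toLinearMap_apply,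
    character_a, character_b, character_star_a, character_star_b, torus_a, torus_b, torus_star_a,
    torus_star_b, zero_smul, smul_zero, add_zero, zero_add, sub_zero]

end Coord

/-! ### The derivations `∂_e` and `∂_f` -/

section Derivations

variable (q : Set.Ioc (0 : ℝ) 1)

open Coord

/-- The unit `q^{1/2}`. -/
def sqrtUnit : ℂˣ := Units.mk0 (sqrtq q) (sqrtq_ne_zero q)

theorem coe_sqrtUnit : (sqrtUnit q : ℂ) = sqrtq q := rfl

/-- Matrices on the generators are upper triangular, hence so is the whole image, and the diagonal
entries are characters. Multiplying two such matrices gives the twisted Leibniz rule for the corner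
entry. -/
theorem lift_triangular_apply (s t : ℂ) (x : Coord (q : ℝ)) :
    Coord.lift (relations_triangular q s t) x 1 0 = 0 ∧
    Coord.lift (relations_triangular q s t) x 0 0 = character (sqrtUnit q)⁻¹ x ∧
    Coord.lift (relations_triangular q s t) x 1 1 = character (sqrtUnit q) x := by
  induction x using Coord.induction with
  | h0 c => simp only [AlgHom.commutes]; simp [Matrix.algebraMap_matrix_apply]
  | hg g =>
    have h1 := fun z : ℂˣ => character_star_a (q := (q : ℝ)) z
    have h2 := fun z : ℂˣ => character_star_b (q := (q : ℝ)) z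
    have h3 := fun z : ℂˣ => character_a (q := (q : ℝ)) z
    have h4 := fun z : ℂˣ => character_b (q := (q : ℝ)) z
    rw [star_a] at h1
    rw [star_b] at h2
    rw [a] at h3
    rw [b] at h4
    rw [lift_gen]
    cases g <;> simp [h1, h2, h3, h4, coe_sqrtUnit]
  | hm x y hx hy =>
    simp only [map_mul, Matrix.mul_apply, Fin.sum_univ_two, hx.1, hx.2.1, hx.2.2, hy.1, hy.2.1,
      hy.2.2, mul_zero, zero_mul, add_zero, zero_add, and_self]
  | ha x y hx hy =>
    simp only [map_add, Matrix.add_apply, hx.1, hx.2.1, hx.2.2, hy.1, hy.2.1, hy.2.2, add_zero,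
      and_self]

theorem pairE_mul (x y : Coord (q : ℝ)) : pairE q (x * y)
    = pairE q x * (character (sqrtUnit q)).toLinearMap y
      + (character (sqrtUnit q)⁻¹).toLinearMap x * pairE q y := by
  have h1 := (lift_triangular_apply q (-((q : ℝ) : ℂ)⁻¹) 0 x).2.1
  have h2 := (lift_triangular_apply q (-((q : ℝ) : ℂ)⁻¹) 0 y).2.2
  change pairHomE q (x * y) 0 1 = pairHomE q x 0 1 * character (sqrtUnit q) y
    + character (sqrtUnit q)⁻¹ x * pairHomE q y 0 1
  rw [map_mul, Matrix.mul_apply, Fin.sum_univ_two, ← h1, ← h2, add_comm]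
  rfl

theorem pairF_mul (x y : Coord (q : ℝ)) : pairF q (x * y)
    = pairF q x * (character (sqrtUnit q)).toLinearMap y
      + (character (sqrtUnit q)⁻¹).toLinearMap x * pairF q y := by
  have h1 := (lift_triangular_apply q 0 1 x).2.1
  have h2 := (lift_triangular_apply q 0 1 y).2.2
  change pairHomF q (x * y) 0 1 = pairHomF q x 0 1 * character (sqrtUnit q) y
    + character (sqrtUnit q)⁻¹ x * pairHomF q y 0 1
  rw [map_mul, Matrix.mul_apply, Fin.sum_univ_two, ← h1, ← h2, add_comm]
  rfl

theorem pairE_a : pairE q (a q) = 0 :=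
  congrFun (congrFun (lift_gen (relations_triangular q (-((q : ℝ) : ℂ)⁻¹) 0) Gen.a) 0) 1

theorem pairE_b : pairE q (b q) = -((q : ℝ) : ℂ)⁻¹ :=
  congrFun (congrFun (lift_gen (relations_triangular q (-((q : ℝ) : ℂ)⁻¹) 0) Gen.b) 0) 1

theorem pairE_star_a : pairE q (star (a q)) = 0 := by
  rw [star_a]
  exact congrFun (congrFun (lift_gen (relations_triangular q (-((q : ℝ) : ℂ)⁻¹) 0) Gen.as) 0) 1

theorem pairE_star_b : pairE q (star (b q)) = 0 := by
  rw [star_b]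
  exact congrFun (congrFun (lift_gen (relations_triangular q (-((q : ℝ) : ℂ)⁻¹) 0) Gen.bs) 0) 1

theorem pairF_a : pairF q (a q) = 0 :=
  congrFun (congrFun (lift_gen (relations_triangular q 0 1) Gen.a) 0) 1

theorem pairF_b : pairF q (b q) = 0 :=
  congrFun (congrFun (lift_gen (relations_triangular q 0 1) Gen.b) 0) 1

theorem pairF_star_a : pairF q (star (a q)) = 0 := by
  rw [star_a]
  exact congrFun (congrFun (lift_gen (relations_triangular q 0 1) Gen.as) 0) 1

theorem pairF_star_b : pairF q (star (b q)) = 1 := by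
  rw [star_b]
  exact congrFun (congrFun (lift_gen (relations_triangular q 0 1) Gen.bs) 0) 1

/-- The automorphism `∂_k`, that is `a ↦ q^{1/2} a`, `b ↦ q^{1/2} b`. -/
def K : Coord (q : ℝ) →ₐ[ℂ] Coord (q : ℝ) := torus (sqrtUnit q) (sqrtUnit q)

/-- The inverse of the automorphism `∂_k`. -/
def Kinv : Coord (q : ℝ) →ₐ[ℂ] Coord (q : ℝ) := torus (sqrtUnit q)⁻¹ (sqrtUnit q)⁻¹

theorem partialE_eq : partialE q = convRight (pairE q) := rfl

theorem partialF_eq : partialF q = convRight (pairF q) := rfl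

theorem partialE_mul (x y : Coord (q : ℝ)) :
    partialE q (x * y) = partialE q x * K q y + Kinv q x * partialE q y := by
  rw [partialE_eq, convRight_mul_of_leibniz (pairE_mul q), convRight_character,
    convRight_character]
  rfl

theorem partialF_mul (x y : Coord (q : ℝ)) :
    partialF q (x * y) = partialF q x * K q y + Kinv q x * partialF q y := by
  rw [partialF_eq, convRight_mul_of_leibniz (pairF_mul q), convRight_character,
    convRight_character]
  rfl

theorem coe_ne_zero : ((q : ℝ) : ℂ) ≠ 0 := Complex.ofReal_ne_zero.2 q.2.1.ne'

theorem partialE_a : partialE q (a q) = star (b q) := by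
  rw [partialE_eq, convRight_apply, comul_a, map_sub, map_smul, sliceRight_tmul, sliceRight_tmul,
    pairE_a, pairE_b, zero_smul, zero_sub, neg_smul, smul_neg, neg_neg, smul_smul,
    mul_inv_cancel₀ (coe_ne_zero q), one_smul]

theorem partialE_b : partialE q (b q) = -((q : ℝ) : ℂ)⁻¹ • star (a q) := by
  simp [partialE_eq, convRight_apply, comul_b, sliceRight_tmul, pairE_a, pairE_b]

theorem partialE_star_a : partialE q (star (a q)) = 0 := by
  simp [partialE_eq, convRight_apply, comul_star_a, sliceRight_tmul, pairE_star_a, pairE_star_b]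

theorem partialE_star_b : partialE q (star (b q)) = 0 := by
  simp [partialE_eq, convRight_apply, comul_star_b, sliceRight_tmul, pairE_star_a, pairE_star_b]

theorem partialF_a : partialF q (a q) = 0 := by
  simp [partialF_eq, convRight_apply, comul_a, sliceRight_tmul, pairF_a, pairF_b]

theorem partialF_b : partialF q (b q) = 0 := by
  simp [partialF_eq, convRight_apply, comul_b, sliceRight_tmul, pairF_a, pairF_b]

theorem partialF_star_a : partialF q (star (a q)) = -((q : ℝ) : ℂ) • b q := by
  simp [partialF_eq, convRight_apply, comul_star_a, sliceRight_tmul, pairF_star_a, pairF_star_b]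

theorem partialF_star_b : partialF q (star (b q)) = a q := by
  simp [partialF_eq, convRight_apply, comul_star_b, sliceRight_tmul, pairF_star_a, pairF_star_b]

theorem partialE_one : partialE q 1 = 0 := by
  have h := partialE_mul q 1 1
  simpa using h

theorem partialF_one : partialF q 1 = 0 := by
  have h := partialF_mul q 1 1
  simpa using h

end Derivations

end QuantumSU2

end

noncomputable section

namespace QuantumSU2

open Coord

variable (q : Set.Ioc (0 : ℝ) 1)

/-! ### The image of `∂_e` -/

theorem K_t : K q (t q) = t q := torus_t _ _

theorem Kinv_t : Kinv q (t q) = t q := torus_t _ _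

theorem K_a : K q (a q) = sqrtq q • a q := torus_a _ _

theorem K_b : K q (b q) = sqrtq q • b q := torus_b _ _

theorem K_star_a : K q (star (a q)) = (sqrtq q)⁻¹ • star (a q) := torus_star_a _ _

theorem K_star_b : K q (star (b q)) = (sqrtq q)⁻¹ • star (b q) := torus_star_b _ _

theorem Kinv_a : Kinv q (a q) = (sqrtq q)⁻¹ • a q := by
  rw [Kinv, torus_a, Units.val_inv_eq_inv_val]; rfl

theorem Kinv_b : Kinv q (b q) = (sqrtq q)⁻¹ • b q := by
  rw [Kinv, torus_b, Units.val_inv_eq_inv_val]; rfl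

theorem Kinv_star_b : Kinv q (star (b q)) = sqrtq q • star (b q) := by
  rw [Kinv, torus_star_b, Units.val_inv_eq_inv_val, inv_inv]; rfl

theorem sqrtq_eq : sqrtq q = ((√(q : ℝ) : ℝ) : ℂ) := rfl

theorem sqrt_pos : 0 < √(q : ℝ) := Real.sqrt_pos.2 q.2.1

theorem coe_eq_sqrtq_sq : ((q : ℝ) : ℂ) = sqrtq q ^ 2 := by rw [sq, sqrtq_mul_self]

theorem star_a_mul_star_b_mul_t : star (a q) * star (b q) * t (q : ℝ)
    = ((q : ℝ) : ℂ) ^ 2 • (t (q : ℝ) * (star (a q) * star (b q))) := by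
  rw [mul_assoc, commute_star_b_t.eq, ← mul_assoc, star_a_mul_t, smul_mul_assoc, mul_assoc]

theorem partialE_t_pow_succ (n : ℕ) : partialE q (t (q : ℝ) ^ (n + 1))
    = -(((q : ℝ) : ℂ)⁻¹ * (sqrtq q)⁻¹ * (qInt q (n + 1) : ℂ)) •
      (t (q : ℝ) ^ n * (star (a q) * star (b q))) := by
  have h1 : partialE q (t (q : ℝ))
      = -(((q : ℝ) : ℂ)⁻¹ * (sqrtq q)⁻¹) • (star (a q) * star (b q)) := by
    rw [t, partialE_mul, partialE_b, partialE_star_b, mul_zero, add_zero, K_star_b,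
      smul_mul_smul_comm, neg_mul]
  induction n with
  | zero => simp [h1, qInt]
  | succ n ih =>
    have e : (qInt q (n + 1 + 1) : ℂ) = 1 + ((q : ℝ) : ℂ) ^ 2 * qInt q (n + 1) := by
      rw [add_comm (n + 1), qInt_add]
      simp [qInt]
    rw [pow_succ, partialE_mul, ih, K_t, map_pow, Kinv_t, h1, smul_mul_assoc,
      mul_assoc (t _ ^ n),
      star_a_mul_star_b_mul_t, mul_smul_comm, mul_smul_comm, ← mul_assoc, ← pow_succ, smul_smul,
      ← add_smul, e]
    congr 1
    ring

theorem star_a_mul_star_b_mul_a_pow (k : ℕ) : star (a q) * star (b q) * a q ^ (k + 1)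
    = ((q : ℝ) : ℂ) • ((1 - ((q : ℝ) : ℂ) ^ 2 • t (q : ℝ)) * (star (b q) * a q ^ k)) := by
  rw [pow_succ', mul_assoc, ← mul_assoc (star (b q)), star_b_mul_a, smul_mul_assoc, mul_smul_comm,
    mul_assoc, ← mul_assoc, star_a_mul_a]

theorem star_a_mul_t_pow (n : ℕ) : star (a q) * t (q : ℝ) ^ n
    = ((q : ℝ) : ℂ) ^ (2 * n) • (t (q : ℝ) ^ n * star (a q)) := by
  rw [mul_pow_eq_smul_pow_mul star_a_mul_t, pow_mul]

/-- This recursion dictates the Haar moments: a functional that kills the image of `∂_e` must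
satisfy `⟨n+2⟩ h(t^{n+1}) = ⟨n+1⟩ h(t^n)`, where `⟨m⟩ = qInt q m`. -/
theorem partialE_b_mul_t_pow_mul_a (n : ℕ) : partialE q (b q * t (q : ℝ) ^ n * a q)
    = (sqrtq q)⁻¹ • ((qInt q (n + 2) : ℂ) • t (q : ℝ) ^ (n + 1)
      - (qInt q (n + 1) : ℂ) • t (q : ℝ) ^ n) := by
  have hs := sqrtq_ne_zero q
  have hq := coe_ne_zero q
  have f1 : star (a q) * t (q : ℝ) ^ n * a q
      = ((q : ℝ) : ℂ) ^ (2 * n) • (t (q : ℝ) ^ n - ((q : ℝ) : ℂ) ^ 2 • t (q : ℝ) ^ (n + 1)) := by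
    rw [star_a_mul_t_pow, smul_mul_assoc, mul_assoc, star_a_mul_a, mul_sub, mul_one, mul_smul_comm,
      ← pow_succ]
  have f3 : b q * t (q : ℝ) ^ n * star (b q) = t (q : ℝ) ^ (n + 1) := by
    rw [(commute_b_t.pow_right n).eq, mul_assoc, b_mul_star_b, ← pow_succ]
  have e1 : (qInt q (n + 2) : ℂ) = 1 + ((q : ℝ) : ℂ) ^ 2 * qInt q (n + 1) := by
    rw [show n + 2 = 1 + (n + 1) by ring, qInt_add]
    simp [qInt]
  have e2 : (qInt q (n + 1) : ℂ) = qInt q n + ((q : ℝ) : ℂ) ^ (2 * n) := by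
    rw [qInt_succ]
    push_cast
    rfl
  have f2 : b q * partialE q (t (q : ℝ) ^ n) * a q = -((sqrtq q)⁻¹ * (qInt q n : ℂ)) •
      (t (q : ℝ) ^ n - ((q : ℝ) : ℂ) ^ 2 • t (q : ℝ) ^ (n + 1)) := by
    cases n with
    | zero => simp [partialE_one, qInt]
    | succ n =>
      have := star_a_mul_star_b_mul_a_pow q 0
      rw [zero_add, pow_one, pow_zero, mul_one] at this
      rw [partialE_t_pow_succ, mul_smul_comm, smul_mul_assoc, ← mul_assoc, mul_assoc _ _ (a _),
        this, mul_smul_comm, (commute_b_t.pow_right n).eq, mul_assoc (t _ ^ n), ← mul_assoc (b _),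
        mul_sub,
        mul_one, mul_smul_comm, commute_b_t.eq, sub_mul, smul_mul_assoc, mul_assoc (t _),
        b_mul_star_b, mul_sub, mul_smul_comm, ← mul_assoc (t _ ^ n), ← pow_succ, ← pow_succ,
        smul_smul]
      congr 1
      field_simp
  rw [partialE_mul, partialE_mul, partialE_a, partialE_b, K_a, map_pow (K q), K_t,
    map_mul (Kinv q), map_pow (Kinv q), Kinv_t, Kinv_b]
  simp only [add_mul, smul_mul_assoc, mul_smul_comm, f1, f2, f3]
  have e3 : ((q : ℝ) : ℂ)⁻¹ * sqrtq q = (sqrtq q)⁻¹ := by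
    rw [coe_eq_sqrtq_sq]
    field_simp
  rw [e1, e2]
  match_scalars
  · field_simp
    rw [coe_eq_sqrtq_sq]
    ring
  · field_simp
    rw [coe_eq_sqrtq_sq]
    ring

/-- Only the nonvanishing of the constant is needed, in order to divide by it later. Since the
Leibniz rule adds two positive contributions, positivity is the invariant that survives the
induction without a closed formula; the companion lemmas use the same device. -/
theorem partialE_a_pow_succ (m : ℕ) : ∃ c : ℝ, 0 < c ∧
    partialE q (a q ^ (m + 1)) = (c : ℂ) • (star (b q) * a q ^ m) := by
  have hs := sqrt_pos q
  have hq := q.2.1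
  induction m with
  | zero => exact ⟨1, one_pos, by simp [partialE_a]⟩
  | succ m ih =>
    obtain ⟨c, hc, h⟩ := ih
    refine ⟨c * √q + (√q)⁻¹ ^ (m + 1) * (q : ℝ)⁻¹ ^ (m + 1), by positivity, ?_⟩
    have e := mul_pow_eq_smul_pow_mul (star_b_mul_a (q := (q : ℝ))) (m + 1)
    have e' : a q ^ (m + 1) * star (b q)
        = ((q : ℝ) : ℂ)⁻¹ ^ (m + 1) • (star (b q) * a q ^ (m + 1)) := by
      rw [e, smul_smul, ← mul_pow, inv_mul_cancel₀ (coe_ne_zero q), one_pow, one_smul]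
    rw [pow_succ, partialE_mul, h, K_a, map_pow, Kinv_a, partialE_a, smul_pow, smul_mul_smul_comm,
      smul_mul_assoc, e', mul_assoc, ← pow_succ, smul_smul, ← add_smul, sqrtq_eq]
    push_cast
    rfl

theorem partialE_b_pow_succ (m : ℕ) : ∃ c : ℝ, 0 < c ∧
    partialE q (b q ^ (m + 1)) = -(c : ℂ) • (b q ^ m * star (a q)) := by
  have hs := sqrt_pos q
  have hq := q.2.1
  induction m with
  | zero => exact ⟨(q : ℝ)⁻¹, by positivity, by simp [partialE_b]⟩
  | succ m ih =>
    obtain ⟨c, hc, h⟩ := ih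
    refine ⟨c * √q * q + (√q)⁻¹ ^ (m + 1) * (q : ℝ)⁻¹, by positivity, ?_⟩
    rw [pow_succ, partialE_mul, h, K_b, map_pow, Kinv_b, partialE_b, smul_pow, smul_mul_smul_comm,
      smul_mul_smul_comm, mul_assoc, star_a_mul_b, mul_smul_comm, ← mul_assoc, ← pow_succ,
      smul_smul, ← add_smul, sqrtq_eq]
    push_cast
    congr 1
    ring

theorem partialE_star_a_pow (m : ℕ) : partialE q (star (a q) ^ m) = 0 := by
  induction m with
  | zero => simp [partialE_one]
  | succ m ih => rw [pow_succ, partialE_mul, ih, partialE_star_a, zero_mul, mul_zero, add_zero]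

theorem partialE_star_b_pow (m : ℕ) : partialE q (star (b q) ^ m) = 0 := by
  induction m with
  | zero => simp [partialE_one]
  | succ m ih => rw [pow_succ, partialE_mul, ih, partialE_star_b, zero_mul, mul_zero, add_zero]

theorem exists_partialE_eq_star_b_pow_mul_a_pow (k : ℕ) : ∃ c : ℝ, 0 < c ∧
    partialE q (star (b q) ^ k * a q ^ (k + 2))
      = (c : ℂ) • (star (b q) ^ (k + 1) * a q ^ (k + 1)) := by
  have hs := sqrt_pos q
  obtain ⟨c, hc, h⟩ := partialE_a_pow_succ q (k + 1)
  refine ⟨√q ^ k * c, by positivity, ?_⟩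
  rw [partialE_mul, partialE_star_b_pow, zero_mul, zero_add, h, map_pow, Kinv_star_b, smul_pow,
    smul_mul_smul_comm, ← mul_assoc, ← pow_succ, sqrtq_eq]
  push_cast
  rfl

/-- A triangular relation in `n`: the coefficient `c` of the new element must not vanish, while the
term with `d` is already handled by the preceding value of `n`. -/
theorem exists_partialE_eq_star_b_pow_mul_t_pow_mul_a_pow (k n : ℕ) : ∃ c d : ℝ, 0 < c ∧
    partialE q (star (b q) ^ k * (t (q : ℝ) ^ (n + 1) * a q ^ (k + 2)))
      = (c : ℂ) • (star (b q) ^ (k + 1) * t (q : ℝ) ^ (n + 1) * a q ^ (k + 1))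
        - (d : ℂ) • (star (b q) ^ (k + 1) * t (q : ℝ) ^ n * a q ^ (k + 1)) := by
  have hs := sqrt_pos q
  have hq := q.2.1
  have hn := qInt_succ_pos hq.le n
  obtain ⟨c, hc, h⟩ := partialE_a_pow_succ q (k + 1)
  set d : ℝ := (√q)⁻¹ * qInt q (n + 1) * √q ^ (k + 2) with hd
  have hd0 : 0 < d := by positivity
  refine ⟨√q ^ k * (c + d * (q : ℝ) ^ 2), √q ^ k * d, by positivity, ?_⟩
  have f : ∀ m, star (b q) ^ k * (t (q : ℝ) ^ m * (star (b q) * a q ^ (k + 1)))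
      = star (b q) ^ (k + 1) * t (q : ℝ) ^ m * a q ^ (k + 1) := fun m => by
    rw [← mul_assoc (t _ ^ m), ← (commute_star_b_t.pow_right m).eq, pow_succ (star _)]
    simp only [mul_assoc]
  rw [partialE_mul, partialE_star_b_pow, zero_mul, zero_add, map_pow, Kinv_star_b, smul_pow,
    smul_mul_assoc, partialE_mul, partialE_t_pow_succ, h, map_pow, map_pow, Kinv_t, K_a, smul_pow,
    smul_mul_smul_comm, mul_assoc (t _ ^ n), star_a_mul_star_b_mul_a_pow]
  have g : t (q : ℝ) ^ n * ((1 - ((q : ℝ) : ℂ) ^ 2 • t (q : ℝ)) * (star (b q) * a q ^ (k + 1)))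
      = t (q : ℝ) ^ n * (star (b q) * a q ^ (k + 1))
        - ((q : ℝ) : ℂ) ^ 2 • (t (q : ℝ) ^ (n + 1) * (star (b q) * a q ^ (k + 1))) := by
    rw [sub_mul, mul_sub, one_mul, smul_mul_assoc, mul_smul_comm, pow_succ (t _),
        mul_assoc (t _ ^ n)]
  have hq0 := coe_ne_zero q
  have hs0 := sqrtq_ne_zero q
  simp only [mul_smul_comm, g, mul_add, smul_sub, mul_sub, f]
  rw [hd]
  push_cast
  rw [← sqrtq_eq]
  match_scalars
  · field_simp
  · field_simp
    ring

theorem exists_partialE_eq_b_pow_mul_t_pow_mul_star_a_pow (k n : ℕ) : ∃ c : ℝ, 0 < c ∧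
    partialE q (b q ^ (k + 2) * t (q : ℝ) ^ n * star (a q) ^ k)
      = -(c : ℂ) • (b q ^ (k + 1) * t (q : ℝ) ^ n * star (a q) ^ (k + 1)) := by
  have hs := sqrt_pos q
  have hq := q.2.1
  have hn := qInt_nonneg hq.le n
  have hq0 := coe_ne_zero q
  have hs0 := sqrtq_ne_zero q
  obtain ⟨c, hc, h⟩ := partialE_b_pow_succ q (k + 1)
  refine ⟨(√q)⁻¹ ^ k * (c * (q : ℝ) ^ (2 * n) + (√q)⁻¹ ^ (k + 2) * (√q)⁻¹ * qInt q n),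
    by positivity, ?_⟩
  have f : b q ^ (k + 2) * partialE q (t (q : ℝ) ^ n)
      = -((sqrtq q)⁻¹ * (qInt q n : ℂ)) • (b q ^ (k + 1) * t (q : ℝ) ^ n * star (a q)) := by
    cases n with
    | zero => simp [partialE_one, qInt]
    | succ n =>
      rw [partialE_t_pow_succ, mul_smul_comm, star_a_mul_star_b, mul_smul_comm, mul_smul_comm,
        pow_succ (b _), ← mul_assoc (t _ ^ n), ← (commute_star_b_t.pow_right n).eq,
        mul_assoc (b _ ^ _),
        ← mul_assoc (b _), ← mul_assoc (b _), b_mul_star_b, ← pow_succ', ← mul_assoc, smul_smul]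
      congr 1
      field_simp
  rw [partialE_mul, partialE_star_a_pow, mul_zero, add_zero, partialE_mul, h, map_pow (K q),
    map_pow (K q), map_pow (Kinv q), K_t, K_star_a, Kinv_b, smul_pow, smul_pow, smul_mul_assoc,
    smul_mul_assoc, f,
    mul_assoc _ (star _), star_a_mul_t_pow, mul_smul_comm (_ ^ (2 * n)), ← mul_assoc (b _ ^ _),
    smul_smul, smul_smul, ← add_smul, mul_smul_comm, smul_mul_assoc, smul_smul,
    mul_assoc _ (star _), ← pow_succ', sqrtq_eq]
  congr 1
  push_cast
  ring

end QuantumSU2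

end

noncomputable section

namespace QuantumSU2

open Coord

/-! ### Degrees of the derivations -/

section Degrees

variable (q : Set.Ioc (0 : ℝ) 1)

theorem torus_comm (z w z' w' : ℂˣ) (x : Coord (q : ℝ)) :
    torus z w (torus z' w' x) = torus z' w' (torus z w x) := by
  suffices (torus z w).comp (torus z' w') = (torus z' w').comp (torus z w) from
    DFunLike.congr_fun this x
  apply algHom_ext' <;>
  simp only [AlgHom.comp_apply, torus_a, torus_b, torus_star_a, torus_star_b, map_smul] <;>
  rw [smul_comm]

theorem torus_partialE (z w : ℂˣ) (x : Coord (q : ℝ)) :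
    partialE q (torus z w x) = ((z : ℂ) * w) • torus z w (partialE q x) := by
  have hz := z.ne_zero
  have hw := w.ne_zero
  induction x using Coord.induction with
  | h0 c =>
    rw [AlgHom.commutes, Algebra.algebraMap_eq_smul_one, map_smul, partialE_one]
    simp
  | hg g =>
    cases g
    · change partialE q (torus z w (a q)) = _ • torus z w (partialE q (a q))
      rw [torus_a, map_smul, partialE_a, torus_star_b, smul_smul]
      congr 1
      field_simp
    · rw [← star_a, torus_star_a, map_smul, partialE_star_a]
      simp
    · change partialE q (torus z w (b q)) = _ • torus z w (partialE q (b q))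
      rw [torus_b, map_smul, partialE_b, map_smul, torus_star_a, smul_smul, smul_smul, smul_smul]
      congr 1
      field_simp
    · rw [← star_b, torus_star_b, map_smul, partialE_star_b]
      simp
  | hm x y hx hy =>
    rw [map_mul, partialE_mul, hx, hy, partialE_mul, map_add, map_mul, map_mul, K, Kinv,
      torus_comm q (sqrtUnit q), torus_comm q (sqrtUnit q)⁻¹, smul_add, smul_mul_assoc,
      mul_smul_comm]
  | ha x y hx hy => simp only [map_add, hx, hy, smul_add]

theorem partialE_mem_homog {p : ℤ × ℤ} {x : Coord (q : ℝ)} (hx : x ∈ homog (q : ℝ) p) :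
    partialE q x ∈ homog (q : ℝ) (p - (1, 1)) := fun z w => by
  have h := torus_partialE q z w x
  have hz := z.ne_zero
  have hw := w.ne_zero
  rw [hx z w, map_smul] at h
  rw [Prod.fst_sub, Prod.snd_sub, zpow_sub₀ hz, zpow_sub₀ hw]
  simp only [zpow_one]
  rw [← one_smul ℂ (torus z w _), ← inv_mul_cancel₀ (mul_ne_zero hz hw), mul_smul, ← h, smul_smul]
  congr 1
  field_simp

end Degrees

/-! ### Invariance of the Haar functional -/

section Invariance

variable (q : Set.Ioc (0 : ℝ) 1)

/-- The candidate for the Haar state. -/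
def haarCand : Coord (q : ℝ) →ₗ[ℂ] ℂ := haarFun q.2.1.ne'

theorem haarCand_pt (g : ℂ[X]) : haarCand q (pt q g) = jackson q g := haarFun_pt _ g

theorem haarCand_torus (z w : ℂˣ) (x : Coord (q : ℝ)) :
    haarCand q (torus z w x) = haarCand q x := haarFun_torus q.2.1.ne' z w x

theorem haarCand_t_pow (n : ℕ) :
    haarCand q (t (q : ℝ) ^ n) = (qInt q (n + 1) : ℂ)⁻¹ := by
  rw [← jackson_X_pow, ← haarCand_pt, map_pow (pt _), pt_X]

/-- As `∂_e` lowers the degree by `(1, 1)`, only the elements `b t^n a` can contribute. On these the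
moments give `⟨n+2⟩/⟨n+2⟩ - ⟨n+1⟩/⟨n+1⟩ = 0`. -/
theorem haarCand_partialE (x : Coord (q : ℝ)) : haarCand q (partialE q x) = 0 := by
  suffices haarCand q ∘ₗ partialE q = 0 from LinearMap.congr_fun this x
  refine linearMap_ext q.2.1.ne' fun p n => ?_
  rw [LinearMap.comp_apply, LinearMap.zero_apply]
  by_cases hp : p = (1, 1)
  · have e : mono (q : ℝ) p (Polynomial.X ^ n) = b q * t (q : ℝ) ^ n * a q := by
      simp [hp, mono_apply, aPow, bPow, pt_X]
    have h1 : (qInt q (n + 1) : ℂ) ≠ 0 := by exact_mod_cast (qInt_succ_pos q.2.1.le n).ne'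
    have h2 : (qInt q (n + 2) : ℂ) ≠ 0 := by exact_mod_cast (qInt_succ_pos q.2.1.le (n + 1)).ne'
    rw [e, partialE_b_mul_t_pow_mul_a, map_smul, map_sub, map_smul, map_smul, haarCand_t_pow,
      haarCand_t_pow]
    simp only [smul_eq_mul]
    rw [mul_inv_cancel₀ h1, mul_inv_cancel₀ h2, sub_self, mul_zero]
  · exact haarFun_eq_zero _ (sub_ne_zero.2 hp) (partialE_mem_homog q (mono_mem_homog p _))

/-- The elements on which the candidate is right invariant. -/
def rightInvariants : Submodule ℂ (Coord (q : ℝ)) :=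
  LinearMap.eqLocus (convRight (haarCand q))
    (LinearMap.toSpanSingleton ℂ (Coord (q : ℝ)) 1 ∘ₗ haarCand q)

theorem mem_rightInvariants {x : Coord (q : ℝ)} :
    x ∈ rightInvariants q ↔ convRight (haarCand q) x = haarCand q x • (1 : Coord (q : ℝ)) := Iff.rfl

theorem one_mem_rightInvariants : (1 : Coord (q : ℝ)) ∈ rightInvariants q := by
  rw [mem_rightInvariants, convRight_apply, map_one, Algebra.TensorProduct.one_def,
    sliceRight_tmul]

/-- Both sides of the invariance equation vanish. For the convolution, associativity turns `(1 ⊗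
h)Δ(∂_e x)` into convolution by `h ∘ ∂_e`, which is zero. -/
theorem partialE_mem_rightInvariants (x : Coord (q : ℝ)) :
    partialE q x ∈ rightInvariants q := by
  have h : haarCand q ∘ₗ convRight (pairE q) = 0 :=
    LinearMap.ext fun y => haarCand_partialE q y
  rw [mem_rightInvariants, haarCand_partialE, zero_smul, partialE_eq, convRight_convRight, h]
  have h0 : ∀ w : Coord (q : ℝ) ⊗[ℂ] Coord (q : ℝ), sliceRight 0 w = 0 := fun w => by
    simp [sliceRight]
  exact h0 _

/-- The diagonal torus passes through `Δ` to the second leg, where the functional absorbs it. An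
element on which this torus acts with nonzero weight therefore convolves to zero, and its integral
is zero as well. -/
theorem mem_rightInvariants_of_homog {p : ℤ × ℤ} (hp : p.1 + p.2 ≠ 0) {x : Coord (q : ℝ)}
    (hx : x ∈ homog (q : ℝ) p) : x ∈ rightInvariants q := by
  have hp0 : p ≠ 0 := by
    rintro rfl
    exact hp rfl
  have h0 : haarCand q x = 0 := haarFun_eq_zero _ hp0 hx
  obtain ⟨z, hz⟩ := exists_units_zpow_ne_one hp
  have h2 : haarCand q ∘ₗ (torus z z).toLinearMap = haarCand q :=
    LinearMap.ext fun y => haarCand_torus q z z y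
  have h1 : (z : ℂ) ^ (p.1 + p.2) • convRight (haarCand q) x = convRight (haarCand q) x := by
    rw [← map_smul, zpow_add₀ z.ne_zero, ← hx z z, convRight_torus, h2]
  have h3 : ((z : ℂ) ^ (p.1 + p.2) - 1) • convRight (haarCand q) x = 0 := by
    rw [sub_smul, one_smul, h1, sub_self]
  rw [mem_rightInvariants, h0, zero_smul, ← one_smul ℂ (convRight _ x),
    ← inv_mul_cancel₀ (sub_ne_zero.2 hz), mul_smul, h3, smul_zero]

theorem t_pow_mem_rightInvariants (n : ℕ) : t (q : ℝ) ^ n ∈ rightInvariants q := by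
  induction n with
  | zero => simpa using one_mem_rightInvariants q
  | succ n ih =>
    have h2 : (qInt q (n + 2) : ℂ) ≠ 0 := by exact_mod_cast (qInt_succ_pos q.2.1.le (n + 1)).ne'
    have h := partialE_mem_rightInvariants q (b q * t (q : ℝ) ^ n * a q)
    rw [partialE_b_mul_t_pow_mul_a,
      Submodule.smul_mem_iff _ (inv_ne_zero (sqrtq_ne_zero q))] at h
    have h3 := (rightInvariants q).add_mem h ((rightInvariants q).smul_mem (qInt q (n + 1) : ℂ) ih)
    rwa [sub_add_cancel, Submodule.smul_mem_iff _ h2] at h3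

theorem star_b_pow_mul_mem_rightInvariants (k n : ℕ) :
    star (b q) ^ (k + 1) * t (q : ℝ) ^ n * a q ^ (k + 1) ∈ rightInvariants q := by
  induction n with
  | zero =>
    obtain ⟨c, hc, h⟩ := exists_partialE_eq_star_b_pow_mul_a_pow q k
    have h1 := partialE_mem_rightInvariants q (star (b q) ^ k * a q ^ (k + 2))
    rwa [h, Submodule.smul_mem_iff _ (Complex.ofReal_ne_zero.2 hc.ne'), ← mul_one (_ ^ _),
      ← pow_zero (t (q : ℝ))] at h1
  | succ n ih =>
    obtain ⟨c, d, hc, h⟩ := exists_partialE_eq_star_b_pow_mul_t_pow_mul_a_pow q k n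
    have h1 := partialE_mem_rightInvariants q
      (star (b q) ^ k * (t (q : ℝ) ^ (n + 1) * a q ^ (k + 2)))
    rw [h] at h1
    have h3 := (rightInvariants q).add_mem h1 ((rightInvariants q).smul_mem (d : ℂ) ih)
    rwa [sub_add_cancel, Submodule.smul_mem_iff _ (Complex.ofReal_ne_zero.2 hc.ne')] at h3

theorem b_pow_mul_mem_rightInvariants (k n : ℕ) :
    b q ^ (k + 1) * t (q : ℝ) ^ n * star (a q) ^ (k + 1) ∈ rightInvariants q := by
  obtain ⟨c, hc, h⟩ := exists_partialE_eq_b_pow_mul_t_pow_mul_star_a_pow q k n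
  have h1 := partialE_mem_rightInvariants q (b q ^ (k + 2) * t (q : ℝ) ^ n * star (a q) ^ k)
  rwa [h, Submodule.smul_mem_iff _ (neg_ne_zero.2 (Complex.ofReal_ne_zero.2 hc.ne'))] at h1

/-- Monomials of nonzero total degree are covered by the weight argument. Those of total degree zero
are powers of `t` or of the form `(b^*)^k t^n a^k` or `b^k t^n (a^*)^k`; the recursions for `∂_e`
place each of them in the span of `1` and the image of `∂_e`. -/
theorem convRight_haarCand (x : Coord (q : ℝ)) :
    convRight (haarCand q) x = haarCand q x • (1 : Coord (q : ℝ)) := by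
  suffices convRight (haarCand q)
      = LinearMap.toSpanSingleton ℂ (Coord (q : ℝ)) 1 ∘ₗ haarCand q from
    LinearMap.congr_fun this x
  refine linearMap_ext q.2.1.ne' fun p n => ?_
  change mono (q : ℝ) p (Polynomial.X ^ n) ∈ rightInvariants q
  by_cases hp : p.1 + p.2 = 0
  · obtain ⟨i, j⟩ := p
    obtain rfl : j = -i := (neg_eq_of_add_eq_zero_right hp).symm
    rw [mono_apply, map_pow, pt_X]
    obtain ⟨k, rfl | rfl⟩ := i.eq_nat_or_neg
    · rw [bPow_neg_natCast, aPow_natCast]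
      cases k with
      | zero => simpa using t_pow_mem_rightInvariants q n
      | succ k => exact star_b_pow_mul_mem_rightInvariants q k n
    · rw [neg_neg, bPow_natCast, aPow_neg_natCast]
      cases k with
      | zero => simpa using t_pow_mem_rightInvariants q n
      | succ k => exact b_pow_mul_mem_rightInvariants q k n
  · exact mem_rightInvariants_of_homog q hp (mono_mem_homog p _)

end Invariance

/-! ### Transposition and left invariance -/

section Transpose

variable (q : Set.Ioc (0 : ℝ) 1)

theorem relations_transpose : Relations (q : ℝ) (a q) (star (a q))
    (-((q : ℝ) : ℂ)⁻¹ • star (b q)) (-((q : ℝ) : ℂ) • b q) := by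
  have h := relations (q := (q : ℝ))
  have hq := coe_ne_zero q
  have e : -((q : ℝ) : ℂ)⁻¹ * -((q : ℝ) : ℂ) = 1 := by field_simp
  have e' : -((q : ℝ) : ℂ) * -((q : ℝ) : ℂ)⁻¹ = 1 := by field_simp
  constructor <;> simp only [smul_mul_assoc, mul_smul_comm, smul_smul, e, e', one_smul, ← h.bbs]
  · rw [h.bsa, smul_smul, mul_comm]
  · rw [h.ba, smul_smul, mul_comm]
  · rw [h.asb, smul_smul, mul_comm]
  · rw [h.asbs, smul_smul, mul_comm]
  · exact h.asa
  · exact h.aas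

/-- The automorphism that transposes the fundamental unitary. -/
def transpose : Coord (q : ℝ) →ₐ[ℂ] Coord (q : ℝ) := lift (relations_transpose q)

theorem transpose_a : transpose q (a q) = a q := lift_gen _ _

theorem transpose_b : transpose q (b q) = -((q : ℝ) : ℂ)⁻¹ • star (b q) := lift_gen _ _

theorem transpose_star_a : transpose q (star (a q)) = star (a q) := by
  conv_lhs => rw [star_a]
  exact lift_gen _ _

theorem transpose_star_b : transpose q (star (b q)) = -((q : ℝ) : ℂ) • b q := by
  conv_lhs => rw [star_b]
  exact lift_gen _ _

theorem transpose_transpose (x : Coord (q : ℝ)) : transpose q (transpose q x) = x := by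
  have hq := coe_ne_zero q
  suffices (transpose q).comp (transpose q) = AlgHom.id ℂ _ from DFunLike.congr_fun this x
  apply algHom_ext' <;>
  simp only [AlgHom.comp_apply, transpose_a, transpose_b, transpose_star_a, transpose_star_b,
    map_smul, smul_smul, AlgHom.id_apply]
  · rw [neg_mul_neg, inv_mul_cancel₀ hq, one_smul]
  · rw [neg_mul_neg, mul_inv_cancel₀ hq, one_smul]

/-- In `Δ(u_{ij}) = ∑_l u_{il} ⊗ u_{lj}`, replacing `u` by its transpose exchanges the two legs.
Statements about one-sided convolutions can thus be carried to the other side. -/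
theorem comul_transpose (x : Coord (q : ℝ)) : comul (transpose q x)
    = Algebra.TensorProduct.comm ℂ _ _
      (Algebra.TensorProduct.map (transpose q) (transpose q) (comul x)) := by
  have hq := coe_ne_zero q
  suffices comul.comp (transpose q) = ((Algebra.TensorProduct.comm ℂ _ _).toAlgHom.comp
      (Algebra.TensorProduct.map (transpose q) (transpose q))).comp comul from
    DFunLike.congr_fun this x
  apply algHom_ext' <;>
  simp only [AlgHom.comp_apply, transpose_a, transpose_b, transpose_star_a, transpose_star_b,
    map_smul, map_add, map_sub, comul_a, comul_b, comul_star_a, comul_star_b,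
    Algebra.TensorProduct.map_tmul, AlgEquiv.coe_toAlgHom, Algebra.TensorProduct.comm_tmul,
    TensorProduct.tmul_smul, ← TensorProduct.smul_tmul'] <;>
  match_scalars <;> field_simp

theorem transpose_t : transpose q (t q) = t q := by
  have hq := coe_ne_zero q
  rw [t, map_mul, transpose_b, transpose_star_b, smul_mul_smul_comm, neg_mul_neg,
    inv_mul_cancel₀ hq, one_smul, star_b_mul_b]
  rfl

theorem transpose_mem_homog {p : ℤ × ℤ} {x : Coord (q : ℝ)} (hx : x ∈ homog (q : ℝ) p) :
    transpose q x ∈ homog (q : ℝ) (p.1, -p.2) := fun z w => by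
  have : (torus z w).comp (transpose q) = (transpose q).comp (torus z w⁻¹) := by
    apply algHom_ext' <;>
    simp only [AlgHom.comp_apply, transpose_a, transpose_b, transpose_star_a, transpose_star_b,
      torus_a, torus_b, torus_star_a, torus_star_b, map_smul, Units.val_inv_eq_inv_val, inv_inv]
    · rw [smul_comm]
    · rw [smul_comm]
  have h := DFunLike.congr_fun this x
  rw [AlgHom.comp_apply, AlgHom.comp_apply, hx, map_smul] at h
  rw [h]
  simp

theorem haarCand_transpose (x : Coord (q : ℝ)) : haarCand q (transpose q x) = haarCand q x := by
  suffices haarCand q ∘ₗ (transpose q).toLinearMap = haarCand q from LinearMap.congr_fun this x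
  refine linearMap_ext q.2.1.ne' fun p n => ?_
  change haarCand q (transpose q _) = _
  by_cases hp : p = 0
  · rw [hp, mono_zero, map_pow, pt_X, map_pow, transpose_t]
  · rw [haarCand, haarFun_mono _ hp]
    refine haarFun_eq_zero _ (fun h => hp ?_) (transpose_mem_homog q (mono_mem_homog p _))
    simpa [Prod.ext_iff] using h

/-- The transposition flips the coproduct and fixes the functional, so left invariance at `x` is
right invariance at the transpose of `x`. -/
theorem convLeft_haarCand (x : Coord (q : ℝ)) :
    convLeft (haarCand q) x = haarCand q x • (1 : Coord (q : ℝ)) := by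
  have key : ∀ w : Coord (q : ℝ) ⊗[ℂ] Coord (q : ℝ),
      sliceRight (haarCand q) (Algebra.TensorProduct.comm ℂ _ _
        (Algebra.TensorProduct.map (transpose q) (transpose q) w))
      = transpose q (sliceLeft (haarCand q) w) := fun w => by
    induction w using TensorProduct.induction_on with
    | zero => simp
    | add v w hv hw => simp only [map_add, hv, hw]
    | tmul v w =>
      rw [Algebra.TensorProduct.map_tmul, Algebra.TensorProduct.comm_tmul, sliceRight_tmul,
        sliceLeft_tmul, haarCand_transpose, map_smul]
  have h := convRight_haarCand q (transpose q x)
  rw [convRight_apply, comul_transpose, key, haarCand_transpose, ← convLeft_apply] at h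
  rw [← transpose_transpose q (convLeft _ x), h, map_smul, map_one]

theorem isHaarState_haarCand : IsHaarState (haarCand q) where
  nonneg x := haarFun_nonneg q.2.1 q.2.2 x
  map_one := by
    have := haarCand_t_pow q 0
    simpa [qInt] using this
  left_invariant := convLeft_haarCand q
  right_invariant := convRight_haarCand q

theorem isHaarState_haar : IsHaarState (haar (q : ℝ)) := by
  have h : ∃ φ : Coord (q : ℝ) →ₗ[ℂ] ℂ, IsHaarState φ := ⟨_, isHaarState_haarCand q⟩
  rw [haar, dif_pos h]
  exact h.choose_spec

/-- Evaluating `(h ⊗ h')Δ(x)` with the right invariance of `h'` gives `h'(x)`, and with the left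
invariance of `h` gives `h(x)`. The chosen functional is therefore the constructed one. -/
theorem haar_eq_haarCand : haar (q : ℝ) = haarCand q := LinearMap.ext fun x => by
  have h1 := apply_convRight (haar (q : ℝ)) (haarCand q) x
  rw [convRight_haarCand, convLeft_apply, (isHaarState_haar q).left_invariant, map_smul, map_smul,
    (isHaarState_haar q).map_one, (isHaarState_haarCand q).map_one, smul_eq_mul, smul_eq_mul,
    mul_one, mul_one] at h1
  exact h1.symm

end Transpose

end QuantumSU2

end

noncomputable section

namespace QuantumSU2

open Coord

variable (q : Set.Ioc (0 : ℝ) 1)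

/-! ### Properties of the Haar state -/

theorem convRight_haar (x : Coord (q : ℝ)) :
    convRight (haar (q : ℝ)) x = haar (q : ℝ) x • (1 : Coord (q : ℝ)) :=
  (isHaarState_haar q).right_invariant x

theorem convLeft_haar (x : Coord (q : ℝ)) :
    convLeft (haar (q : ℝ)) x = haar (q : ℝ) x • (1 : Coord (q : ℝ)) :=
  (isHaarState_haar q).left_invariant x

theorem haar_torus (z w : ℂˣ) (x : Coord (q : ℝ)) :
    haar (q : ℝ) (torus z w x) = haar (q : ℝ) x := by
  rw [haar_eq_haarCand, haarCand_torus]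

theorem haar_a_mul (x : Coord (q : ℝ)) :
    haar (q : ℝ) (a q * x) = ((q : ℝ) : ℂ) ^ 2 * haar (q : ℝ) (x * a q) := by
  rw [haar_eq_haarCand]
  exact haarFun_a_mul q.2.1 x

theorem haar_b_mul (x : Coord (q : ℝ)) : haar (q : ℝ) (b q * x) = haar (q : ℝ) (x * b q) := by
  rw [haar_eq_haarCand]
  exact haarFun_b_mul q.2.1.ne' x

theorem haar_star_a_pow_mul_a_pow (N : ℕ) :
    haar (q : ℝ) (star (a q) ^ N * a q ^ N) = (qInt q (N + 1) : ℂ)⁻¹ := by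
  rw [star_a_pow_mul_a_pow, haar_eq_haarCand, haarCand_pt, jackson_qPoch q.2.1]

theorem haar_convRight (φ : Coord (q : ℝ) →ₗ[ℂ] ℂ) (x : Coord (q : ℝ)) :
    haar (q : ℝ) (convRight φ x) = haar (q : ℝ) x * φ 1 := by
  rw [apply_convRight, convLeft_haar, map_smul, smul_eq_mul]

theorem pairF_one : pairF q 1 = 0 := by
  have h := pairF_mul q 1 1
  simpa using h

theorem haar_partialF (x : Coord (q : ℝ)) : haar (q : ℝ) (partialF q x) = 0 := by
  rw [partialF_eq, haar_convRight, pairF_one, mul_zero]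

/-! ### The spectral subspaces -/

/-- Since `π` is irrational, `e^i` is not a root of unity. A single circle element then separates
all spectral degrees. -/
theorem circle_exp_one_zpow_injective :
    Function.Injective fun n : ℤ => (Circle.exp 1 : ℂ) ^ n := by
  intro m n h
  simp only [← Circle.coe_zpow, ← Circle.exp_zsmul] at h
  obtain ⟨k, hk⟩ := Circle.exp_eq_exp.1 (Circle.coe_injective h)
  by_contra hmn
  simp only [zsmul_eq_mul, mul_one] at hk
  have hk0 : (k : ℝ) ≠ 0 := by
    intro h0
    rw [h0, zero_mul, add_zero] at hk
    exact hmn (by exact_mod_cast hk)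
  refine irrational_pi ⟨((m - n : ℤ) : ℚ) / (2 * k), ?_⟩
  push_cast
  rw [div_eq_iff (by simpa using hk0)]
  linarith

/-- Membership in `𝒜_n` only controls unimodular parameters, whereas `K` needs `q^{1/2}`. The weight
spaces of the complex diagonal torus already span, by the monomials, and lie in eigenspaces of the
action of `e^i`. Independence of these eigenspaces forces each `𝒜_n` into a single weight space. -/
theorem torus_spectralSubspace {n : ℤ} {y : Coord (q : ℝ)}
    (hy : y ∈ spectralSubspace (q : ℝ) n) (z : ℂˣ) : torus z z y = (z : ℂ) ^ n • y := by
  let T : ℤ → Submodule ℂ (Coord (q : ℝ)) := fun d =>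
    { carrier := {x | ∀ z : ℂˣ, torus z z x = (z : ℂ) ^ d • x}
      add_mem' := fun hx hy z => by rw [map_add, hx z, hy z, smul_add]
      zero_mem' := fun z => by rw [map_zero, smul_zero]
      smul_mem' := fun c x hx z => by rw [map_smul, hx z, smul_comm] }
  have hT : ⨆ d, T d = ⊤ := by
    refine eq_top_iff.2 ?_
    rw [← iSup_range_mono q.2.1.ne']
    refine iSup_le fun p => ?_
    rintro _ ⟨f, rfl⟩
    refine Submodule.mem_iSup_of_mem (p.1 + p.2) fun z => ?_
    rw [torus_mono, zpow_add₀ z.ne_zero]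
  let c : Circle := Circle.exp 1
  let f : Module.End ℂ (Coord (q : ℝ)) := (circleAct c).toLinearMap
  have hf : ∀ (d : ℤ) x, x ∈ f.eigenspace ((c : ℂ) ^ d) ↔ circleAct c x = (c : ℂ) ^ d • x :=
    fun d x => Module.End.mem_eigenspace_iff
  have hle : ∀ d, T d ≤ f.eigenspace ((c : ℂ) ^ d) := fun d x hx => (hf d x).2 (by
    rw [circleAct_eq_torus]; exact hx (Circle.toUnits c))
  have hind : iSupIndep fun d : ℤ => f.eigenspace ((c : ℂ) ^ d) :=
    (Module.End.eigenspaces_iSupIndep f).comp circle_exp_one_zpow_injective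
  have hsup : T n ⊔ ⨆ (d) (_ : d ≠ n), T d = ⊤ := by
    refine eq_top_iff.2 ?_
    rw [← hT]
    refine iSup_le fun d => ?_
    by_cases h : d = n
    · exact h ▸ le_sup_left
    · exact le_sup_of_le_right (le_iSup₂_of_le d h le_rfl)
  obtain ⟨u, hu, v, hv, huv⟩ := Submodule.mem_sup.1 (hsup ▸ Submodule.mem_top (x := y))
  have hv0 : v = 0 := by
    refine (Submodule.disjoint_def.1 (hind n)) v ?_ ?_
    · rw [← add_sub_cancel_left u v, huv]
      exact Submodule.sub_mem _ ((hf n y).2 (hy c)) (hle n hu)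
    · exact iSup₂_mono (fun d _ => hle d) hv
  rw [← huv, hv0, add_zero]
  exact hu z

theorem K_spectralSubspace {n : ℤ} {y : Coord (q : ℝ)} (hy : y ∈ spectralSubspace (q : ℝ) n) :
    K q y = sqrtq q ^ n • y := torus_spectralSubspace q hy (sqrtUnit q)

theorem Kinv_spectralSubspace {n : ℤ} {y : Coord (q : ℝ)}
    (hy : y ∈ spectralSubspace (q : ℝ) n) : Kinv q y = sqrtq q ^ (-n) • y := by
  have := torus_spectralSubspace q hy (sqrtUnit q)⁻¹
  rw [Units.val_inv_eq_inv_val, inv_zpow', coe_sqrtUnit] at this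
  exact this

theorem mem_podles_iff {x : Coord (q : ℝ)} :
    x ∈ podles (q : ℝ) ↔ x ∈ spectralSubspace (q : ℝ) 0 := by
  refine forall_congr' fun z => ?_
  rw [zpow_zero, one_smul]

theorem spectralSubspace_mul {m n : ℤ} {x y : Coord (q : ℝ)}
    (hx : x ∈ spectralSubspace (q : ℝ) m) (hy : y ∈ spectralSubspace (q : ℝ) n) :
    x * y ∈ spectralSubspace (q : ℝ) (m + n) := fun z => by
  rw [map_mul, hx z, hy z, smul_mul_smul_comm, zpow_add₀ (Circle.coe_ne_zero z)]

theorem spectralSubspace_star {n : ℤ} {x : Coord (q : ℝ)}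
    (hx : x ∈ spectralSubspace (q : ℝ) n) : star x ∈ spectralSubspace (q : ℝ) (-n) := fun z => by
  rw [circleAct_star, hx z, star_smul, RCLike.star_def, map_zpow₀, ← Circle.coe_inv_eq_conj,
    Circle.coe_inv, inv_zpow']

theorem a_mem_spectralSubspace : a q ∈ spectralSubspace (q : ℝ) 1 := fun z => by
  rw [circleAct_eq_torus, torus_a, zpow_one]; rfl

theorem b_mem_spectralSubspace : b q ∈ spectralSubspace (q : ℝ) 1 := fun z => by
  rw [circleAct_eq_torus, torus_b, zpow_one]; rfl

theorem star_a_mem_spectralSubspace : star (a q) ∈ spectralSubspace (q : ℝ) (-1) :=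
  spectralSubspace_star q (a_mem_spectralSubspace q)

theorem star_b_mem_spectralSubspace : star (b q) ∈ spectralSubspace (q : ℝ) (-1) :=
  spectralSubspace_star q (b_mem_spectralSubspace q)

/-! ### The derivations and the involution -/

theorem star_K (x : Coord (q : ℝ)) : star (K q x) = Kinv q (star x) := by
  rw [Kinv, torus_star]
  congr 1
  have : (star (sqrtUnit q)⁻¹)⁻¹ = sqrtUnit q := by
    ext
    simp [coe_sqrtUnit, sqrtq_eq]
  rw [this, K]

theorem star_Kinv (x : Coord (q : ℝ)) : star (Kinv q x) = K q (star x) := by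
  rw [K, torus_star]
  congr 1
  have : (star (sqrtUnit q))⁻¹ = (sqrtUnit q)⁻¹ := by
    ext
    simp [coe_sqrtUnit, sqrtq_eq]
  rw [this, Kinv]

theorem partialF_star (x : Coord (q : ℝ)) :
    partialF q (star x) = -((q : ℝ) : ℂ) • star (partialE q x) := by
  have hq := coe_ne_zero q
  induction x using Coord.induction with
  | h0 c =>
    rw [star_algebraMap', Algebra.algebraMap_eq_smul_one, Algebra.algebraMap_eq_smul_one, map_smul,
      map_smul, partialE_one, partialF_one]
    simp
  | hg g =>
    cases g
    · change partialF q (star (a q)) = _ • star (partialE q (a q))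
      rw [partialF_star_a, partialE_a, star_star]
    · rw [← star_a, star_star, partialF_a, partialE_star_a, star_zero, smul_zero]
    · change partialF q (star (b q)) = _ • star (partialE q (b q))
      rw [partialF_star_b, partialE_b, star_smul, star_star, smul_smul, RCLike.star_def, map_neg,
        map_inv₀, Complex.conj_ofReal, neg_mul_neg, mul_inv_cancel₀ hq, one_smul]
    · rw [← star_b, star_star, partialF_b, partialE_star_b, star_zero, smul_zero]
  | hm x y hx hy =>
    rw [star_mul, partialF_mul, hx, hy, partialE_mul, star_add, star_mul, star_mul, star_K,
      star_Kinv, smul_mul_assoc, mul_smul_comm, ← smul_add, add_comm]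
  | ha x y hx hy => simp only [star_add, map_add, hx, hy, smul_add]

theorem partialE_mem_spectralSubspace {n : ℤ} {x : Coord (q : ℝ)}
    (hx : x ∈ spectralSubspace (q : ℝ) n) :
    partialE q x ∈ spectralSubspace (q : ℝ) (n - 2) := fun z => by
  have hz := Circle.coe_ne_zero z
  have h := torus_partialE q (Circle.toUnits z) (Circle.toUnits z) x
  rw [← circleAct_eq_torus, hx z, map_smul] at h
  change _ = ((z : ℂ) * z) • _ at h
  rw [zpow_sub₀ hz, ← one_smul ℂ (circleAct z _), ← inv_mul_cancel₀ (mul_ne_zero hz hz), mul_smul,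
    ← h, smul_smul]
  congr 1
  field_simp

theorem partialF_mem_spectralSubspace {n : ℤ} {x : Coord (q : ℝ)}
    (hx : x ∈ spectralSubspace (q : ℝ) n) :
    partialF q x ∈ spectralSubspace (q : ℝ) (n + 2) := by
  have h := partialE_mem_spectralSubspace q (spectralSubspace_star q hx)
  rw [← star_star x, partialF_star]
  refine Submodule.smul_mem _ _ ?_
  have := spectralSubspace_star q h
  rwa [neg_sub, sub_neg_eq_add, add_comm] at this

/-- The operators `∂_e : 𝒜_1 → 𝒜_{-1}` and `∂_f : 𝒜_{-1} → 𝒜_1` are formally adjoint. -/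
theorem haar_star_partialE_mul {x y : Coord (q : ℝ)} (hx : x ∈ spectralSubspace (q : ℝ) 1)
    (hy : y ∈ spectralSubspace (q : ℝ) (-1)) :
    haar (q : ℝ) (star (partialE q x) * y) = haar (q : ℝ) (star x * partialF q y) := by
  have hs := sqrtq_ne_zero q
  -- Integration by parts: `h ∘ ∂_f = 0` applied to a product, expanded by the twisted Leibniz rule.
  have h := haar_partialF q (star x * y)
  rw [partialF_mul, partialF_star, K_spectralSubspace q hy,
    Kinv_spectralSubspace q (spectralSubspace_star q hx), neg_neg, zpow_one, zpow_neg_one,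
    smul_mul_smul_comm, smul_mul_assoc, map_add, map_smul, map_smul, smul_eq_mul, smul_eq_mul,
    coe_eq_sqrtq_sq] at h
  have e : -sqrtq q ^ 2 * (sqrtq q)⁻¹ = -sqrtq q := by field_simp
  rw [e] at h
  refine mul_left_cancel₀ hs ?_
  linear_combination -h

/-- On `𝒜_0` the twist `Kinv` is trivial and on `𝒜_1` the twist `K` is the scalar `q^{1/2}`. The
twisted rule becomes an honest commutator formula, and this scalar is the constant in the entry of
`X(x)`. -/
theorem partialE_podles_mul {x y : Coord (q : ℝ)} (hx : x ∈ podles (q : ℝ))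
    (hy : y ∈ spectralSubspace (q : ℝ) 1) :
    partialE q (x * y) = x * partialE q y + (sqrtq q • partialE q x) * y := by
  rw [partialE_mul, K_spectralSubspace q hy,
    Kinv_spectralSubspace q ((mem_podles_iff q).1 hx), zpow_one, neg_zero, zpow_zero, one_smul,
    mul_smul_comm, smul_mul_assoc, add_comm]

theorem partialF_podles_mul {x y : Coord (q : ℝ)} (hx : x ∈ podles (q : ℝ))
    (hy : y ∈ spectralSubspace (q : ℝ) (-1)) :
    partialF q (x * y) = x * partialF q y + ((sqrtq q)⁻¹ • partialF q x) * y := by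
  rw [partialF_mul, K_spectralSubspace q hy,
    Kinv_spectralSubspace q ((mem_podles_iff q).1 hx), zpow_neg_one, neg_zero, zpow_zero, one_smul,
    mul_smul_comm, smul_mul_assoc, add_comm]

end QuantumSU2

end

noncomputable section

namespace QuantumSU2

open Coord

/-! ### Operators between the spaces `H_n` -/

section Operators

variable {q : ℝ}

theorem inner_toL2 (x y : Coord q) : ⟪toL2 q x, toL2 q y⟫_ℂ = haar q (star x * y) :=
  UniformSpace.Completion.inner_coe (toPreL2 q x) (toPreL2 q y)

theorem norm_toL2_sq (x : Coord q) : ‖toL2 q x‖ ^ 2 = (haar q (star x * x)).re := by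
  rw [← inner_toL2, ← RCLike.re_eq_complex_re, inner_self_eq_norm_sq]

theorem eq_zero_of_inner_eq_zero {n : ℤ} {η : L2 q} (hη : η ∈ H q n)
    (h : ∀ y ∈ spectralSubspace q n, ⟪toL2 q y, η⟫_ℂ = 0) : η = 0 := by
  have hc : IsClosed {ζ : L2 q | ⟪ζ, η⟫_ℂ = 0} :=
    isClosed_eq (continuous_id.inner continuous_const) continuous_const
  have hη' : η ∈ closure (((spectralSubspace q n).map (toL2 q) : Submodule ℂ (L2 q)) : Set (L2 q))
      :=
    hη
  refine inner_self_eq_zero.1 (closure_minimal ?_ hc hη')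
  rintro _ ⟨y, hy, rfl⟩
  exact h y hy

/-- The inclusion of `𝒜_n` into `H_n`. -/
def toH (n : ℤ) : spectralSubspace q n →ₗ[ℂ] H q n :=
  ((toL2 q).domRestrict _).codRestrict _ fun y => toL2_mem_H y.2

theorem denseRange_toH (n : ℤ) : DenseRange (toH (q := q) n) := by
  intro ξ
  rw [Metric.mem_closure_iff]
  intro ε hε
  have hξ : (ξ : L2 q) ∈ closure
      (((spectralSubspace q n).map (toL2 q) : Submodule ℂ (L2 q)) : Set (L2 q)) := ξ.2
  obtain ⟨_, ⟨y, hy, rfl⟩, h⟩ := Metric.mem_closure_iff.1 hξ ε hε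
  exact ⟨toH n ⟨y, hy⟩, ⟨_, rfl⟩, h⟩

end Operators

/-! ### Closability, the closed operators and the bounded commutator -/

section Dirac

variable (q : Set.Ioc (0 : ℝ) 1)

theorem rho_mem_H_of_mem_spectralSubspace {k m n : ℤ} {x : Coord (q : ℝ)}
    (hx : x ∈ spectralSubspace (q : ℝ) k) (h : k + m = n) (ξ : H (q : ℝ) m) :
    rho x (ξ : L2 (q : ℝ)) ∈ H (q : ℝ) n := by
  refine map_mem_closure (rho x).continuous ξ.2 ?_
  rintro _ ⟨y, hy, rfl⟩
  rw [rho_toL2]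
  exact Submodule.mem_map_of_mem (h ▸ spectralSubspace_mul q hx hy)

/-- Left multiplication by an element of `𝒜_k`, as an operator `H_m → H_n` with `n = k + m`. -/
def rhoShift {k m n : ℤ} {x : Coord (q : ℝ)} (hx : x ∈ spectralSubspace (q : ℝ) k)
    (h : k + m = n) : H (q : ℝ) m →L[ℂ] H (q : ℝ) n :=
  ((rho x).comp (H (q : ℝ) m).subtypeL).codRestrict (H (q : ℝ) n)
    (rho_mem_H_of_mem_spectralSubspace q hx h)

theorem smul_partialE_mem {x : Coord (q : ℝ)} (hx : x ∈ podles (q : ℝ)) :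
    sqrtq q • partialE q x ∈ spectralSubspace (q : ℝ) (-2) :=
  Submodule.smul_mem _ _ (partialE_mem_spectralSubspace q ((mem_podles_iff q).1 hx))

theorem smul_partialF_mem {x : Coord (q : ℝ)} (hx : x ∈ podles (q : ℝ)) :
    (sqrtq q)⁻¹ • partialF q x ∈ spectralSubspace (q : ℝ) 2 :=
  Submodule.smul_mem _ _ (partialF_mem_spectralSubspace q ((mem_podles_iff q).1 hx))

/-- The graph of `∂_e` on `𝒜_1`. -/
def graphE : Submodule ℂ (H (q : ℝ) 1 × H (q : ℝ) (-1)) :=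
  ((spectralSubspace (q : ℝ) 1).map
    ((toL2 (q : ℝ)).prod (toL2 (q : ℝ) ∘ₗ partialE q))).comap
      ((H (q : ℝ) 1).subtype.prodMap (H (q : ℝ) (-1)).subtype)

/-- The graph of `∂_f` on `𝒜_{-1}`. -/
def graphF : Submodule ℂ (H (q : ℝ) (-1) × H (q : ℝ) 1) :=
  ((spectralSubspace (q : ℝ) (-1)).map
    ((toL2 (q : ℝ)).prod (toL2 (q : ℝ) ∘ₗ partialF q))).comap
      ((H (q : ℝ) (-1)).subtype.prodMap (H (q : ℝ) 1).subtype)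

theorem mem_graphE {ξ : H (q : ℝ) 1 × H (q : ℝ) (-1)} : ξ ∈ graphE q ↔
    ∃ x ∈ spectralSubspace (q : ℝ) 1, toL2 (q : ℝ) x = ξ.1 ∧ toL2 (q : ℝ) (partialE q x) = ξ.2 := by
  simp [graphE, Submodule.mem_map, Prod.ext_iff]

theorem mem_graphF {ξ : H (q : ℝ) (-1) × H (q : ℝ) 1} : ξ ∈ graphF q ↔
    ∃ x ∈ spectralSubspace (q : ℝ) (-1),
      toL2 (q : ℝ) x = ξ.1 ∧ toL2 (q : ℝ) (partialF q x) = ξ.2 := by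
  simp [graphF, Submodule.mem_map, Prod.ext_iff]

/-- Formal adjointness is a closed condition and so holds on the closure of the graph. A vector
lying over `0` is then orthogonal to the dense subspace `𝒜_{-1}`. This gives closability, and also
shows that the graph itself is single-valued, with no appeal to faithfulness of `h`. -/
theorem snd_eq_zero_of_mem_closure_graphE {ξ : H (q : ℝ) 1 × H (q : ℝ) (-1)}
    (h : ξ ∈ (graphE q).topologicalClosure) (h0 : ξ.1 = 0) : ξ.2 = 0 := by
  have key : ∀ y ∈ spectralSubspace (q : ℝ) (-1), ⟪toL2 (q : ℝ) y, (ξ.2 : L2 (q : ℝ))⟫_ℂ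
      = ⟪toL2 (q : ℝ) (partialF q y), (ξ.1 : L2 (q : ℝ))⟫_ℂ := by
    intro y hy
    have hc : IsClosed {ζ : H (q : ℝ) 1 × H (q : ℝ) (-1) | ⟪toL2 (q : ℝ) y, (ζ.2 : L2 (q : ℝ))⟫_ℂ
        = ⟪toL2 (q : ℝ) (partialF q y), (ζ.1 : L2 (q : ℝ))⟫_ℂ} :=
      isClosed_eq (by fun_prop) (by fun_prop)
    refine closure_minimal ?_ hc (show ξ ∈ closure (graphE q : Set _) from h)
    intro ζ hζ
    obtain ⟨x, hx, h1, h2⟩ := (mem_graphE q).1 hζ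
    rw [Set.mem_ofPred_eq, ← h1, ← h2, ← inner_conj_symm, ← inner_conj_symm (toL2 _ (partialF q y)),
      inner_toL2, inner_toL2, haar_star_partialE_mul q hx hy]
  refine Subtype.ext (eq_zero_of_inner_eq_zero ξ.2.2 fun y hy => ?_)
  rw [key y hy, h0, Submodule.coe_zero, inner_zero_right]

theorem snd_eq_zero_of_mem_closure_graphF {ξ : H (q : ℝ) (-1) × H (q : ℝ) 1}
    (h : ξ ∈ (graphF q).topologicalClosure) (h0 : ξ.1 = 0) : ξ.2 = 0 := by
  have key : ∀ y ∈ spectralSubspace (q : ℝ) 1, ⟪toL2 (q : ℝ) y, (ξ.2 : L2 (q : ℝ))⟫_ℂ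
      = ⟪toL2 (q : ℝ) (partialE q y), (ξ.1 : L2 (q : ℝ))⟫_ℂ := by
    intro y hy
    have hc : IsClosed {ζ : H (q : ℝ) (-1) × H (q : ℝ) 1 | ⟪toL2 (q : ℝ) y, (ζ.2 : L2 (q : ℝ))⟫_ℂ
        = ⟪toL2 (q : ℝ) (partialE q y), (ζ.1 : L2 (q : ℝ))⟫_ℂ} :=
      isClosed_eq (by fun_prop) (by fun_prop)
    refine closure_minimal ?_ hc (show ξ ∈ closure (graphF q : Set _) from h)
    intro ζ hζ
    obtain ⟨x, hx, h1, h2⟩ := (mem_graphF q).1 hζ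
    rw [Set.mem_ofPred_eq, ← h1, ← h2, inner_toL2, inner_toL2, haar_star_partialE_mul q hy hx]
  refine Subtype.ext (eq_zero_of_inner_eq_zero ξ.2.2 fun y hy => ?_)
  rw [key y hy, h0, Submodule.coe_zero, inner_zero_right]

/-- Both `toLinearPMap` and `closure` fall back on default values, for a relation that is not
single-valued and for an operator that is not closable. The hypothesis excludes both, so the
operators can be handled through their graphs. -/
theorem graph_closure_toLinearPMap {E F : Type*} [NormedAddCommGroup E] [NormedSpace ℂ E]
    [NormedAddCommGroup F] [NormedSpace ℂ F] (g : Submodule ℂ (E × F))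
    (hg : ∀ ξ ∈ g.topologicalClosure, ξ.1 = 0 → ξ.2 = 0) :
    g.toLinearPMap.closure.graph = g.topologicalClosure := by
  have h1 : g.toLinearPMap.graph = g :=
    g.toLinearPMap_graph_eq fun x hx => hg x (g.le_topologicalClosure hx)
  have h2 : g.toLinearPMap.IsClosable :=
    ⟨g.topologicalClosure.toLinearPMap, by rw [h1, Submodule.toLinearPMap_graph_eq _ hg]⟩
  rw [← h2.graph_closure_eq_closure_graph, h1]

theorem graph_E : (E q).graph = (graphE q).topologicalClosure :=
  graph_closure_toLinearPMap _ fun _ => snd_eq_zero_of_mem_closure_graphE q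

theorem graph_F : (F q).graph = (graphF q).topologicalClosure :=
  graph_closure_toLinearPMap _ fun _ => snd_eq_zero_of_mem_closure_graphF q

/-- The bounded map `L` on pairs sends the graph over `𝒜_1` into itself, by the Leibniz rule, and
hence its closure into itself. This yields invariance of the domain and the commutator formula
together. -/
theorem E_rhoH (x : podles (q : ℝ)) (ξ : (E q).domain) :
    ((rhoH 1 x ξ, rhoH (-1) x (E q ξ) + rhoShift q (m := 1) (n := -1) (smul_partialE_mem q x.2)
    (by norm_num) ξ) :
      H (q : ℝ) 1 × H (q : ℝ) (-1)) ∈ (E q).graph := by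
  have hξ := (E q).mem_graph ξ
  rw [graph_E] at hξ ⊢
  let L : H (q : ℝ) 1 × H (q : ℝ) (-1) →L[ℂ] H (q : ℝ) 1 × H (q : ℝ) (-1) :=
    ((rhoH 1 x).comp (ContinuousLinearMap.fst ℂ _ _)).prod
      ((rhoH (-1) x).comp (ContinuousLinearMap.snd ℂ _ _) +
        (rhoShift q (m := 1) (n := -1) (smul_partialE_mem q x.2) (by norm_num)).comp
        (ContinuousLinearMap.fst ℂ _ _))
  refine map_mem_closure (f := L) L.continuous hξ fun ζ hζ => ?_
  obtain ⟨y, hy, h1, h2⟩ := (mem_graphE q).1 hζ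
  refine (mem_graphE q).2 ⟨(x : Coord (q : ℝ)) * y, podles_mul_mem x.2 hy, ?_, ?_⟩
  · change _ = rho (x : Coord (q : ℝ)) (ζ.1 : L2 (q : ℝ))
    rw [← h1, rho_toL2]
  · change _ = rho (x : Coord (q : ℝ)) (ζ.2 : L2 (q : ℝ))
      + rho (sqrtq q • partialE q (x : Coord (q : ℝ))) (ζ.1 : L2 (q : ℝ))
    rw [← h1, ← h2, rho_toL2, rho_toL2, ← map_add, partialE_podles_mul q x.2 hy]

theorem F_rhoH (x : podles (q : ℝ)) (ξ : (F q).domain) :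
    ((rhoH (-1) x ξ,
    rhoH 1 x (F q ξ) + rhoShift q (m := -1) (n := 1) (smul_partialF_mem q x.2) (by norm_num) ξ) :
      H (q : ℝ) (-1) × H (q : ℝ) 1) ∈ (F q).graph := by
  have hξ := (F q).mem_graph ξ
  rw [graph_F] at hξ ⊢
  let L : H (q : ℝ) (-1) × H (q : ℝ) 1 →L[ℂ] H (q : ℝ) (-1) × H (q : ℝ) 1 :=
    ((rhoH (-1) x).comp (ContinuousLinearMap.fst ℂ _ _)).prod
      ((rhoH 1 x).comp (ContinuousLinearMap.snd ℂ _ _) +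
        (rhoShift q (m := -1) (n := 1) (smul_partialF_mem q x.2) (by norm_num)).comp
        (ContinuousLinearMap.fst ℂ _ _))
  refine map_mem_closure (f := L) L.continuous hξ fun ζ hζ => ?_
  obtain ⟨y, hy, h1, h2⟩ := (mem_graphF q).1 hζ
  refine (mem_graphF q).2 ⟨(x : Coord (q : ℝ)) * y, podles_mul_mem x.2 hy, ?_, ?_⟩
  · change _ = rho (x : Coord (q : ℝ)) (ζ.1 : L2 (q : ℝ))
    rw [← h1, rho_toL2]
  · change _ = rho (x : Coord (q : ℝ)) (ζ.2 : L2 (q : ℝ))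
      + rho ((sqrtq q)⁻¹ • partialF q (x : Coord (q : ℝ))) (ζ.1 : L2 (q : ℝ))
    rw [← h1, ← h2, rho_toL2, rho_toL2, ← map_add, partialF_podles_mul q x.2 hy]

/-- The bounded operator with off-diagonal entries given by `q^{-1/2} ∂_f(x)` and
`q^{1/2} ∂_e(x)`. -/
def commutator (x : podles (q : ℝ)) : Spinors (q : ℝ) →L[ℂ] Spinors (q : ℝ) :=
  (WithLp.prodContinuousLinearEquiv 2 ℂ _ _).symm.toContinuousLinearMap ∘L
    (((rhoShift q (m := -1) (n := 1) (smul_partialF_mem q x.2) (by norm_num)).comp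
        (ContinuousLinearMap.snd ℂ (H (q : ℝ) 1) (H (q : ℝ) (-1)))).prod
      ((rhoShift q (m := 1) (n := -1) (smul_partialE_mem q x.2) (by norm_num)).comp
        (ContinuousLinearMap.fst ℂ (H (q : ℝ) 1) (H (q : ℝ) (-1))))) ∘L
    (WithLp.prodContinuousLinearEquiv 2 ℂ _ _).toContinuousLinearMap

theorem isDiracCommutator_commutator (x : podles (q : ℝ)) :
    IsDiracCommutator q x (commutator q x) := by
  intro ξ
  have hE := E_rhoH q x ⟨(ξ : Spinors (q : ℝ)).fst, ξ.2.1⟩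
  have hF := F_rhoH q x ⟨(ξ : Spinors (q : ℝ)).snd, ξ.2.2⟩
  have hE' := LinearPMap.mem_domain_of_mem_graph hE
  have hF' := LinearPMap.mem_domain_of_mem_graph hF
  have e := LinearPMap.mem_graph_snd_inj _ ((E q).mem_graph ⟨_, hE'⟩) hE rfl
  have f := LinearPMap.mem_graph_snd_inj _ ((F q).mem_graph ⟨_, hF'⟩) hF rfl
  refine ⟨⟨hE', hF'⟩, congrArg (WithLp.toLp 2) (Prod.ext ?_ ?_)⟩
  · exact (sub_eq_of_eq_add' f).symm
  · exact (sub_eq_of_eq_add' e).symm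

theorem isDiracCommutator_derivation (x : podles (q : ℝ)) :
    IsDiracCommutator q x (derivation q x) := by
  have h : ∃ T, IsDiracCommutator q x T := ⟨_, isDiracCommutator_commutator q x⟩
  rw [derivation, dif_pos h]
  exact h.choose_spec

/-- The spinor with components `y₁` and `y₂`. -/
def spinor (y₁ : spectralSubspace (q : ℝ) 1) (y₂ : spectralSubspace (q : ℝ) (-1)) :
    Spinors (q : ℝ) := WithLp.toLp 2 (toH 1 y₁, toH (-1) y₂)

theorem denseRange_spinor :
    DenseRange fun y : spectralSubspace (q : ℝ) 1 × spectralSubspace (q : ℝ) (-1) =>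
      spinor q y.1 y.2 := by
  have h := (denseRange_toH (q := (q : ℝ)) 1).prodMap (denseRange_toH (q := (q : ℝ)) (-1))
  exact (WithLp.prodContinuousLinearEquiv 2 ℂ (H (q : ℝ) 1) (H (q : ℝ)
      (-1))).symm.surjective.denseRange.comp
    h (WithLp.prodContinuousLinearEquiv 2 ℂ (H (q : ℝ) 1) (H (q : ℝ) (-1))).symm.continuous

theorem spinor_mem_diracDomain (y₁ : spectralSubspace (q : ℝ) 1)
    (y₂ : spectralSubspace (q : ℝ) (-1)) : spinor q y₁ y₂ ∈ diracDomain q := by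
  constructor
  · refine LinearPMap.mem_domain_of_mem_graph (y := ⟨toL2 (q : ℝ) (partialE q y₁),
      toL2_mem_H (partialE_mem_spectralSubspace q y₁.2)⟩) ?_
    rw [graph_E]
    exact Submodule.le_topologicalClosure _ ((mem_graphE q).2 ⟨y₁, y₁.2, rfl, rfl⟩)
  · refine LinearPMap.mem_domain_of_mem_graph (y := ⟨toL2 (q : ℝ) (partialF q y₂),
      toL2_mem_H (partialF_mem_spectralSubspace q y₂.2)⟩) ?_
    rw [graph_F]
    exact Submodule.le_topologicalClosure _ ((mem_graphF q).2 ⟨y₂, y₂.2, rfl, rfl⟩)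

/-- The operator `derivation` is a chosen one, but any two bounded operators that implement the
commutator agree on the algebraic spinors, which are dense and lie in the domain. -/
theorem derivation_eq_commutator (x : podles (q : ℝ)) : derivation q x = commutator q x := by
  refine ContinuousLinearMap.coeFn_injective ?_
  refine (denseRange_spinor q).equalizer (derivation q x).continuous (commutator q x).continuous ?_
  funext y
  have h := spinor_mem_diracDomain q y.1 y.2
  obtain ⟨_, h1⟩ := isDiracCommutator_derivation q x ⟨_, h⟩
  obtain ⟨_, h2⟩ := isDiracCommutator_commutator q x ⟨_, h⟩
  exact h1.trans h2.symm

theorem norm_spinor_sq (y₁ : spectralSubspace (q : ℝ) 1) (y₂ : spectralSubspace (q : ℝ) (-1)) :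
    ‖spinor q y₁ y₂‖ ^ 2 = ‖toL2 (q : ℝ) y₁‖ ^ 2 + ‖toL2 (q : ℝ) y₂‖ ^ 2 :=
  WithLp.prod_norm_sq_eq_of_L2 _

theorem norm_commutator_spinor_sq (x : podles (q : ℝ)) (y₁ : spectralSubspace (q : ℝ) 1)
    (y₂ : spectralSubspace (q : ℝ) (-1)) : ‖commutator q x (spinor q y₁ y₂)‖ ^ 2
      = ‖toL2 (q : ℝ) ((sqrtq q)⁻¹ • partialF q x * y₂)‖ ^ 2
        + ‖toL2 (q : ℝ) (sqrtq q • partialE q x * y₁)‖ ^ 2 := by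
  rw [← rho_toL2, ← rho_toL2]
  exact WithLp.prod_norm_sq_eq_of_L2 _

theorem norm_commutator_le {x : podles (q : ℝ)} {C : ℝ} (hC : 0 ≤ C)
    (h : ∀ y₁ ∈ spectralSubspace (q : ℝ) 1, ∀ y₂ ∈ spectralSubspace (q : ℝ) (-1),
      ‖toL2 (q : ℝ) ((sqrtq q)⁻¹ • partialF q x * y₂)‖ ^ 2
        + ‖toL2 (q : ℝ) (sqrtq q • partialE q x * y₁)‖ ^ 2
      ≤ C ^ 2 * (‖toL2 (q : ℝ) y₁‖ ^ 2 + ‖toL2 (q : ℝ) y₂‖ ^ 2)) : ‖commutator q x‖ ≤ C := by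
  refine ContinuousLinearMap.opNorm_le_bound _ hC fun ξ => ?_
  refine (denseRange_spinor q).induction_on ξ
    (isClosed_le (commutator q x).continuous.norm (continuous_norm.const_mul C)) fun y => ?_
  refine abs_le_of_sq_le_sq' ?_ (by positivity) |>.2
  rw [norm_commutator_spinor_sq, mul_pow, norm_spinor_sq]
  exact h _ y.1.2 _ y.2.2

end Dirac

end QuantumSU2

end

noncomputable section

namespace QuantumSU2

open Coord

variable (q : Set.Ioc (0 : ℝ) 1)

/-! ### Left convolution and the transpose -/

theorem convLeft_eq_transpose (φ : Coord (q : ℝ) →ₗ[ℂ] ℂ) (x : Coord (q : ℝ)) :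
    convLeft φ x
      = transpose q (convRight (φ ∘ₗ (transpose q).toLinearMap) (transpose q x)) := by
  have key : ∀ w : Coord (q : ℝ) ⊗[ℂ] Coord (q : ℝ),
      transpose q (sliceRight (φ ∘ₗ (transpose q).toLinearMap) (Algebra.TensorProduct.comm ℂ _ _
        (Algebra.TensorProduct.map (transpose q) (transpose q) w))) = sliceLeft φ w := fun w => by
    induction w using TensorProduct.induction_on with
    | zero => simp
    | add v w hv hw => simp only [map_add, hv, hw]
    | tmul v w =>
      rw [Algebra.TensorProduct.map_tmul, Algebra.TensorProduct.comm_tmul, sliceRight_tmul,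
        sliceLeft_tmul, map_smul, transpose_transpose]
      change φ (transpose q (transpose q v)) • w = _
      rw [transpose_transpose]
  rw [convRight_apply, comul_transpose, key, convLeft_apply]

theorem character_transpose (z : ℂˣ) (x : Coord (q : ℝ)) :
    character z (transpose q x) = character z x := by
  suffices (character z).comp (transpose q) = character z from DFunLike.congr_fun this x
  apply algHom_ext' <;>
  simp only [AlgHom.comp_apply, transpose_a, transpose_b, transpose_star_a, transpose_star_b,
    map_smul, character_b, character_star_b, smul_zero]

theorem pairE_one : pairE q 1 = 0 := by
  have h := pairE_mul q 1 1
  simpa using h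

/-- Transposition exchanges the roles of `e` and `f`, so left convolutions by them can be computed
from the formulas for `∂_e` and `∂_f`. -/
theorem pairF_transpose (x : Coord (q : ℝ)) : pairF q (transpose q x) = pairE q x := by
  induction x using Coord.induction with
  | h0 c =>
    rw [AlgHom.commutes, Algebra.algebraMap_eq_smul_one, map_smul, map_smul, pairE_one, pairF_one]
  | hg g =>
    cases g
    · change pairF q (transpose q (a q)) = pairE q (a q)
      rw [transpose_a, pairF_a, pairE_a]
    · rw [← star_a, transpose_star_a, pairF_star_a, pairE_star_a]
    · change pairF q (transpose q (b q)) = pairE q (b q)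
      rw [transpose_b, map_smul, pairF_star_b, pairE_b, smul_eq_mul, mul_one]
    · rw [← star_b, transpose_star_b, map_smul, pairF_b, pairE_star_b, smul_zero]
  | hm x y hx hy =>
    rw [map_mul, pairF_mul, pairE_mul, hx, hy, AlgHom.toLinearMap_apply, AlgHom.toLinearMap_apply,
      AlgHom.toLinearMap_apply, AlgHom.toLinearMap_apply, character_transpose, character_transpose]
  | ha x y hx hy => simp only [map_add, hx, hy]

theorem convLeft_pairF (x : Coord (q : ℝ)) :
    convLeft (pairF q) x = transpose q (partialE q (transpose q x)) := by
  have : pairF q ∘ₗ (transpose q).toLinearMap = pairE q := LinearMap.ext (pairF_transpose q)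
  rw [convLeft_eq_transpose, this, partialE_eq]

theorem convLeft_pairE (x : Coord (q : ℝ)) :
    convLeft (pairE q) x = transpose q (partialF q (transpose q x)) := by
  have : pairE q ∘ₗ (transpose q).toLinearMap = pairF q := LinearMap.ext fun x => by
    rw [← transpose_transpose q x, LinearMap.comp_apply, AlgHom.toLinearMap_apply,
      transpose_transpose, ← pairF_transpose]
  rw [convLeft_eq_transpose, this, partialF_eq]

/-! ### The derivation on the sphere in the frame of the fundamental unitary -/

theorem partialF_mem_homog {p : ℤ × ℤ} {x : Coord (q : ℝ)} (hx : x ∈ homog (q : ℝ) p) :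
    partialF q x ∈ homog (q : ℝ) (p + (1, 1)) := by
  rw [← star_star x, partialF_star]
  refine Submodule.smul_mem _ _ ?_
  have := homog_star (partialE_mem_homog q (homog_star hx))
  rwa [neg_sub, sub_neg_eq_add, add_comm] at this

theorem partialE_star (x : Coord (q : ℝ)) :
    partialE q (star x) = -((q : ℝ) : ℂ)⁻¹ • star (partialF q x) := by
  have hq := coe_ne_zero q
  have h := partialF_star q (star x)
  rw [star_star] at h
  rw [h, star_smul, star_star, smul_smul, RCLike.star_def, map_neg, Complex.conj_ofReal,
    neg_mul_neg, inv_mul_cancel₀ hq, one_smul]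

/-- The entries of the fundamental unitary `u`. -/
def fund : Fin 2 → Fin 2 → Coord (q : ℝ) :=
  ![![star (a q), -((q : ℝ) : ℂ) • b q], ![star (b q), a q]]

/-- The entries of the adjoint `u^*` of the fundamental unitary. -/
def fundStar : Fin 2 → Fin 2 → Coord (q : ℝ) :=
  ![![a q, b q], ![-((q : ℝ) : ℂ) • star (b q), star (a q)]]

/-- The matrix of functionals `!![0, q^{-1/2} f; q^{1/2} e, 0]`. -/
def pairDirac : Fin 2 → Fin 2 → Coord (q : ℝ) →ₗ[ℂ] ℂ :=
  ![![0, (sqrtq q)⁻¹ • pairF q], ![sqrtq q • pairE q, 0]]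

/-- The matrix `X(x) = !![0, q^{-1/2} ∂_f(x); q^{1/2} ∂_e(x), 0]` of the commutator with `D_q`. -/
def commEntry : Fin 2 → Fin 2 → Coord (q : ℝ) →ₗ[ℂ] Coord (q : ℝ) :=
  ![![0, (sqrtq q)⁻¹ • partialF q], ![sqrtq q • partialE q, 0]]

/-- The entries of the matrix `u X(x) u^*`. -/
def frameEntry (i j : Fin 2) : Coord (q : ℝ) →ₗ[ℂ] Coord (q : ℝ) :=
  ∑ k, ∑ l, LinearMap.mulRight ℂ (fundStar q l j) ∘ₗ LinearMap.mulLeft ℂ (fund q i k) ∘ₗ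
    commEntry q k l

theorem frameEntry_apply (i j : Fin 2) (x : Coord (q : ℝ)) : frameEntry q i j x
    = ∑ k, ∑ l, fund q i k * commEntry q k l x * fundStar q l j := by
  simp [frameEntry]

theorem frameEntry_zero_zero (x : Coord (q : ℝ)) : frameEntry q 0 0 x
    = -((sqrtq q)⁻¹ * ((q : ℝ) : ℂ)) • (star (a q) * partialF q x * star (b q))
      - (((q : ℝ) : ℂ) * sqrtq q) • (b q * partialE q x * a q) := by
  simp [frameEntry_apply, fund, fundStar, commEntry, smul_smul, sub_eq_add_neg, mul_comm,
    -Complex.coe_smul]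

theorem frameEntry_one_one (x : Coord (q : ℝ)) : frameEntry q 1 1 x
    = (sqrtq q)⁻¹ • (star (b q) * partialF q x * star (a q))
      + sqrtq q • (a q * partialE q x * b q) := by
  simp [frameEntry_apply, fund, fundStar, commEntry]

theorem frameEntry_zero_one (x : Coord (q : ℝ)) : frameEntry q 0 1 x
    = (sqrtq q)⁻¹ • (star (a q) * partialF q x * star (a q))
      - (((q : ℝ) : ℂ) * sqrtq q) • (b q * partialE q x * b q) := by
  simp [frameEntry_apply, fund, fundStar, commEntry, smul_smul, sub_eq_add_neg, mul_comm,
    -Complex.coe_smul]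

theorem frameEntry_one_zero (x : Coord (q : ℝ)) : frameEntry q 1 0 x
    = -((sqrtq q)⁻¹ * ((q : ℝ) : ℂ)) • (star (b q) * partialF q x * star (b q))
      + sqrtq q • (a q * partialE q x * a q) := by
  simp [frameEntry_apply, fund, fundStar, commEntry, smul_smul, mul_comm, -Complex.coe_smul]

theorem partialF_t_pow_succ (n : ℕ) : partialF q (t (q : ℝ) ^ (n + 1))
    = ((sqrtq q)⁻¹ * (qInt q (n + 1) : ℂ)) • (b q * a q * t (q : ℝ) ^ n) := by
  have hq := coe_ne_zero q
  have h := partialF_star q (t (q : ℝ) ^ (n + 1))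
  rw [star_pow, star_t, partialE_t_pow_succ, star_smul, star_mul, star_mul, star_star, star_star,
    star_pow, star_t, smul_smul] at h
  rw [h]
  congr 1
  simp [sqrtq_eq]
  field_simp

/-- Both summands are multiples of `(1 - q^2 t) t^n` for `n ≥ 1`, with opposite coefficients. The
vanishing matches the zero diagonal of `pairDirac`. -/
theorem frameEntry_zero_zero_t_pow (n : ℕ) : frameEntry q 0 0 (t (q : ℝ) ^ n) = 0 := by
  have hq := coe_ne_zero q
  have hs := sqrtq_ne_zero q
  cases n with
  | zero => simp [frameEntry_zero_zero, partialE_one, partialF_one]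
  | succ n =>
    have h1 : star (a q) * (b q * a q * t (q : ℝ) ^ n) * star (b q)
        = ((q : ℝ) : ℂ) • ((1 - ((q : ℝ) : ℂ) ^ 2 • t (q : ℝ)) * t (q : ℝ) ^ (n + 1)) := by
      rw [b_mul_a, smul_mul_assoc, mul_smul_comm, smul_mul_assoc, ← mul_assoc, ← mul_assoc,
        star_a_mul_a, mul_assoc, mul_assoc, ← mul_assoc (b _), (commute_b_t.pow_right n).eq,
        mul_assoc (_ ^ n), b_mul_star_b, ← pow_succ]
    have h2 : b q * (t (q : ℝ) ^ n * (star (a q) * star (b q))) * a q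
        = ((q : ℝ) : ℂ) • ((1 - ((q : ℝ) : ℂ) ^ 2 • t (q : ℝ)) * t (q : ℝ) ^ (n + 1)) := by
      have := star_a_mul_star_b_mul_a_pow q 0
      rw [zero_add, pow_one, pow_zero, mul_one] at this
      rw [mul_assoc, mul_assoc, this, mul_smul_comm, mul_smul_comm, sub_mul, one_mul,
        smul_mul_assoc, ← commute_star_b_t.eq, mul_sub, mul_sub, mul_smul_comm, mul_smul_comm,
        ← mul_assoc, ← mul_assoc, (commute_b_t.pow_right n).eq, mul_assoc _ (b _),
        mul_assoc _ (b _),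
        ← mul_assoc (b _), b_mul_star_b, sub_mul, one_mul, smul_mul_assoc, ← pow_succ, ← pow_succ',
        ← mul_assoc, ← pow_succ, ← pow_succ]
    rw [frameEntry_zero_zero, partialE_t_pow_succ, partialF_t_pow_succ]
    simp only [mul_smul_comm, smul_mul_assoc, h1, h2, smul_smul]
    rw [← sub_smul]
    convert zero_smul ℂ _
    field_simp
    rw [coe_eq_sqrtq_sq]
    ring

theorem frameEntry_one_one_t_pow (n : ℕ) : frameEntry q 1 1 (t (q : ℝ) ^ n) = 0 := by
  have hq := coe_ne_zero q
  have hs := sqrtq_ne_zero q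
  cases n with
  | zero => simp [frameEntry_one_one, partialE_one, partialF_one]
  | succ n =>
    have h1 : star (b q) * (b q * a q * t (q : ℝ) ^ n) * star (a q)
        = t (q : ℝ) * (a q * t (q : ℝ) ^ n * star (a q)) := by
      rw [← star_b_mul_b]
      simp only [mul_assoc]
    have h2 : a q * (t (q : ℝ) ^ n * (star (a q) * star (b q))) * b q
        = t (q : ℝ) * (a q * t (q : ℝ) ^ n * star (a q)) := by
      simp only [mul_assoc]
      rw [star_b_mul_b, star_a_mul_t, ← mul_assoc (t _) (a _), t_mul_a, mul_smul_comm,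
          mul_smul_comm,
        smul_mul_assoc, mul_assoc (a _), ← mul_assoc (_ ^ n), ← pow_succ, ← mul_assoc (t _),
        ← pow_succ']
    rw [frameEntry_one_one, partialE_t_pow_succ, partialF_t_pow_succ]
    simp only [mul_smul_comm, smul_mul_assoc, h1, h2, smul_smul]
    rw [← add_smul]
    convert zero_smul ℂ _
    field_simp
    rw [coe_eq_sqrtq_sq]
    ring

/-- At `n = 0` the truncated exponent `n - 1` is harmless, since its coefficient `qInt q 0` is zero.
-/
theorem partialE_star_b_mul_t_pow_mul_a (n : ℕ) : partialE q (star (b q) * t (q : ℝ) ^ n * a q)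
    = sqrtq q • (star (b q) * ((qInt q (n + 1) : ℂ) • t (q : ℝ) ^ n * star (b q)
      - (qInt q n : ℂ) • t (q : ℝ) ^ (n - 1) * star (b q))) := by
  have hq := coe_ne_zero q
  have hs := sqrtq_ne_zero q
  rw [mul_assoc, partialE_mul, partialE_star_b, zero_mul, zero_add, Kinv_star_b, partialE_mul,
    partialE_a, K_a, map_pow (Kinv q), Kinv_t, smul_mul_assoc]
  congr 2
  cases n with
  | zero => simp [partialE_one, qInt]
  | succ n =>
    have := star_a_mul_star_b_mul_a_pow q 0
    rw [zero_add, pow_one, pow_zero, mul_one] at this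
    rw [partialE_t_pow_succ, smul_mul_smul_comm, mul_assoc (_ ^ n), this, mul_smul_comm, sub_mul,
      one_mul, mul_sub, smul_mul_assoc, mul_smul_comm, ← mul_assoc, ← pow_succ,
      add_tsub_cancel_right]
    have e : (qInt q (n + 1 + 1) : ℂ) = 1 + ((q : ℝ) : ℂ) ^ 2 * qInt q (n + 1) := by
      rw [add_comm (n + 1), qInt_add]
      simp [qInt]
    rw [e]
    simp only [smul_mul_assoc]
    match_scalars <;> field_simp
    ring

theorem partialF_star_b_mul_t_pow_mul_a (n : ℕ) : partialF q (star (b q) * t (q : ℝ) ^ n * a q)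
    = (sqrtq q * (qInt q (n + 1) : ℂ)) • (a q * t (q : ℝ) ^ n * a q) := by
  have hs := sqrtq_ne_zero q
  have h : partialF q (star (b q) * t (q : ℝ) ^ n)
      = (qInt q (n + 1) : ℂ) • (a q * t (q : ℝ) ^ n) := by
    rw [partialF_mul, partialF_star_b, map_pow, K_t, Kinv_star_b]
    cases n with
    | zero => simp [partialF_one, qInt]
    | succ n =>
      have e : (qInt q (n + 1 + 1) : ℂ) = 1 + ((q : ℝ) : ℂ) ^ 2 * qInt q (n + 1) := by
        rw [add_comm (n + 1), qInt_add]
        simp [qInt]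
      rw [partialF_t_pow_succ, smul_mul_smul_comm, mul_assoc (b _), ← mul_assoc _ (b _),
        star_b_mul_b, ← mul_assoc (t _), t_mul_a,
        smul_mul_assoc, mul_assoc (a _), ← pow_succ', e]
      match_scalars
      field_simp
  rw [partialF_mul, partialF_a, mul_zero, add_zero, h, K_a, smul_mul_smul_comm, mul_comm (sqrtq q)]

/-- Up to the scalar `-q^{1/2}` this is the polynomial that `∂_e` produces from `b t^n a`. Since
transposition carries `b^* t^n a` to a multiple of `b t^n a`, it is also the left convolution by
`q^{-1/2} f`. -/
theorem frameEntry_zero_one_star_b_mul_t_pow_mul_a (n : ℕ) :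
    frameEntry q 0 1 (star (b q) * t (q : ℝ) ^ n * a q)
      = (qInt q (n + 1) : ℂ) • t (q : ℝ) ^ n - (qInt q (n + 2) : ℂ) • t (q : ℝ) ^ (n + 1) := by
  have hq := coe_ne_zero q
  have hs := sqrtq_ne_zero q
  have h1 : star (a q) * (a q * t (q : ℝ) ^ n * a q) * star (a q)
      = t (q : ℝ) ^ n - (1 + ((q : ℝ) : ℂ) ^ 2) • t (q : ℝ) ^ (n + 1)
        + ((q : ℝ) : ℂ) ^ 2 • t (q : ℝ) ^ (n + 2) := by
    rw [← mul_assoc, ← mul_assoc, star_a_mul_a, mul_assoc, a_mul_star_a]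
    simp only [sub_mul, mul_sub, one_mul, mul_one, smul_mul_assoc, ← pow_succ, ← pow_succ']
    module
  have h2 : ∀ m, b q * (star (b q) * (t (q : ℝ) ^ m * star (b q))) * b q = t (q : ℝ) ^ (m + 2) := by
    intro m
    rw [← mul_assoc, b_mul_star_b, mul_assoc, mul_assoc, star_b_mul_b, ← pow_succ, ← pow_succ']
  rw [frameEntry_zero_one, partialE_star_b_mul_t_pow_mul_a, partialF_star_b_mul_t_pow_mul_a]
  simp only [mul_smul_comm, smul_mul_assoc, h1, mul_sub, sub_mul, h2]
  have e2 : (qInt q (n + 2) : ℂ) = 1 + ((q : ℝ) : ℂ) ^ 2 * qInt q (n + 1) := by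
    rw [show n + 2 = 1 + (n + 1) by ring, qInt_add]
    simp [qInt]
  have e1 : (qInt q (n + 1) : ℂ) = 1 + ((q : ℝ) : ℂ) ^ 2 * qInt q n := by
    rw [show n + 1 = 1 + n by ring, qInt_add]
    simp [qInt]
  cases n with
  | zero =>
    rw [e2, e1]
    simp only [qInt_zero, Complex.ofReal_zero, zero_smul, mul_zero, add_zero, zero_add, sub_zero]
    match_scalars <;> field_simp
    rw [coe_eq_sqrtq_sq]
    ring
  | succ n =>
    rw [e2, e1]
    rw [show n + 1 - 1 + 2 = n + 1 + 1 by omega]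
    match_scalars <;> field_simp <;> rw [coe_eq_sqrtq_sq] <;> ring

theorem frameEntry_one_zero_star (x : Coord (q : ℝ)) :
    frameEntry q 1 0 (star x) = -star (frameEntry q 0 1 x) := by
  have hq := coe_ne_zero q
  have hs := sqrtq_ne_zero q
  rw [frameEntry_one_zero, frameEntry_zero_one, partialE_star, partialF_star]
  simp only [star_sub, star_smul, star_mul, star_star, mul_smul_comm, smul_mul_assoc, smul_smul,
    RCLike.star_def, map_inv₀, Complex.conj_ofReal, sqrtq_eq, mul_assoc]
  rw [← sqrtq_eq]
  match_scalars <;> field_simp <;> rw [coe_eq_sqrtq_sq]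

theorem inv_smul_convLeft_pairF (n : ℕ) :
    (sqrtq q)⁻¹ • convLeft (pairF q) (star (b q) * t (q : ℝ) ^ n * a q)
      = frameEntry q 0 1 (star (b q) * t (q : ℝ) ^ n * a q) := by
  have hs := sqrtq_ne_zero q
  rw [frameEntry_zero_one_star_b_mul_t_pow_mul_a, convLeft_pairF, map_mul (transpose q),
    map_mul (transpose q), map_pow (transpose q),
    transpose_star_b, transpose_t, transpose_a, smul_mul_assoc, smul_mul_assoc, map_smul,
    partialE_b_mul_t_pow_mul_a, map_smul, map_smul, map_sub, map_smul, map_smul, map_pow, map_pow,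
    transpose_t, smul_smul, smul_smul, coe_eq_sqrtq_sq]
  match_scalars <;> field_simp

theorem smul_convLeft_pairE (n : ℕ) :
    sqrtq q • convLeft (pairE q) (star (star (b q) * t (q : ℝ) ^ n * a q))
      = frameEntry q 1 0 (star (star (b q) * t (q : ℝ) ^ n * a q)) := by
  have hs := sqrtq_ne_zero q
  have hq := coe_ne_zero q
  have h : transpose q (star (star (b q) * t (q : ℝ) ^ n * a q))
      = -((q : ℝ) : ℂ)⁻¹ • star (b q * t (q : ℝ) ^ n * a q) := by
    simp only [star_mul, star_star, star_pow, star_t, map_mul, map_pow, transpose_star_a,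
        transpose_t,
      transpose_b, mul_smul_comm]
  rw [frameEntry_one_zero_star, frameEntry_zero_one_star_b_mul_t_pow_mul_a, convLeft_pairE, h,
    map_smul, partialF_star, partialE_b_mul_t_pow_mul_a]
  simp only [star_sub, star_smul, star_pow, star_t, RCLike.star_def, map_inv₀, Complex.conj_ofReal,
    sqrtq_eq, map_smul, map_sub, map_pow, transpose_t]
  rw [← sqrtq_eq]
  match_scalars <;> field_simp

/-- The monomials relevant to the entry `(1, 0)` are multiples of adjoints of those for `(0, 1)`, so
the involution settles that entry. -/
theorem mul_t_pow_mul_star_a (n : ℕ) : b q * t (q : ℝ) ^ n * star (a q)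
    = (((q : ℝ) : ℂ) ^ (2 * n + 1))⁻¹ • star (star (b q) * t (q : ℝ) ^ n * a q) := by
  have hq := coe_ne_zero q
  rw [star_mul, star_mul, star_star, star_pow, star_t, ← mul_assoc, star_a_mul_t_pow,
    smul_mul_assoc, mul_assoc (_ ^ n), star_a_mul_b, mul_smul_comm, ← mul_assoc,
    (commute_b_t.pow_right n).eq, smul_smul, smul_smul, mul_assoc _ (_ ^ (2 * n)),
    ← pow_succ (_ : ℂ),
    inv_mul_cancel₀ (pow_ne_zero _ hq), one_smul]

/-! ### The Berezin functional -/

theorem hN_apply (N : ℕ) (x : Coord (q : ℝ)) : hN q N x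
    = (qInt q (N + 1) : ℂ) * haar (q : ℝ) (star (a q) ^ N * (x * a q ^ N)) := by
  simp [hN, qInt]

theorem hN_torus (N : ℕ) (z w : ℂˣ) (x : Coord (q : ℝ)) : hN q N (torus z w x) = hN q N x := by
  have hz := z.ne_zero
  have h := haar_torus q z w (star (a q) ^ N * (x * a q ^ N))
  rw [map_mul (torus z w), map_mul (torus z w), map_pow (torus z w), map_pow (torus z w),
      torus_star_a, torus_a, smul_pow, smul_pow, mul_smul_comm,
    smul_mul_smul_comm, ← mul_pow, inv_mul_cancel₀ hz, one_pow, one_smul] at h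
  rw [hN_apply, hN_apply, h]

theorem hN_one (N : ℕ) : hN (q : ℝ) N 1 = 1 := by
  rw [hN_apply, one_mul, haar_star_a_pow_mul_a_pow, mul_inv_cancel₀]
  exact_mod_cast (qInt_succ_pos q.2.1.le N).ne'

/-- The circle action on the first leg of `Δ(x)` becomes a torus action on the second, and `h_N`
absorbs it. -/
theorem convRight_hN_mem_podles (N : ℕ) (x : Coord (q : ℝ)) :
    convRight (hN q N) x ∈ podles (q : ℝ) := fun z => by
  rw [circleAct_eq_torus, torus_convRight]
  congr 2
  exact LinearMap.ext fun y => hN_torus q N _ _ y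

/-- The degree by which the entries of `u X u^*` shift. -/
def frameDegree : Fin 2 → Fin 2 → ℤ × ℤ := ![![0, (-1, 1)], ![(1, -1), 0]]

theorem frameEntry_mem_homog (i j : Fin 2) {p : ℤ × ℤ} {x : Coord (q : ℝ)}
    (hx : x ∈ homog (q : ℝ) p) : frameEntry q i j x ∈ homog (q : ℝ) (p + frameDegree i j) := by
  have hE := partialE_mem_homog q hx
  have hF := partialF_mem_homog q hx
  have key : ∀ {p' p'' : ℤ × ℤ} {y}, p' = p'' → y ∈ homog (q : ℝ) p' → y ∈ homog (q : ℝ) p'' :=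
    fun h hy => h ▸ hy
  fin_cases i <;> fin_cases j
  · change frameEntry q 0 0 x ∈ homog (q : ℝ) (p + 0)
    rw [frameEntry_zero_zero]
    refine Submodule.sub_mem _ (Submodule.smul_mem _ _ (key ?_
      (homog_mul (homog_mul star_a_mem_homog hF) star_b_mem_homog))) (Submodule.smul_mem _ _ (key ?_
        (homog_mul (homog_mul b_mem_homog hE) a_mem_homog))) <;> ext <;> simp
  · change frameEntry q 0 1 x ∈ homog (q : ℝ) (p + (-1, 1))
    rw [frameEntry_zero_one]
    refine Submodule.sub_mem _ (Submodule.smul_mem _ _ (key ?_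
      (homog_mul (homog_mul star_a_mem_homog hF) star_a_mem_homog))) (Submodule.smul_mem _ _ (key ?_
        (homog_mul (homog_mul b_mem_homog hE) b_mem_homog))) <;> ext <;> simp <;> ring
  · change frameEntry q 1 0 x ∈ homog (q : ℝ) (p + (1, -1))
    rw [frameEntry_one_zero]
    refine Submodule.add_mem _ (Submodule.smul_mem _ _ (key ?_
      (homog_mul (homog_mul star_b_mem_homog hF) star_b_mem_homog))) (Submodule.smul_mem _ _ (key ?_
        (homog_mul (homog_mul a_mem_homog hE) a_mem_homog))) <;> ext <;> simp <;> ring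
  · change frameEntry q 1 1 x ∈ homog (q : ℝ) (p + 0)
    rw [frameEntry_one_one]
    refine Submodule.add_mem _ (Submodule.smul_mem _ _ (key ?_
      (homog_mul (homog_mul star_b_mem_homog hF) star_a_mem_homog))) (Submodule.smul_mem _ _ (key ?_
        (homog_mul (homog_mul a_mem_homog hE) b_mem_homog))) <;> ext <;> simp

theorem convLeft_smul (c : ℂ) (φ : Coord (q : ℝ) →ₗ[ℂ] ℂ) (x : Coord (q : ℝ)) :
    convLeft (c • φ) x = c • convLeft φ x := by
  simp [convLeft, sliceLeft, LinearMap.rTensor_smul]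

theorem convLeft_zero (x : Coord (q : ℝ)) : convLeft (0 : Coord (q : ℝ) →ₗ[ℂ] ℂ) x = 0 := by
  simp [convLeft, sliceLeft, LinearMap.rTensor_zero]

theorem convLeft_pairDirac_mem_homog (i j : Fin 2) {p : ℤ × ℤ} {x : Coord (q : ℝ)}
    (hx : x ∈ homog (q : ℝ) p) :
    convLeft (pairDirac q i j) x ∈ homog (q : ℝ) (p + frameDegree i j) := by
  have key : ∀ {p' p'' : ℤ × ℤ} {y}, p' = p'' → y ∈ homog (q : ℝ) p' → y ∈ homog (q : ℝ) p'' :=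
    fun h hy => h ▸ hy
  fin_cases i <;> fin_cases j
  · change convLeft 0 x ∈ _
    rw [convLeft_zero]
    exact zero_mem _
  · change convLeft ((sqrtq q)⁻¹ • pairF q) x ∈ homog (q : ℝ) (p + (-1, 1))
    rw [convLeft_smul, convLeft_pairF]
    refine Submodule.smul_mem _ _ (key ?_
      (transpose_mem_homog q (partialE_mem_homog q (transpose_mem_homog q hx))))
    ext <;> simp <;> ring
  · change convLeft (sqrtq q • pairE q) x ∈ homog (q : ℝ) (p + (1, -1))
    rw [convLeft_smul, convLeft_pairE]
    refine Submodule.smul_mem _ _ (key ?_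
      (transpose_mem_homog q (partialF_mem_homog q (transpose_mem_homog q hx))))
    ext <;> simp <;> ring
  · change convLeft 0 x ∈ _
    rw [convLeft_zero]
    exact zero_mem _

/-- The degree condition selects the monomials whose image has torus degree zero: powers of `t` for
the diagonal entries, `b^* t^n a` and `b t^n a^*` for the others. No more is needed under a
torus-invariant functional. -/
theorem frameEntry_eq_convLeft (i j : Fin 2) {p : ℤ × ℤ} (hp : p + frameDegree i j = 0) (n : ℕ) :
    frameEntry q i j (mono q p (Polynomial.X ^ n))
      = convLeft (pairDirac q i j) (mono q p (Polynomial.X ^ n)) := by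
  obtain rfl := eq_neg_of_add_eq_zero_left hp
  rw [mono_apply, map_pow, pt_X]
  fin_cases i <;> fin_cases j
  · change frameEntry q 0 0 (bPow q 0 * _ * aPow q 0) = convLeft 0 _
    rw [convLeft_zero]
    simpa [aPow, bPow] using frameEntry_zero_zero_t_pow q n
  · change frameEntry q 0 1 (bPow q (-(1 : ℕ)) * _ * aPow q (1 : ℕ))
      = convLeft ((sqrtq q)⁻¹ • pairF q) (bPow q (-(1 : ℕ)) * _ * aPow q (1 : ℕ))
    rw [aPow_natCast, bPow_neg_natCast, pow_one, pow_one, convLeft_smul, inv_smul_convLeft_pairF]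
  · change frameEntry q 1 0 (bPow q (1 : ℕ) * _ * aPow q (-(1 : ℕ)))
      = convLeft (sqrtq q • pairE q) (bPow q (1 : ℕ) * _ * aPow q (-(1 : ℕ)))
    rw [aPow_neg_natCast, bPow_natCast, pow_one, pow_one, convLeft_smul, mul_t_pow_mul_star_a,
      map_smul, map_smul, smul_comm (sqrtq q), smul_convLeft_pairE]
  · change frameEntry q 1 1 (bPow q 0 * _ * aPow q 0) = convLeft 0 _
    rw [convLeft_zero]
    simpa [aPow, bPow] using frameEntry_one_one_t_pow q n

/-- The key compatibility of `h_N` with the Dirac operator. Both maps shift the torus degree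
equally; outside degree zero `h_N` kills both images, and in degree zero the elements themselves
coincide. -/
theorem hN_frameEntry (N : ℕ) (i j : Fin 2) :
    hN (q : ℝ) N ∘ₗ frameEntry q i j = hN (q : ℝ) N ∘ₗ convLeft (pairDirac q i j) := by
  refine linearMap_ext q.2.1.ne' fun p n => ?_
  rw [LinearMap.comp_apply, LinearMap.comp_apply]
  by_cases hp : p + frameDegree i j = 0
  · rw [frameEntry_eq_convLeft q i j hp]
  · rw [eq_zero_of_mem_homog (hN_torus q N) hp (frameEntry_mem_homog q i j (mono_mem_homog p _)),
      eq_zero_of_mem_homog (hN_torus q N) hp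
        (convLeft_pairDirac_mem_homog q i j (mono_mem_homog p _))]

end QuantumSU2

end

noncomputable section

namespace QuantumSU2

open Coord

variable (q : Set.Ioc (0 : ℝ) 1)

/-! ### The derivation of a Berezin transform -/

theorem sum_mul_sum_mul {R : Type*} [Ring R] {A B X C G P Q : Fin 2 → Fin 2 → R}
    (hP : ∀ p k, ∑ i, A p i * B i k = P p k) (hQ : ∀ l r, ∑ j, C l j * G j r = Q l r)
    (p r : Fin 2) :
    ∑ i, ∑ j, A p i * (∑ k, ∑ l, B i k * X k l * C l j) * G j r
      = ∑ k, ∑ l, P p k * X k l * Q l r := by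
  simp only [← hP, ← hQ, Fin.sum_univ_two]
  noncomm_ring

/-- This is `Δ(u) = (u ⊗ 1)(1 ⊗ u)` as matrices, multiplied on the left by `u^* ⊗ 1` and simplified
by unitarity. -/
theorem sum_fundStar_tmul_mul_comul_fund (p k : Fin 2) :
    ∑ i, (fundStar q p i ⊗ₜ[ℂ] (1 : Coord (q : ℝ))) * comul (fund q i k) = 1 ⊗ₜ fund q p k := by
  have h1 := star_a_mul_a (q := (q : ℝ))
  have h2 := a_mul_star_a (q := (q : ℝ))
  have h3 := b_mul_a (q := (q : ℝ))
  have h5 := star_a_mul_star_b (q := (q : ℝ))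
  have h7 := star_b_mul_b (q := (q : ℝ))
  have h8 := b_mul_star_b (q := (q : ℝ))
  fin_cases p <;> fin_cases k <;>
  simp only [fund, fundStar, Fin.sum_univ_two, Fin.zero_eta, Fin.mk_one, Matrix.cons_val_zero,
    Matrix.cons_val_one, map_smul, comul_a, comul_b, comul_star_a, comul_star_b, mul_add, mul_sub,
    smul_mul_assoc, mul_smul_comm, Algebra.TensorProduct.tmul_mul_tmul, one_mul,
    ← TensorProduct.smul_tmul', TensorProduct.tmul_smul, h1, h2, h3, h5, h7, h8,
    TensorProduct.sub_tmul] <;>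
  module

theorem sum_comul_fundStar_mul_fund_tmul (l r : Fin 2) :
    ∑ j, comul (fundStar q l j) * (fund q j r ⊗ₜ[ℂ] (1 : Coord (q : ℝ))) = 1 ⊗ₜ fundStar q l r := by
  have h1 := star_a_mul_a (q := (q : ℝ))
  have h2 := a_mul_star_a (q := (q : ℝ))
  have h3 := b_mul_a (q := (q : ℝ))
  have h5 := star_a_mul_star_b (q := (q : ℝ))
  have h7 := star_b_mul_b (q := (q : ℝ))
  have h8 := b_mul_star_b (q := (q : ℝ))
  fin_cases l <;> fin_cases r <;>
  simp only [fund, fundStar, Fin.sum_univ_two, Fin.zero_eta, Fin.mk_one, Matrix.cons_val_zero,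
    Matrix.cons_val_one, map_smul, comul_a, comul_b, comul_star_a, comul_star_b, add_mul, sub_mul,
    smul_mul_assoc, mul_smul_comm, Algebra.TensorProduct.tmul_mul_tmul, mul_one,
    ← TensorProduct.smul_tmul', TensorProduct.tmul_smul, h1, h2, h3, h5, h7, h8,
    TensorProduct.sub_tmul] <;>
  module

theorem convRight_smul (c : ℂ) (φ : Coord (q : ℝ) →ₗ[ℂ] ℂ) (x : Coord (q : ℝ)) :
    convRight (c • φ) x = c • convRight φ x := by
  simp [convRight, sliceRight, LinearMap.lTensor_smul]

theorem convRight_add (φ ψ : Coord (q : ℝ) →ₗ[ℂ] ℂ) (x : Coord (q : ℝ)) :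
    convRight (φ + ψ) x = convRight φ x + convRight ψ x := by
  simp [convRight, sliceRight, LinearMap.lTensor_add]

theorem commEntry_eq_convRight (k l : Fin 2) : commEntry q k l = convRight (pairDirac q k l) := by
  have h0 : (0 : Coord (q : ℝ) →ₗ[ℂ] Coord (q : ℝ)) = convRight 0 := by
    simp [convRight, sliceRight]
  have h1 : ∀ (c : ℂ) φ, c • convRight φ = convRight (q := (q : ℝ)) (c • φ) := fun c φ =>
    LinearMap.ext fun x => (convRight_smul q c φ x).symm
  fin_cases k <;> fin_cases l
  · exact h0
  · exact h1 _ (pairF q)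
  · exact h1 _ (pairE q)
  · exact h0

/-- The matrix `X` of a Berezin transform is `u^* β_N(u X u^*) u`. -/
theorem commEntry_convRight_hN (N : ℕ) (p r : Fin 2) (x : Coord (q : ℝ)) :
    commEntry q p r (convRight (hN q N) x)
      = ∑ i, ∑ j, fundStar q p i * convRight (hN q N) (frameEntry q i j x) * fund q j r := by
  have h1 : ∀ i j, fundStar q p i * convRight (hN q N) (frameEntry q i j x) * fund q j r
      = sliceRight (hN q N) ((fundStar q p i ⊗ₜ 1) * (∑ k, ∑ l, comul (fund q i k) *
        comul (commEntry q k l x) * comul (fundStar q l j)) * (fund q j r ⊗ₜ 1)) := fun i j => by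
    rw [sliceRight_tmul_one_mul, convRight_apply, frameEntry_apply]
    simp only [map_sum, map_mul]
  simp only [h1, ← map_sum]
  rw [sum_mul_sum_mul (A := fun p i => fundStar q p i ⊗ₜ[ℂ] (1 : Coord (q : ℝ)))
    (B := fun i k => comul (fund q i k)) (C := fun l j => comul (fundStar q l j))
    (G := fun j r => fund q j r ⊗ₜ[ℂ] (1 : Coord (q : ℝ)))
    (X := fun k l => comul (commEntry q k l x))
    (sum_fundStar_tmul_mul_comul_fund q) (sum_comul_fundStar_mul_fund_tmul q)]
  simp only [map_sum, sliceRight_one_tmul_mul, ← convRight_apply]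
  have h3 : ∀ k l φ, convRight φ (commEntry q k l x) = convRight (φ ∘ₗ commEntry q k l) x :=
    fun k l φ => by rw [commEntry_eq_convRight, convRight_convRight]
  rw [commEntry_eq_convRight, convRight_convRight]
  -- Pairing after right convolution equals `h_N` after left convolution, and `hN_frameEntry`
  -- replaces the latter by the frame entry. Both sides of the identity are then right convolutions
  -- of `x` by the same functional.
  have h2 : pairDirac q p r ∘ₗ convRight (hN q N) = hN (q : ℝ) N ∘ₗ frameEntry q p r := by
    rw [hN_frameEntry]
    exact LinearMap.ext fun y => apply_convRight _ _ y
  simp only [h2, h3, frameEntry, Fin.sum_univ_two, LinearMap.comp_add, convRight_add]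
  rfl

/-! ### Norm estimates -/

/-- The square of the norm of a pair of elements of `𝒪(SU_q(2))`. -/
def vecNormSq {q : ℝ} (ξ : Fin 2 → Coord q) : ℝ := ∑ i, ‖toL2 q (ξ i)‖ ^ 2

/-- The action of a matrix over `𝒪(SU_q(2))` by left multiplication. -/
def matVec {q : ℝ} (M : Fin 2 → Fin 2 → Coord q) (ξ : Fin 2 → Coord q) (i : Fin 2) : Coord q :=
  ∑ j, M i j * ξ j

theorem vecNormSq_eq {q : ℝ} (ξ : Fin 2 → Coord q) :
    vecNormSq ξ = (haar q (∑ i, star (ξ i) * ξ i)).re := by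
  rw [map_sum, Complex.re_sum]
  exact Finset.sum_congr rfl fun i _ => norm_toL2_sq _

theorem vecNormSq_matVec {q : ℝ} {M : Fin 2 → Fin 2 → Coord q}
    (hM : ∀ j k, ∑ i, star (M i j) * M i k = if j = k then 1 else 0) (ξ : Fin 2 → Coord q) :
    vecNormSq (matVec M ξ) = vecNormSq ξ := by
  have h : ∑ i, star (matVec M ξ i) * matVec M ξ i
      = ∑ j, ∑ k, star (ξ j) * (∑ i, star (M i j) * M i k) * ξ k := by
    simp only [matVec, Fin.sum_univ_two, star_add, star_mul]
    noncomm_ring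
  rw [vecNormSq_eq, vecNormSq_eq, h]
  simp [hM]

theorem star_fund (i j : Fin 2) : star (fund q i j) = fundStar q j i := by
  fin_cases i <;> fin_cases j <;> simp [fund, fundStar, -Complex.coe_smul, star_smul]

theorem star_fundStar (i j : Fin 2) : star (fundStar q i j) = fund q j i := by
  rw [← star_fund, star_star]

theorem sum_fundStar_mul_fund (j k : Fin 2) :
    ∑ i, fundStar q j i * fund q i k = if j = k then 1 else 0 := by
  have h1 := star_a_mul_a (q := (q : ℝ))
  have h2 := a_mul_star_a (q := (q : ℝ))
  have h3 := b_mul_a (q := (q : ℝ))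
  have h5 := star_a_mul_star_b (q := (q : ℝ))
  have h7 := star_b_mul_b (q := (q : ℝ))
  have h8 := b_mul_star_b (q := (q : ℝ))
  fin_cases j <;> fin_cases k <;>
  simp [fund, fundStar, -Complex.coe_smul, h1, h2, h3, h5, h7, h8, smul_smul, sq]

theorem sum_fund_mul_fundStar (j k : Fin 2) :
    ∑ i, fund q j i * fundStar q i k = if j = k then 1 else 0 := by
  have h1 := star_a_mul_a (q := (q : ℝ))
  have h2 := a_mul_star_a (q := (q : ℝ))
  have h4 := star_b_mul_a (q := (q : ℝ))
  have h6 := star_a_mul_b (q := (q : ℝ))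
  have h7 := star_b_mul_b (q := (q : ℝ))
  have h8 := b_mul_star_b (q := (q : ℝ))
  fin_cases j <;> fin_cases k <;>
  simp [fund, fundStar, -Complex.coe_smul, h1, h2, h4, h6, h7, h8, smul_smul, sq]

theorem vecNormSq_fund (ξ : Fin 2 → Coord (q : ℝ)) :
    vecNormSq (matVec (fund q) ξ) = vecNormSq ξ :=
  vecNormSq_matVec (by simpa only [star_fund] using sum_fundStar_mul_fund q) ξ

theorem vecNormSq_fundStar (ξ : Fin 2 → Coord (q : ℝ)) :
    vecNormSq (matVec (fundStar q) ξ) = vecNormSq ξ :=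
  vecNormSq_matVec (by simpa only [star_fundStar] using sum_fund_mul_fundStar q) ξ

theorem matVec_conj {q : ℝ} (A X B : Fin 2 → Fin 2 → Coord q) (ξ : Fin 2 → Coord q) :
    matVec (fun i j => ∑ k, ∑ l, A i k * X k l * B l j) ξ = matVec A (matVec X (matVec B ξ)) := by
  funext i
  simp only [matVec, Fin.sum_univ_two]
  noncomm_ring

theorem vecNormSq_commEntry_le (x : podles (q : ℝ)) {ξ : Fin 2 → Coord (q : ℝ)}
    (h0 : ξ 0 ∈ spectralSubspace (q : ℝ) 1) (h1 : ξ 1 ∈ spectralSubspace (q : ℝ) (-1)) :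
    vecNormSq (matVec (fun i j => commEntry q i j x) ξ) ≤ ‖commutator q x‖ ^ 2 * vecNormSq ξ := by
  have h := (commutator q x).le_opNorm (spinor q ⟨_, h0⟩ ⟨_, h1⟩)
  have h' := pow_le_pow_left₀ (norm_nonneg _) h 2
  rw [mul_pow, norm_commutator_spinor_sq, norm_spinor_sq] at h'
  simpa [vecNormSq, matVec, commEntry] using h'

/-- The rows of `u^*` lie in `𝒜_1` and `𝒜_{-1}`, so `u^*` carries pairs from `𝒜_0` isometrically to
spinors. There `X(x)` is the commutator, and the final multiplication by `u` preserves the norm. -/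
theorem vecNormSq_frameEntry_le_of_podles (x : podles (q : ℝ)) {ξ : Fin 2 → Coord (q : ℝ)}
    (hξ : ∀ i, ξ i ∈ spectralSubspace (q : ℝ) 0) :
    vecNormSq (matVec (fun i j => frameEntry q i j x) ξ)
      ≤ ‖commutator q x‖ ^ 2 * vecNormSq ξ := by
  simp only [frameEntry_apply]
  rw [matVec_conj, vecNormSq_fund, ← vecNormSq_fundStar q ξ]
  have key : ∀ {n : ℤ} {y : Coord (q : ℝ)} (i : Fin 2), y ∈ spectralSubspace (q : ℝ) n →
      y * ξ i ∈ spectralSubspace (q : ℝ) n := fun i hy => by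
    have := spectralSubspace_mul q hy (hξ i)
    rwa [add_zero] at this
  refine vecNormSq_commEntry_le q x ?_ ?_
  · rw [matVec, Fin.sum_univ_two]
    exact Submodule.add_mem _ (key 0 (a_mem_spectralSubspace q)) (key 1 (b_mem_spectralSubspace q))
  · rw [matVec, Fin.sum_univ_two]
    exact Submodule.add_mem _ (key 0 (Submodule.smul_mem _ _ (star_b_mem_spectralSubspace q)))
      (key 1 (star_a_mem_spectralSubspace q))

/-- The modular property moves the right factors together: the weighted sum becomes `h(x^* x (a^* a
+ q^2 b b^*)) = h(x^* x)`. The factor `q^{-2}` compensates the `q^2` produced by commuting `a` past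
the rest. -/
theorem norm_toL2_mul_star_a_sq_add (x : Coord (q : ℝ)) :
    ((q : ℝ) ^ 2)⁻¹ * ‖toL2 (q : ℝ) (x * star (a q))‖ ^ 2
      + (q : ℝ) ^ 2 * ‖toL2 (q : ℝ) (x * star (b q))‖ ^ 2 = ‖toL2 (q : ℝ) x‖ ^ 2 := by
  have hq := q.2.1.ne'
  have h1 : haar (q : ℝ) (star (x * star (a q)) * (x * star (a q)))
      = (((q : ℝ) ^ 2 : ℝ) : ℂ) * haar (q : ℝ) (star x * x * (star (a q) * a q)) := by
    rw [star_mul, star_star, mul_assoc, haar_a_mul]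
    simp only [mul_assoc, Complex.ofReal_pow]
  have h2 : haar (q : ℝ) (star (x * star (b q)) * (x * star (b q)))
      = haar (q : ℝ) (star x * x * t (q : ℝ)) := by
    rw [star_mul, star_star, mul_assoc, haar_b_mul, ← star_b_mul_b]
    simp only [mul_assoc]
  rw [norm_toL2_sq, norm_toL2_sq, norm_toL2_sq, h1, h2, Complex.re_ofReal_mul, ← mul_assoc,
    inv_mul_cancel₀ (pow_ne_zero 2 hq), one_mul, ← Complex.re_ofReal_mul, ← Complex.add_re,
    Complex.ofReal_pow, ← smul_eq_mul (a := ((q : ℝ) : ℂ) ^ 2), ← map_smul, ← map_add,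
    ← mul_smul_comm, ← mul_add,
    star_a_mul_a, sub_add_cancel, mul_one]

theorem vecNormSq_mul_star_a_add (ξ : Fin 2 → Coord (q : ℝ)) :
    ((q : ℝ) ^ 2)⁻¹ * vecNormSq (fun i => ξ i * star (a q))
      + (q : ℝ) ^ 2 * vecNormSq (fun i => ξ i * star (b q)) = vecNormSq ξ := by
  simp only [vecNormSq, Finset.mul_sum, ← Finset.sum_add_distrib, norm_toL2_mul_star_a_sq_add]

theorem matVec_mul_right {q : ℝ} (M : Fin 2 → Fin 2 → Coord q) (ξ : Fin 2 → Coord q) (c : Coord q) :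
    matVec M (fun i => ξ i * c) = fun i => matVec M ξ i * c := by
  funext i
  simp only [matVec, Finset.sum_mul, mul_assoc]

/-- A bound on `𝒜_0` for left multiplication by a matrix holds on every `𝒜_n` with `n ≥ 0`. -/
theorem vecNormSq_matVec_le {M : Fin 2 → Fin 2 → Coord (q : ℝ)} {C : ℝ}
    (h : ∀ ξ, (∀ i, ξ i ∈ spectralSubspace (q : ℝ) 0) →
      vecNormSq (matVec M ξ) ≤ C * vecNormSq ξ) (n : ℕ) :
    ∀ ξ, (∀ i, ξ i ∈ spectralSubspace (q : ℝ) n) → vecNormSq (matVec M ξ) ≤ C * vecNormSq ξ := by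
  have hq := q.2.1
  induction n with
  | zero => exact h
  | succ n ih =>
    intro ξ hξ
    have e : ((n + 1 : ℕ) : ℤ) + -1 = n := by push_cast; ring
    have ha := ih (fun i => ξ i * star (a q)) fun i =>
      e ▸ spectralSubspace_mul q (hξ i) (star_a_mem_spectralSubspace q)
    have hb := ih (fun i => ξ i * star (b q)) fun i =>
      e ▸ spectralSubspace_mul q (hξ i) (star_b_mem_spectralSubspace q)
    -- Left multiplication by `M` commutes with the right multiplications, so the bounds in degree
    -- `n` for the two components add up to the bound in degree `n + 1`.
    rw [matVec_mul_right] at ha hb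
    rw [← vecNormSq_mul_star_a_add, ← vecNormSq_mul_star_a_add q ξ, mul_add, mul_left_comm C,
      mul_left_comm C]
    gcongr

/-! ### The Kraus decomposition of the Berezin transform -/

/-- The element `1 ⊗ a^N` is `∑ i, Δ(v i) (c i ⊗ 1)` with all `v i` in `𝒜_N`. -/
theorem exists_one_tmul_a_pow (N : ℕ) : ∃ (ι : Type) (_ : Fintype ι) (v c : ι → Coord (q : ℝ)),
    (∀ i, v i ∈ spectralSubspace (q : ℝ) N) ∧
    (1 ⊗ₜ[ℂ] (a q ^ N) = ∑ i, comul (v i) * (c i ⊗ₜ[ℂ] (1 : Coord (q : ℝ)))) ∧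
    (1 ⊗ₜ[ℂ] (star (a q) ^ N) = ∑ i,
    (star (c i) ⊗ₜ[ℂ] (1 : Coord (q : ℝ))) * comul (star (v i))) := by
  have h2 := a_mul_star_a (q := (q : ℝ))
  have h5 := star_a_mul_star_b (q := (q : ℝ))
  have h3 := b_mul_a (q := (q : ℝ))
  have h8 := b_mul_star_b (q := (q : ℝ))
  -- On the right the coefficient of `a` in the second leg is `a a^* + b b^* = 1`, and that of `b`
  -- is `a^* b^* - q b^* a^* = 0`.
  have ha : 1 ⊗ₜ[ℂ] a q = comul (a q) * (star (a q) ⊗ₜ[ℂ] (1 : Coord (q : ℝ)))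
      + comul (b q) * (star (b q) ⊗ₜ[ℂ] (1 : Coord (q : ℝ))) := by
    rw [comul_a, comul_b]
    simp only [add_mul, sub_mul, smul_mul_assoc, Algebra.TensorProduct.tmul_mul_tmul, mul_one, h2,
      h5, h8, ← TensorProduct.smul_tmul', TensorProduct.sub_tmul]
    module
  have ha' : 1 ⊗ₜ[ℂ] star (a q) = (a q ⊗ₜ[ℂ] (1 : Coord (q : ℝ))) * comul (star (a q))
      + (b q ⊗ₜ[ℂ] (1 : Coord (q : ℝ))) * comul (star (b q)) := by
    rw [comul_star_a, comul_star_b]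
    simp only [mul_add, mul_sub, mul_smul_comm, Algebra.TensorProduct.tmul_mul_tmul, one_mul, h2,
      h3, h8, ← TensorProduct.smul_tmul', TensorProduct.sub_tmul]
    module
  induction N with
  | zero =>
    refine ⟨Unit, inferInstance, fun _ => 1, fun _ => 1, fun _ => ?_, ?_, ?_⟩
    · exact (mem_podles_iff q).1 (one_mem _)
    · simp [Algebra.TensorProduct.one_def]
    · simp [Algebra.TensorProduct.one_def]
  | succ N ih =>
    obtain ⟨ι, _, v, c, hv, h, h'⟩ := ih
    -- The index set doubles at each stage: the `v i` are the words of length `N` in `a` and `b`,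
    -- and the `c i` are their adjoints.
    refine ⟨ι ⊕ ι, inferInstance, Sum.elim (fun i => v i * a q) (fun i => v i * b q),
      Sum.elim (fun i => star (a q) * c i) (fun i => star (b q) * c i), ?_, ?_, ?_⟩
    · rintro (i | i)
      · exact spectralSubspace_mul q (hv i) (a_mem_spectralSubspace q)
      · exact spectralSubspace_mul q (hv i) (b_mem_spectralSubspace q)
    · have e : (1 : Coord (q : ℝ)) ⊗ₜ[ℂ] (a q ^ (N + 1)) = (1 ⊗ₜ (a q ^ N)) * (1 ⊗ₜ a q) := by
        rw [Algebra.TensorProduct.tmul_mul_tmul, one_mul, pow_succ]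
      have e2 : ∀ i, (c i ⊗ₜ[ℂ] (1 : Coord (q : ℝ))) * (1 ⊗ₜ a q)
          = (1 ⊗ₜ a q) * (c i ⊗ₜ 1) := fun i => by
        simp only [Algebra.TensorProduct.tmul_mul_tmul, one_mul, mul_one]
      rw [e, h, Finset.sum_mul, Fintype.sum_sum_type, ← Finset.sum_add_distrib]
      refine Finset.sum_congr rfl fun i _ => ?_
      have e3 : ∀ x y : Coord (q : ℝ), (x * y) ⊗ₜ[ℂ] (1 : Coord (q : ℝ))
          = (x ⊗ₜ 1) * (y ⊗ₜ 1) := fun x y => by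
        rw [Algebra.TensorProduct.tmul_mul_tmul, mul_one]
      rw [mul_assoc, e2, ha]
      simp only [Sum.elim_inl, Sum.elim_inr, map_mul, e3, add_mul, mul_add, mul_assoc]
    · have e : (1 : Coord (q : ℝ)) ⊗ₜ[ℂ] (star (a q) ^ (N + 1))
          = (1 ⊗ₜ star (a q)) * (1 ⊗ₜ (star (a q) ^ N)) := by
        rw [Algebra.TensorProduct.tmul_mul_tmul, one_mul, pow_succ']
      have e2 : ∀ i, (1 ⊗ₜ star (a q)) * (star (c i) ⊗ₜ[ℂ] (1 : Coord (q : ℝ)))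
          = (star (c i) ⊗ₜ 1) * (1 ⊗ₜ star (a q)) := fun i => by
        simp only [Algebra.TensorProduct.tmul_mul_tmul, one_mul, mul_one]
      rw [e, h', Finset.mul_sum, Fintype.sum_sum_type, ← Finset.sum_add_distrib]
      refine Finset.sum_congr rfl fun i _ => ?_
      have e3 : ∀ x y : Coord (q : ℝ), (x * y) ⊗ₜ[ℂ] (1 : Coord (q : ℝ))
          = (x ⊗ₜ 1) * (y ⊗ₜ 1) := fun x y => by
        rw [Algebra.TensorProduct.tmul_mul_tmul, mul_one]
      rw [← mul_assoc, e2, ha']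
      simp only [Sum.elim_inl, Sum.elim_inr, map_mul, star_mul, star_star, e3, add_mul, mul_add,
          mul_assoc]

/-- Writing `1 ⊗ a^N` through coproducts gathers the second leg into `Δ(v_i^* m v_j)`, which the
invariant state slices to a scalar. Thus `β_N` compresses `m` to the span of the `v_i` in `𝒜_N` and
then conjugates by the `c_i`, so it is completely positive. -/
theorem exists_convRight_hN_eq_sum (N : ℕ) : ∃ (ι : Type) (_ : Fintype ι) (v c : ι → Coord (q : ℝ)),
    (∀ i, v i ∈ spectralSubspace (q : ℝ) N) ∧ ∀ m, convRight (hN q N) m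
      = (qInt q (N + 1) : ℂ) • ∑ i, ∑ j,
      haar (q : ℝ) (star (v i) * m * v j) • (star (c i) * c j) := by
  obtain ⟨ι, hι, v, c, hv, h, h'⟩ := exists_one_tmul_a_pow q N
  refine ⟨ι, hι, v, c, hv, fun m => ?_⟩
  have e : hN (q : ℝ) N = (qInt q (N + 1) : ℂ) • (haar (q : ℝ) ∘ₗ LinearMap.mulRight ℂ (a q ^ N) ∘ₗ
      LinearMap.mulLeft ℂ (star (a q) ^ N)) := LinearMap.ext fun y => by
    simp [hN_apply, mul_assoc]
  have e1 : convRight (hN (q : ℝ) N) m = (qInt q (N + 1) : ℂ) • sliceRight (haar (q : ℝ))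
      ((1 ⊗ₜ (star (a q) ^ N)) * comul m * (1 ⊗ₜ (a q ^ N))) := by
    rw [sliceRight_one_tmul_mul, e, convRight_smul, convRight_apply]
  rw [e1, h, h', Finset.sum_mul, Finset.sum_mul, map_sum]
  congr 1
  refine Finset.sum_congr rfl fun i _ => ?_
  rw [Finset.mul_sum, map_sum]
  refine Finset.sum_congr rfl fun j _ => ?_
  have e2 : (star (c i) ⊗ₜ[ℂ] (1 : Coord (q : ℝ))) * comul (star (v i)) * comul m *
      (comul (v j) * (c j ⊗ₜ[ℂ] (1 : Coord (q : ℝ))))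
      = (star (c i) ⊗ₜ[ℂ] (1 : Coord (q : ℝ))) * comul (star (v i) * m * v j) * (c j ⊗ₜ[ℂ] 1) := by
    simp only [map_mul, mul_assoc]
  rw [e2, sliceRight_tmul_one_mul, ← convRight_apply, convRight_haar, mul_smul_comm, mul_one,
    smul_mul_assoc]

end QuantumSU2

end

/-! ### Contractivity of the Berezin transform on matrices -/

noncomputable section

namespace QuantumSU2

open Coord

variable (q : Set.Ioc (0 : ℝ) 1)

-- A Gram matrix is positive semidefinite, hence of the form `B^* B`. This works for a semidefinite
-- form, so `h` need not be faithful.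
open scoped MatrixOrder in
theorem exists_gram_eq_sum {q : ℝ} {κ : Type} [Fintype κ] (ζ : κ → Coord q) :
    ∃ B : κ → κ → ℂ, ∀ i j, haar q (star (ζ i) * ζ j) = ∑ r, star (B r i) * B r j := by
  classical
  obtain ⟨B, hB⟩ := CStarAlgebra.nonneg_iff_eq_star_mul_self.mp
    (Matrix.posSemidef_gram ℂ fun i => toL2 q (ζ i)).nonneg
  refine ⟨B, fun i j => ?_⟩
  have h := congrFun (congrFun hB i) j
  rwa [Matrix.gram_apply, inner_toL2] at h

/-- A Stinespring-type formula: matrix coefficients of `β_N(m)` at arbitrary vectors are sums of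
matrix coefficients of `m` at vectors in `𝒜_N`. The vectors `w` do not depend on `m`, so one family
serves all the entries of a matrix. -/
theorem exists_haar_convRight_hN_eq_sum (N : ℕ) {J : Type} [Fintype J] (η : J → Coord (q : ℝ)) :
    ∃ (R : Type) (_ : Fintype R) (w : R → J → Coord (q : ℝ)),
      (∀ r j, w r j ∈ spectralSubspace (q : ℝ) N) ∧
      ∀ m j k, haar (q : ℝ) (star (η j) * convRight (hN q N) m * η k)
        = ∑ r, haar (q : ℝ) (star (w r j) * m * w r k) := by
  obtain ⟨ι, _, v, c, hv, h⟩ := exists_convRight_hN_eq_sum q N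
  obtain ⟨B, hB⟩ := exists_gram_eq_sum fun p : ι × J => c p.1 * η p.2
  have hn := qInt_nonneg q.2.1.le (N + 1)
  set s : ℂ := ((√(qInt q (N + 1)) : ℝ) : ℂ) with hs
  have hss : star s * s = (qInt q (N + 1) : ℂ) := by
    rw [hs, RCLike.star_def, Complex.conj_ofReal, ← Complex.ofReal_mul, Real.mul_self_sqrt hn]
  -- Here `B` factors the Gram matrix of the vectors `c_i η_j`, and `s` distributes the prefactor
  -- `⟨N+1⟩` of `h_N` as a square root over the two arguments.
  refine ⟨ι × J, inferInstance, fun r j => s • ∑ i, B r (i, j) • v i, fun r j =>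
    Submodule.smul_mem _ _ (Submodule.sum_mem _ fun i _ => Submodule.smul_mem _ _ (hv i)),
    fun m j k => ?_⟩
  have h1 : ∀ r : ι × J, haar (q : ℝ) (star (s • ∑ i, B r (i, j) • v i) * m *
      (s • ∑ i, B r (i, k) • v i)) = (qInt q (N + 1) : ℂ) * ∑ i, ∑ i', star (B r (i, j)) *
        B r (i', k) * haar (q : ℝ) (star (v i) * m * v i') := fun r => by
    rw [star_smul, smul_mul_assoc, smul_mul_smul_comm, map_smul, hss, smul_eq_mul, star_sum,
      Finset.sum_mul, Finset.sum_mul, map_sum]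
    congr 1
    refine Finset.sum_congr rfl fun i _ => ?_
    rw [Finset.mul_sum, map_sum]
    refine Finset.sum_congr rfl fun i' _ => ?_
    rw [star_smul, smul_mul_assoc, smul_mul_smul_comm, map_smul, smul_eq_mul]
  simp only [h1]
  rw [h, mul_smul_comm, smul_mul_assoc, map_smul, smul_eq_mul, ← Finset.mul_sum, Finset.mul_sum,
    Finset.sum_mul, map_sum, Finset.sum_comm]
  congr 1
  refine Finset.sum_congr rfl fun i _ => ?_
  rw [Finset.mul_sum, Finset.sum_mul, map_sum, Finset.sum_comm]
  refine Finset.sum_congr rfl fun i' _ => ?_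
  have h2 : star (η j) * (star (c i) * c i') * η k = star (c i * η j) * (c i' * η k) := by
    simp only [star_mul, mul_assoc]
  rw [mul_smul_comm, smul_mul_assoc, map_smul, h2, hB (i, j) (i', k), smul_eq_mul, mul_comm,
    Finset.sum_mul]

theorem two_mul_re_sum_haar_le {q : ℝ} (x y : Fin 2 → Coord q) :
    2 * (∑ k, haar q (star (x k) * y k)).re ≤ vecNormSq x + vecNormSq y := by
  simp only [vecNormSq, Complex.re_sum, Finset.mul_sum, ← Finset.sum_add_distrib]
  refine Finset.sum_le_sum fun k _ => ?_
  have h1 : (haar q (star (x k) * y k)).re ≤ ‖toL2 q (x k)‖ * ‖toL2 q (y k)‖ := by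
    rw [← inner_toL2]
    exact re_inner_le_norm (𝕜 := ℂ) _ _
  nlinarith [sq_nonneg (‖toL2 q (x k)‖ - ‖toL2 q (y k)‖)]

theorem convRight_hN_one (N : ℕ) : convRight (hN (q : ℝ) N) 1 = 1 := by
  rw [convRight_apply, map_one, Algebra.TensorProduct.one_def, sliceRight_tmul, hN_one, one_smul]

/-- The Berezin transform does not increase the norm of a matrix, measured on `𝒜_N`. -/
theorem vecNormSq_convRight_hN_le (N : ℕ) {M : Fin 2 → Fin 2 → Coord (q : ℝ)} {C : ℝ}
    (h : ∀ ξ, (∀ i, ξ i ∈ spectralSubspace (q : ℝ) N) →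
      vecNormSq (matVec M ξ) ≤ C * vecNormSq ξ) (η : Fin 2 → Coord (q : ℝ)) :
    vecNormSq (matVec (fun i j => convRight (hN q N) (M i j)) η) ≤ C * vecNormSq η := by
  set θ := matVec (fun i j => convRight (hN q N) (M i j)) η with hθ
  -- Input and output are decomposed together, because `‖θ‖²` is to be expanded as the mixed
  -- coefficient between `θ` and `η`. The choice `m = 1` shows that the decomposition preserves
  -- norms.
  obtain ⟨R, _, w, hw, hsum⟩ := exists_haar_convRight_hN_eq_sum q N (Sum.elim η θ)
  have norm : ∀ (f : Fin 2 → Fin 2 ⊕ Fin 2), vecNormSq (fun i => Sum.elim η θ (f i))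
      = ∑ r, vecNormSq fun i => w r (f i) := fun f => by
    simp only [vecNormSq_eq, map_sum, Complex.re_sum]
    rw [Finset.sum_comm]
    refine Finset.sum_congr rfl fun i _ => ?_
    rw [← Complex.re_sum]
    have := hsum 1 (f i) (f i)
    rw [convRight_hN_one, mul_one] at this
    rw [this]
    simp only [mul_one]
  have hη : vecNormSq η = ∑ r, vecNormSq fun i => w r (Sum.inl i) := norm Sum.inl
  have hθ' : vecNormSq θ = ∑ r, vecNormSq fun i => w r (Sum.inr i) := norm Sum.inr
  have hmain : vecNormSq θ
      = ∑ r, (∑ k, haar (q : ℝ) (star (w r (Sum.inr k)) * matVec M (fun i => w r (Sum.inl i))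
      k)).re := by
    rw [vecNormSq_eq, ← Complex.re_sum, Finset.sum_comm, map_sum]
    congr 1
    refine Finset.sum_congr rfl fun k _ => ?_
    conv_lhs => rw [hθ]
    simp only [matVec, Finset.mul_sum, map_sum, ← mul_assoc]
    rw [Finset.sum_comm]
    refine Finset.sum_congr rfl fun j _ => ?_
    exact hsum (M k j) (Sum.inr k) (Sum.inl j)
  -- Young's inequality applied to each mixed term; one copy of `‖θ‖²` is then cancelled.
  have hle : 2 * vecNormSq θ ≤ vecNormSq θ + C * vecNormSq η := by
    calc 2 * vecNormSq θ ≤ ∑ r, (vecNormSq (fun i => w r (Sum.inr i))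
          + C * vecNormSq fun i => w r (Sum.inl i)) := by
          rw [hmain, Finset.mul_sum]
          refine Finset.sum_le_sum fun r _ => (two_mul_re_sum_haar_le _ _).trans ?_
          gcongr
          exact h _ fun i => hw r _
      _ = _ := by rw [Finset.sum_add_distrib, ← Finset.mul_sum, ← hθ', ← hη]
  linarith

/-- The bound for `u X(x) u^*` travels from `𝒜_0` to `𝒜_N`, and through `β_N` to arbitrary vectors.
It is applied to `u` times the spinor, where conjugating back by `u` turns `β_N(u X(x) u^*)` into
`X(β_N(x))`. -/
theorem norm_commutator_convRight_hN_le (N : ℕ) (x : podles (q : ℝ)) :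
    ‖commutator q ⟨convRight (hN q N) x, convRight_hN_mem_podles q N x⟩‖ ≤ ‖commutator q x‖ := by
  refine norm_commutator_le q (ContinuousLinearMap.opNorm_nonneg _) fun y₁ _ y₂ _ => ?_
  have h := vecNormSq_convRight_hN_le q N (vecNormSq_matVec_le q
    (fun ξ => vecNormSq_frameEntry_le_of_podles q x) N) (matVec (fund q) ![y₁, y₂])
  rw [vecNormSq_fund, ← vecNormSq_fundStar, ← matVec_conj] at h
  simp only [← commEntry_convRight_hN] at h
  simpa [vecNormSq, matVec, commEntry] using h

end QuantumSU2

end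

open QuantumSU2 in
theorem mainTheorem4 (q : Set.Ioc (0 : ℝ) 1) (N : ℕ) (x : podles (q : ℝ)) :
    IsDiracCommutator q x (derivation q x) ∧
    ∃ hβ : berezin (q : ℝ) N x ∈ podles (q : ℝ),
      IsDiracCommutator q ⟨berezin (q : ℝ) N x, hβ⟩
        (derivation q ⟨berezin (q : ℝ) N x, hβ⟩) ∧
      ‖derivation q ⟨berezin (q : ℝ) N x, hβ⟩‖ ≤ ‖derivation q x‖ := by
  refine ⟨isDiracCommutator_derivation q x, convRight_hN_mem_podles q N x,
    isDiracCommutator_derivation q _, ?_⟩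
  rw [derivation_eq_commutator, derivation_eq_commutator]
  exact norm_commutator_convRight_hN_le q N x
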